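/- Let $\mathcal Z$ be a locally compact, separable, metrizable space and let $\mathcal M$ be a compact metrizable $p$-dimensional foliated space modelled transversely on $\mathcal Z$; that is, $\mathcal M$ has an atlas of homeomorphisms $\varphi=(y,z)\colon U\to B_1\times B_2$ from open sets $U\subset\mathcal M$ onto products of a connected open set $B_1\subset\mathbb R^p$ and an open set $B_2\subset\mathcal Z$, whose coordinate changes are leafwise smooth: for every $k$ they are locally of the form $(y,z)\mapsto(f_1(y,z),f_2(z))$ with $f_2$ continuous and $f_1$ of class $C^k_L$. Here a function of $(y,z)$ is of class $C^k_L$ if it is $C^k$ in $y$ and its $y$-derivatives of order at most $k$ are jointly continuous in $(y,z)$. A function on $\mathcal M$ is leafwise $C^k$ if it is of class $C^k_L$ in every chart; a vector field tangent to the leaves is leafwise $C^k$ if its components with respect to $\partial/\partial y^1,\dots,\partial/\partial y^p$ are of class $C^k_L$ in every chart. Let $\alpha\in(1/3,1/2)$, $T>0$ and $d\ge 0$. An $\alpha$-Hölder rough path is a continuous map $\mathbf w=(\mathbf w^1,\mathbf w^2)$ from $\{0\le s\le t\le T\}$ to $\mathbb R^d\oplus(\mathbb R^d\otimes\mathbb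 R^d)$ such that $\mathbf w^1_{s,t}=\mathbf w^1_{s,u}+\mathbf w^1_{u,t}$ and $\mathbf w^2_{s,t}=\mathbf w^2_{s,u}+\mathbf w^2_{u,t}+\mathbf w^1_{s,u}\otimes\mathbf w^1_{u,t}$ for $s\le u\le t$, and $\|\mathbf w^i\|_{i\alpha}:=\sup_{s<t}|\mathbf w^i_{s,t}|/(t-s)^{i\alpha}<\infty$ for $i=1,2$. Let $d_\alpha(\mathbf w,\hat{\mathbf w})=\max_{i=1,2}\|\mathbf w^i-\hat{\mathbf w}^i\|_{i\alpha}$, and let $G\Omega_\alpha([0,T],\mathbb R^d)$ be the $d_\alpha$-closure of the set of natural lifts $\mathbf w^1_{s,t}=w_t-w_s$, $\mathbf w^2_{s,t}=\int_s^t(w_u-w_s)\otimes dw_u$ (Riemann–Stieltjes integral) of Lipschitz paths $w\colon[0,T]\to\mathbb R^d$ with $w_0=0$. Let $V_0,V_1,\dots,V_d$ be leafwise $C^3$ vector fields on $\mathcal M$, and let $[a,b]\subset[0,T]$. For $\mathbf w\in G\Omega_\alpha([0,T],\mathbb R^d)$ and $m\in\mathcal M$, a path $x\in C([a,b],\mathcal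 M)$ is called a solution of the rough differential equation $dx_t=\sum_{i=1}^dV_i(x_t)\,dw^i_t+V_0(x_t)\,dt$ with $x_a=m$ if $x_a=m$ and, for every leafwise $C^3$ function $f$ on $\mathcal M$, $$f(x_t)-f(x_s)=\sum_{i=1}^dV_if(x_s)\,\mathbf w^{1,i}_{s,t}+\sum_{j,k=1}^dV_jV_kf(x_s)\,\mathbf w^{2,jk}_{s,t}+V_0f(x_s)(t-s)+O(|t-s|^{3\alpha})$$ for $a\le s\le t\le b$, where the constant in $O(\cdot)$ does not depend on $(s,t)$. Then for every $m\in\mathcal M$ and $\mathbf w\in G\Omega_\alpha([0,T],\mathbb R^d)$ there is exactly one solution with $x_a=m$, denoted $\Phi_{[a,b]}(m,\mathbf w)$, and the Lyons–Itô map $$\mathcal M\times G\Omega_\alpha([0,T],\mathbb R^d)\ni(m,\mathbf w)\mapsto\Phi_{[a,b]}(m,\mathbf w)\in C([a,b],\mathcal M)$$ is continuous, where $G\Omega_\alpha([0,T],\mathbb R^d)$ carries the topology of $d_\alpha$ and $C([a,b],\mathcal M)$ the topology of uniform convergence (the compact-open topology). -/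

import Mathlib

open Set Filter Topology
open scoped ENNReal

noncomputable section

namespace FoliatedRDE

/-! ### Leafwise regularity -/

/-- `f`, defined on an open subset `U` of `ℝ^p × W`, is of class `C_L^k` on `U`: each slice
`f (·, z)` is `C^k`, and its derivatives in `y` of order at most `k` are jointly continuous
in `(y, z) ∈ U`. -/
def LeafwiseContDiffOn {p : ℕ} {W F : Type*} [TopologicalSpace W]
    [NormedAddCommGroup F] [NormedSpace ℝ F] (k : ℕ)
    (f : EuclideanSpace ℝ (Fin p) × W → F) (U : Set (EuclideanSpace ℝ (Fin p) × W)) : Prop :=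
  (∀ z : W, ContDiffOn ℝ k (fun y => f (y, z)) {y | (y, z) ∈ U}) ∧
  ∀ l : ℕ, l ≤ k →
    ContinuousOn (fun q : EuclideanSpace ℝ (Fin p) × W =>
      iteratedFDeriv ℝ l (fun y => f (y, q.2)) q.1) U

/-- A map `f` from an open subset `U` of `ℝ^p × W₁` to `ℝ^q × W₂` is of class `C_L^k` if locally
it has the form `(y, z) ↦ (f₁ (y, z), f₂ z)` with `f₁` of class `C_L^k` and `f₂` continuous. -/
def LeafwiseContDiffMapOn {p q : ℕ} {W₁ W₂ : Type*} [TopologicalSpace W₁] [TopologicalSpace W₂]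
    (k : ℕ) (f : EuclideanSpace ℝ (Fin p) × W₁ → EuclideanSpace ℝ (Fin q) × W₂)
    (U : Set (EuclideanSpace ℝ (Fin p) × W₁)) : Prop :=
  ∀ x ∈ U, ∃ O : Set (EuclideanSpace ℝ (Fin p) × W₁), IsOpen O ∧ x ∈ O ∧ O ⊆ U ∧
    ∃ (f₁ : EuclideanSpace ℝ (Fin p) × W₁ → EuclideanSpace ℝ (Fin q)) (f₂ : W₁ → W₂),
      LeafwiseContDiffOn k f₁ O ∧ ContinuousOn f₂ (Prod.snd '' O) ∧
      ∀ r ∈ O, f r = (f₁ r, f₂ r.2)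

/-! ### Foliated spaces -/

/-- The atlas of `M` (charts with values in `ℝ^p × Z`) is a foliated atlas: every chart is a
homeomorphism onto `B₁ × B₂` with `B₁` a connected open subset of `ℝ^p` and `B₂` an open subset
of `Z`, and every change of charts is leafwise smooth. -/
class IsFoliatedSpace (p : ℕ) (Z M : Type*) [TopologicalSpace Z] [TopologicalSpace M]
    [ChartedSpace (EuclideanSpace ℝ (Fin p) × Z) M] : Prop where
  target_eq_prod : ∀ φ ∈ atlas (EuclideanSpace ℝ (Fin p) × Z) M,
    ∃ (B₁ : Set (EuclideanSpace ℝ (Fin p))) (B₂ : Set Z),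
      IsOpen B₁ ∧ IsConnected B₁ ∧ IsOpen B₂ ∧ φ.target = B₁ ×ˢ B₂
  leafwise_smooth : ∀ φ ∈ atlas (EuclideanSpace ℝ (Fin p) × Z) M,
    ∀ ψ ∈ atlas (EuclideanSpace ℝ (Fin p) × Z) M,
      ∀ k : ℕ, LeafwiseContDiffMapOn k (ψ ∘ φ.symm) (φ.symm.trans ψ).source

section Leafwise

variable {p : ℕ} (Z : Type*) {M : Type*} [TopologicalSpace Z] [TopologicalSpace M]
  [ChartedSpace (EuclideanSpace ℝ (Fin p) × Z) M]

/-- `f` is a leafwise `C^k` function on `M`: it is of class `C_L^k` in every foliated chart. -/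
def IsLeafwiseCkFun (p : ℕ) (Z : Type*) {M : Type*} [TopologicalSpace Z] [TopologicalSpace M]
    [ChartedSpace (EuclideanSpace ℝ (Fin p) × Z) M] (k : ℕ) (f : M → ℝ) : Prop :=
  ∀ φ ∈ atlas (EuclideanSpace ℝ (Fin p) × Z) M, LeafwiseContDiffOn k (f ∘ φ.symm) φ.target

/-- The tangent space at `m` of the leaf through `m`. The leaf is a manifold whose charts are the
`y`-coordinates on plaques, and, as for Mathlib's `TangentSpace`, a tangent vector at `m` is
written through its components in the basis `∂/∂y¹, …, ∂/∂yᵖ` of the preferred chart at `m`. -/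
abbrev LeafTangentSpace (p : ℕ) {M : Type*} (_m : M) : Type := EuclideanSpace ℝ (Fin p)

/-- The components of the leaf tangent vector `v` at `m` in the basis `∂/∂y¹, …, ∂/∂yᵖ` given by
a foliated chart `φ` around `m`: the derivative at `m`, along the plaque of `m`, of the change of
coordinates from the preferred chart at `m` to `φ`, applied to `v`. -/
def tangentCoord (φ : OpenPartialHomeomorph M (EuclideanSpace ℝ (Fin p) × Z)) (m : M)
    (v : LeafTangentSpace p m) : EuclideanSpace ℝ (Fin p) :=
  let c : OpenPartialHomeomorph M (EuclideanSpace ℝ (Fin p) × Z) := chartAt _ m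
  fderiv ℝ (fun y => (φ (c.symm (y, (c m).2))).1) (c m).1 v

/-- `V`, a choice of a leaf tangent vector at every point, is a leafwise `C^k` vector field: its
components are of class `C_L^k` in every foliated chart. -/
def IsLeafwiseCkVectorField (k : ℕ) (V : (m : M) → LeafTangentSpace p m) : Prop :=
  ∀ φ ∈ atlas (EuclideanSpace ℝ (Fin p) × Z) M,
    LeafwiseContDiffOn k (fun q => tangentCoord Z φ (φ.symm q) (V (φ.symm q))) φ.target

/-- The function `V f`, the derivative of `f` along the leafwise vector field `V`. -/
def lieDeriv (V : (m : M) → LeafTangentSpace p m) (f : M → ℝ) (m : M) : ℝ :=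
  let c : OpenPartialHomeomorph M (EuclideanSpace ℝ (Fin p) × Z) := chartAt _ m
  fderiv ℝ (fun y => f (c.symm (y, (c m).2))) (c m).1 (V m)

end Leafwise

/-! ### Geometric rough paths -/

/-- The triangle `{(s, t) | 0 ≤ s ≤ t ≤ T}`. -/
def Triangle (T : ℝ) : Set (ℝ × ℝ) := {q | 0 ≤ q.1 ∧ q.1 ≤ q.2 ∧ q.2 ≤ T}

/-- `sup_{0 ≤ s < t ≤ T} ‖g_{s,t}‖ / (t - s)^β`, with values in `[0, ∞]`. -/
def holderNorm {T : ℝ} {F : Type*} [NormedAddCommGroup F] (β : ℝ) (g : Triangle T → F) : ℝ≥0∞ :=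
  ⨆ (q : Triangle T) (_ : q.1.1 < q.1.2), ‖g q‖ₑ / ENNReal.ofReal ((q.1.2 - q.1.1) ^ β)

/-- An `α`-Hölder rough path `(w¹, w²)` on `[0, T]` over `ℝ^d`. The space `ℝ^d ⊗ ℝ^d` is
the Euclidean space of arrays indexed by pairs `(j, k)`. -/
@[ext]
structure RoughPath (α T : ℝ) (d : ℕ) where
  w1 : C(Triangle T, EuclideanSpace ℝ (Fin d))
  w2 : C(Triangle T, EuclideanSpace ℝ (Fin d × Fin d))
  chen1 : ∀ (s u t : ℝ) (hsu : (s, u) ∈ Triangle T) (hut : (u, t) ∈ Triangle T)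
    (hst : (s, t) ∈ Triangle T), w1 ⟨(s, t), hst⟩ = w1 ⟨(s, u), hsu⟩ + w1 ⟨(u, t), hut⟩
  chen2 : ∀ (s u t : ℝ) (hsu : (s, u) ∈ Triangle T) (hut : (u, t) ∈ Triangle T)
    (hst : (s, t) ∈ Triangle T) (j k : Fin d),
    w2 ⟨(s, t), hst⟩ (j, k) = w2 ⟨(s, u), hsu⟩ (j, k) + w2 ⟨(u, t), hut⟩ (j, k)
      + w1 ⟨(s, u), hsu⟩ j * w1 ⟨(u, t), hut⟩ k
  holder1 : holderNorm α w1 < ⊤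
  holder2 : holderNorm (2 * α) w2 < ⊤

theorem holderNorm_zero {T : ℝ} {F : Type*} [NormedAddCommGroup F] (β : ℝ) :
    holderNorm β (fun _ : Triangle T => (0 : F)) = 0 := by
  simp [holderNorm]

theorem holderNorm_sub_comm {T : ℝ} {F : Type*} [NormedAddCommGroup F] (β : ℝ)
    (f g : Triangle T → F) :
    holderNorm β (fun q => f q - g q) = holderNorm β (fun q => g q - f q) := by
  unfold holderNorm
  refine iSup_congr fun q => iSup_congr fun _ => ?_
  rw [← enorm_neg, neg_sub]

theorem holderNorm_triangle {T : ℝ} {F : Type*} [NormedAddCommGroup F] (β : ℝ)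
    (f g h : Triangle T → F) :
    holderNorm β (fun q => f q - h q) ≤
      holderNorm β (fun q => f q - g q) + holderNorm β (fun q => g q - h q) := by
  refine iSup₂_le fun q hq => ?_
  have h1 : ‖f q - h q‖ₑ ≤ ‖f q - g q‖ₑ + ‖g q - h q‖ₑ := by
    simpa using enorm_add_le (f q - g q) (g q - h q)
  refine (ENNReal.div_le_div_right h1 _).trans ?_
  rw [ENNReal.add_div]
  exact add_le_add
    (le_iSup₂ (f := fun (q : Triangle T) (_ : q.1.1 < q.1.2) =>
      ‖f q - g q‖ₑ / ENNReal.ofReal ((q.1.2 - q.1.1) ^ β)) q hq)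
    (le_iSup₂ (f := fun (q : Triangle T) (_ : q.1.1 < q.1.2) =>
      ‖g q - h q‖ₑ / ENNReal.ofReal ((q.1.2 - q.1.1) ^ β)) q hq)

theorem eq_of_holderNorm_sub_eq_zero {T : ℝ} {F : Type*} [NormedAddCommGroup F] {β : ℝ}
    {f g : Triangle T → F} (h : holderNorm β (fun q => f q - g q) = 0)
    (q : Triangle T) (hq : q.1.1 < q.1.2) : f q = g q := by
  have h1 : ‖f q - g q‖ₑ / ENNReal.ofReal ((q.1.2 - q.1.1) ^ β) ≤ 0 := h ▸
    le_iSup₂ (f := fun (q : Triangle T) (_ : q.1.1 < q.1.2) =>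
      ‖f q - g q‖ₑ / ENNReal.ofReal ((q.1.2 - q.1.1) ^ β)) q hq
  have h2 := (ENNReal.div_eq_zero_iff.1 (le_antisymm h1 bot_le)).resolve_right
    ENNReal.ofReal_ne_top
  exact sub_eq_zero.1 (enorm_eq_zero.1 h2)

theorem RoughPath.w1_diag {α T : ℝ} {d : ℕ} (w : RoughPath α T d) (s : ℝ)
    (h : (s, s) ∈ Triangle T) : w.w1 ⟨(s, s), h⟩ = 0 := by
  simpa using w.chen1 s s s h h h

theorem RoughPath.w2_diag {α T : ℝ} {d : ℕ} (w : RoughPath α T d) (s : ℝ)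
    (h : (s, s) ∈ Triangle T) : w.w2 ⟨(s, s), h⟩ = 0 := by
  ext ⟨j, k⟩
  have := w.chen2 s s s h h h j k
  rw [w.w1_diag] at this
  simpa using this

/-- The distance `d_α(w, w') = max_{i = 1, 2} ‖wⁱ - w'ⁱ‖_{iα}` on the space of `α`-Hölder
rough paths. -/
instance {α T : ℝ} {d : ℕ} : EMetricSpace (RoughPath α T d) where
  edist v w := max (holderNorm α (fun q => v.w1 q - w.w1 q))
    (holderNorm (2 * α) (fun q => v.w2 q - w.w2 q))
  edist_self v := by simp [holderNorm_zero]
  edist_comm v w := by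
    rw [holderNorm_sub_comm α, holderNorm_sub_comm (2 * α)]
  edist_triangle u v w := max_le
    ((holderNorm_triangle α _ v.w1 _).trans (add_le_add (le_max_left _ _) (le_max_left _ _)))
    ((holderNorm_triangle (2 * α) _ v.w2 _).trans
      (add_le_add (le_max_right _ _) (le_max_right _ _)))
  eq_of_edist_eq_zero := by
    intro v w h
    have h1 : holderNorm α (fun q => v.w1 q - w.w1 q) = 0 :=
      le_antisymm (h ▸ le_max_left _ _) bot_le
    have h2 : holderNorm (2 * α) (fun q => v.w2 q - w.w2 q) = 0 :=
      le_antisymm (h ▸ le_max_right _ _) bot_le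
    refine RoughPath.ext ?_ ?_
    · refine ContinuousMap.ext fun ⟨⟨s, t⟩, hq⟩ => ?_
      rcases hq.2.1.lt_or_eq with hst | hst
      · exact eq_of_holderNorm_sub_eq_zero h1 _ hst
      · obtain rfl : s = t := hst
        rw [v.w1_diag, w.w1_diag]
    · refine ContinuousMap.ext fun ⟨⟨s, t⟩, hq⟩ => ?_
      rcases hq.2.1.lt_or_eq with hst | hst
      · exact eq_of_holderNorm_sub_eq_zero h2 _ hst
      · obtain rfl : s = t := hst
        rw [v.w2_diag, w.w2_diag]

/-- `I` is the Riemann–Stieltjes integral `∫_s^t f dg`: the limit, as the mesh tends to zero, of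
the sums `∑ f(ξ_i) (g(τ_{i+1}) - g(τ_i))` over tagged partitions of `[s, t]`. -/
def HasRiemannStieltjesIntegral (f g : ℝ → ℝ) (s t I : ℝ) : Prop :=
  ∀ ε > 0, ∃ δ > 0, ∀ (n : ℕ) (τ ξ : ℕ → ℝ), τ 0 = s → τ n = t →
    (∀ i < n, τ i ≤ ξ i ∧ ξ i ≤ τ (i + 1) ∧ τ (i + 1) - τ i < δ) →
    |∑ i ∈ Finset.range n, f (ξ i) * (g (τ (i + 1)) - g (τ i)) - I| < ε

/-- `W` is the natural lift of the path `w`: `W¹_{s,t} = w_t - w_s` and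
`W²_{s,t} = ∫_s^t (w_u - w_s) ⊗ dw_u` in the Riemann–Stieltjes sense. -/
def IsNaturalLift {α T : ℝ} {d : ℕ} (w : ℝ → EuclideanSpace ℝ (Fin d))
    (W : RoughPath α T d) : Prop :=
  ∀ q : Triangle T, W.w1 q = w q.1.2 - w q.1.1 ∧
    ∀ j k : Fin d, HasRiemannStieltjesIntegral (fun u => w u j - w q.1.1 j) (fun u => w u k)
      q.1.1 q.1.2 (W.w2 q (j, k))

/-- The space of `α`-Hölder geometric rough paths: the closure with respect to `d_α` of the set
of natural lifts of Lipschitz paths in `ℝ^d` that start at `0`. -/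
def GeometricRoughPath (α T : ℝ) (d : ℕ) : Set (RoughPath α T d) :=
  closure {W | ∃ w : ℝ → EuclideanSpace ℝ (Fin d),
    (∃ K, LipschitzOnWith K w (Icc 0 T)) ∧ w 0 = 0 ∧ IsNaturalLift w W}

/-! ### Rough differential equations on a foliated space -/

/-- The path `x` on `[a, b] ⊆ [0, T]` solves `dx = ∑_{i=1}^d V_i(x) dw^i + V_0(x) dt` with
`x_a = m`: for every leafwise `C³` function `f`,
`f(x_t) - f(x_s) = ∑_i V_i f(x_s) w^{1,i}_{s,t} + ∑_{j,k} V_j V_k f(x_s) w^{2,jk}_{s,t}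
  + V_0 f(x_s) (t - s) + O(|t - s|^{3α})` for `a ≤ s ≤ t ≤ b`.
Here `V 0` is the drift `V_0`, and `V i.succ` for `i : Fin d` are `V_1, …, V_d`. -/
def IsRDESolution {p : ℕ} (Z : Type*) {M : Type*} [TopologicalSpace Z] [TopologicalSpace M]
    [ChartedSpace (EuclideanSpace ℝ (Fin p) × Z) M] {α T : ℝ} {d : ℕ}
    (V : Fin (d + 1) → (m : M) → LeafTangentSpace p m) (w : RoughPath α T d)
    {a b : ℝ} (hab : a ≤ b) (m : M) (x : C(Icc a b, M)) : Prop :=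
  x ⟨a, left_mem_Icc.2 hab⟩ = m ∧
  ∀ f : M → ℝ, IsLeafwiseCkFun p Z 3 f →
    ∃ C : ℝ, ∀ (s t : ℝ) (hs : s ∈ Icc a b) (ht : t ∈ Icc a b) (hst : (s, t) ∈ Triangle T),
      |f (x ⟨t, ht⟩) - f (x ⟨s, hs⟩) -
        (∑ i : Fin d, lieDeriv Z (V i.succ) f (x ⟨s, hs⟩) * w.w1 ⟨(s, t), hst⟩ i
          + ∑ j : Fin d, ∑ k : Fin d,
              lieDeriv Z (V j.succ) (lieDeriv Z (V k.succ) f) (x ⟨s, hs⟩)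
                * w.w2 ⟨(s, t), hst⟩ (j, k)
          + lieDeriv Z (V 0) f (x ⟨s, hs⟩) * (t - s))| ≤ C * (t - s) ^ (3 * α)

end FoliatedRDE

end

open FoliatedRDE

/-!
The equation is solved in foliated charts by the method of almost flows, and the local solutions
are put together by uniqueness.

In a chart the equation becomes a family, indexed by the transverse coordinate `z`, of rough
differential equations on `ℝ^p`. After multiplication by a cut-off function (`ChartBox`) the
second-order increments `Ξ s t y` of such an equation (`germ`) satisfy two bounds: `Ξ s t` has size
`|t - s|^α` in `C^{1,1}`, and by Chen's relations the defect
`Ξ s u y + Ξ u t (y + Ξ s u y) - Ξ s t y` has size `|t - s|^{3α}`, `3α > 1`, as a bounded Lipschitz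
map (`germDefect_bl`). The `C^3` bounds on the fields are what makes the defect Lipschitz. The
constants depend on the rough path only through a bound on its norms, and not on `z`.

For such an almost flow the compositions of Euler steps along a uniform grid stay close to
`id + Ξ` as bounded Lipschitz maps, uniformly in the number of steps (`euler_sub_bl`, by halving the
number of steps). So the schemes are uniformly Lipschitz, and errors made in single steps add up
instead of multiplying (`norm_sub_euler_le`). This gives at once that two paths which follow the
increments up to `O(|t - s|^{3α})` coincide if they start at the same point
(`AlmostFlow.unique`), and that the dyadic Euler schemes converge uniformly (`rdeFlow`). Each scheme
is continuous in the starting point, in `z` and in the rough path; hence so is the limit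
(`continuousOn_rdeFlow`).

The passage between charts and `M` uses test functions `h₁(y) h₂(z)` cut off in a chart
(`isLeafwiseCkFun_bumpFun`). They show that a solution on `M` stays in its plaque, because the
transverse coordinate has increments `O(|t - s|^{3α})`, and that its leaf coordinates follow
the increments `Ξ`. Conversely, a path that follows `Ξ` satisfies the expansion for every
leafwise `C^3` function by a second-order Taylor formula (`exists_germ_taylor`). Here the relation
`w²_{jk} + w²_{kj} = w¹_j w¹_k` enters; it holds for natural lifts by integration by parts, and for
their limits by continuity (`isWeaklyGeometric_of_mem`).

Uniqueness on `M` follows by continuous induction in time (`SolOn.eqOn`). By compactness of `M` the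
local existence time is uniform on bounded sets of rough paths (`exists_uniform_solution`), and
solutions on overlapping time intervals are glued (`SolOn.glue`, `exists_global_solution`). The
solution is jointly continuous in the starting point, the rough path and time, which is continuity
of the Lyons–Itô map into `C([a, b], M)`.
-/

noncomputable section

namespace FoliatedRDE

/-! ### Calculus of leafwise regularity -/

section LeafwiseCalculus

variable {p : ℕ} {W : Type*} [TopologicalSpace W]

/-- The leafwise derivative `∂f/∂y` of a function of `(y, z)`. -/
def dy {F : Type*} [NormedAddCommGroup F] [NormedSpace ℝ F]
    (f : EuclideanSpace ℝ (Fin p) × W → F) (q : EuclideanSpace ℝ (Fin p) × W) :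
    EuclideanSpace ℝ (Fin p) →L[ℝ] F :=
  fderiv ℝ (fun y => f (y, q.2)) q.1

section Basic

variable {F G : Type*} [NormedAddCommGroup F] [NormedSpace ℝ F]
  [NormedAddCommGroup G] [NormedSpace ℝ G] {U O : Set (EuclideanSpace ℝ (Fin p) × W)}
  {f g : EuclideanSpace ℝ (Fin p) × W → F} {k : ℕ}

theorem isOpen_slice (hU : IsOpen U) (z : W) : IsOpen {y | (y, z) ∈ U} :=
  hU.preimage (by fun_prop)

theorem slice_mem_nhds (hU : IsOpen U) {q : EuclideanSpace ℝ (Fin p) × W} (hq : q ∈ U) :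
    ∀ᶠ y in 𝓝 q.1, (y, q.2) ∈ U :=
  (isOpen_slice hU q.2).mem_nhds hq

theorem leafwiseContDiffOn_zero : LeafwiseContDiffOn 0 f U ↔ ContinuousOn f U := by
  have key : ContinuousOn (fun q : EuclideanSpace ℝ (Fin p) × W =>
      iteratedFDeriv ℝ 0 (fun y => f (y, q.2)) q.1) U ↔ ContinuousOn f U := by
    have : (fun q : EuclideanSpace ℝ (Fin p) × W =>
      iteratedFDeriv ℝ 0 (fun y => f (y, q.2)) q.1) =
      (continuousMultilinearCurryFin0 ℝ (EuclideanSpace ℝ (Fin p)) F).symm ∘ f := by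
      funext q
      rw [iteratedFDeriv_zero_eq_comp]
      rfl
    rw [this, LinearIsometryEquiv.comp_continuousOn_iff]
  constructor
  · rintro ⟨-, h⟩
    exact key.1 (h 0 le_rfl)
  · intro h
    refine ⟨fun z => ?_, fun l hl => ?_⟩
    · simp only [Nat.cast_zero, contDiffOn_zero]
      exact h.comp (by fun_prop) fun y hy => hy
    · obtain rfl : l = 0 := by omega
      exact key.2 h

theorem leafwiseContDiffOn_succ (hU : IsOpen U) :
    LeafwiseContDiffOn (k + 1) f U ↔ ContinuousOn f U ∧
      (∀ q ∈ U, DifferentiableAt ℝ (fun y => f (y, q.2)) q.1) ∧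
      LeafwiseContDiffOn k (dy f) U := by
  have key : ∀ l, (ContinuousOn (fun q : EuclideanSpace ℝ (Fin p) × W =>
      iteratedFDeriv ℝ (l + 1) (fun y => f (y, q.2)) q.1) U ↔
      ContinuousOn (fun q : EuclideanSpace ℝ (Fin p) × W =>
      iteratedFDeriv ℝ l (fun y => dy f (y, q.2)) q.1) U) := by
    intro l
    have : (fun q : EuclideanSpace ℝ (Fin p) × W =>
      iteratedFDeriv ℝ (l + 1) (fun y => f (y, q.2)) q.1) =
      (continuousMultilinearCurryRightEquiv' ℝ l (EuclideanSpace ℝ (Fin p)) F).symm ∘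
       (fun q : EuclideanSpace ℝ (Fin p) × W =>
      iteratedFDeriv ℝ l (fun y => dy f (y, q.2)) q.1) := by
      funext q
      rw [iteratedFDeriv_succ_eq_comp_right]
      rfl
    rw [this, LinearIsometryEquiv.comp_continuousOn_iff]
  constructor
  · rintro ⟨h1, h2⟩
    have h3 : ∀ z, _ := fun z =>
      (contDiffOn_succ_iff_fderiv_of_isOpen (n := (k : WithTop ℕ∞)) (isOpen_slice hU z)).1
        (by exact_mod_cast h1 z)
    refine ⟨leafwiseContDiffOn_zero.1 ⟨fun z => (h1 z).of_le (by simp), fun l hl => h2 l (by omega)⟩,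
      fun q hq => ?_, fun z => (h3 z).2.2, fun l hl => (key l).1 (h2 _ (by omega))⟩
    exact (h3 q.2).1.differentiableAt ((isOpen_slice hU q.2).mem_nhds hq)
  · rintro ⟨h1, h2, h3⟩
    refine ⟨fun z => ?_, fun l hl => ?_⟩
    · have := (contDiffOn_succ_iff_fderiv_of_isOpen (n := (k : WithTop ℕ∞)) (𝕜 := ℝ)
        (f := fun y => f (y, z)) (isOpen_slice hU z)).2
        ⟨fun y hy => (h2 (y, z) hy).differentiableWithinAt,
          fun h => absurd h (by simp), h3.1 z⟩
      exact_mod_cast this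
    · rcases l with _ | l
      · exact (leafwiseContDiffOn_zero.2 h1).2 0 le_rfl
      · exact (key l).2 (h3.2 l (by omega))

theorem LeafwiseContDiffOn.continuousOn (h : LeafwiseContDiffOn k f U) : ContinuousOn f U :=
  leafwiseContDiffOn_zero.1 ⟨fun z => (h.1 z).of_le (by simp), fun l hl => h.2 l (by omega)⟩

theorem LeafwiseContDiffOn.of_le {n : ℕ} (h : LeafwiseContDiffOn k f U) (hn : n ≤ k) :
    LeafwiseContDiffOn n f U :=
  ⟨fun z => (h.1 z).of_le (by exact_mod_cast hn), fun l hl => h.2 l (by omega)⟩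

theorem dy_congr (hU : IsOpen U) (hfg : ∀ q ∈ U, f q = g q) {q} (hq : q ∈ U) :
    dy f q = dy g q := by
  refine Filter.EventuallyEq.fderiv_eq ?_
  filter_upwards [slice_mem_nhds hU hq] with y hy using hfg _ hy

theorem LeafwiseContDiffOn.congr (hU : IsOpen U) (h : LeafwiseContDiffOn k f U)
    (hfg : ∀ q ∈ U, g q = f q) : LeafwiseContDiffOn k g U := by
  refine ⟨fun z => (h.1 z).congr fun y hy => hfg _ hy, fun l hl => (h.2 l hl).congr fun q hq => ?_⟩
  refine (Filter.EventuallyEq.iteratedFDeriv ℝ (?_ : _ =ᶠ[𝓝 q.1] _) l).self_of_nhds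
  filter_upwards [slice_mem_nhds hU hq] with y hy using hfg _ hy

/-- Being of class `C_L^k` is a local property. -/
theorem LeafwiseContDiffOn.of_locally
    (h : ∀ q ∈ U, ∃ O, IsOpen O ∧ q ∈ O ∧ LeafwiseContDiffOn k f O) :
    LeafwiseContDiffOn k f U := by
  refine ⟨fun z y hy => ?_, fun l hl q hq => ?_⟩
  · obtain ⟨O, hO, hqO, hf⟩ := h (y, z) hy
    exact ((hf.1 z).contDiffAt ((isOpen_slice hO z).mem_nhds hqO)).contDiffWithinAt
  · obtain ⟨O, hO, hqO, hf⟩ := h q hq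
    exact ((hf.2 l hl).continuousAt (hO.mem_nhds hqO)).continuousWithinAt

theorem dy_const {W' : Type*} (c : W' → F) :
    dy (fun q : EuclideanSpace ℝ (Fin p) × W' => c q.2) =
    fun _ => 0 := by
  funext q
  simp [dy]

/-- A continuous function of the transverse variable is of class `C_L^k` for every `k`. -/
theorem leafwiseContDiffOn_snd (hU : IsOpen U) {c : W → F}
    (hc : ContinuousOn (fun q : EuclideanSpace ℝ (Fin p) × W => c q.2) U) :
    LeafwiseContDiffOn k (fun q => c q.2) U := by
  cases k with
  | zero => exact leafwiseContDiffOn_zero.2 hc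
  | succ k =>
    refine (leafwiseContDiffOn_succ hU).2 ⟨hc, fun q _ => by simp, ?_⟩
    rw [dy_const]
    refine ⟨fun z => contDiffOn_const, fun l _ => ?_⟩
    have h0 : iteratedFDeriv ℝ l (fun _ : EuclideanSpace ℝ (Fin p) =>
        (0 : EuclideanSpace ℝ (Fin p) →L[ℝ] F)) = 0 := iteratedFDeriv_fun_zero
    simp only [h0]
    exact continuousOn_const

theorem leafwiseContDiffOn_const (hU : IsOpen U) (c : F) :
    LeafwiseContDiffOn k (fun _ => c) U :=
  leafwiseContDiffOn_snd hU (c := fun _ => c) continuousOn_const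

theorem leafwiseContDiffOn_fst (hU : IsOpen U) :
    LeafwiseContDiffOn k (fun q : EuclideanSpace ℝ (Fin p) × W => q.1) U := by
  cases k with
  | zero => exact leafwiseContDiffOn_zero.2 (by fun_prop)
  | succ k =>
    refine (leafwiseContDiffOn_succ hU).2 ⟨by fun_prop, fun q _ => by fun_prop, ?_⟩
    have : dy (fun q : EuclideanSpace ℝ (Fin p) × W => q.1) =
        fun _ => ContinuousLinearMap.id ℝ _ := by
      funext q
      simp [dy]
    rw [this]
    exact leafwiseContDiffOn_const hU _

theorem LeafwiseContDiffOn.differentiableAt (hU : IsOpen U) (h : LeafwiseContDiffOn k f U)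
    (hk : 1 ≤ k) {q} (hq : q ∈ U) : DifferentiableAt ℝ (fun y => f (y, q.2)) q.1 :=
  ((leafwiseContDiffOn_succ (k := 0) hU).1 (h.of_le hk)).2.1 q hq

theorem LeafwiseContDiffOn.dy (hU : IsOpen U) (h : LeafwiseContDiffOn (k + 1) f U) :
    LeafwiseContDiffOn k (dy f) U :=
  ((leafwiseContDiffOn_succ hU).1 h).2.2

theorem LeafwiseContDiffOn.add (hU : IsOpen U) (hf : LeafwiseContDiffOn k f U)
    (hg : LeafwiseContDiffOn k g U) : LeafwiseContDiffOn k (fun q => f q + g q) U := by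
  refine ⟨fun z => (hf.1 z).add (hg.1 z), fun l hl => ?_⟩
  refine ((hf.2 l hl).add (hg.2 l hl)).congr fun q hq => ?_
  have hl' : (l : WithTop ℕ∞) ≤ k := by exact_mod_cast hl
  exact iteratedFDeriv_add_apply
    (((hf.1 q.2).contDiffAt ((isOpen_slice hU q.2).mem_nhds hq)).of_le hl')
    (((hg.1 q.2).contDiffAt ((isOpen_slice hU q.2).mem_nhds hq)).of_le hl')

end Basic

theorem LeafwiseContDiffOn.bilinear {U : Set (EuclideanSpace ℝ (Fin p) × W)} (hU : IsOpen U)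
    {k : ℕ} : ∀ {F G H : Type} [NormedAddCommGroup F] [NormedSpace ℝ F]
    [NormedAddCommGroup G] [NormedSpace ℝ G] [NormedAddCommGroup H] [NormedSpace ℝ H]
    (B : F →L[ℝ] G →L[ℝ] H) {f : EuclideanSpace ℝ (Fin p) × W → F}
    {g : EuclideanSpace ℝ (Fin p) × W → G},
    LeafwiseContDiffOn k f U → LeafwiseContDiffOn k g U →
      LeafwiseContDiffOn k (fun q => B (f q) (g q)) U := by
  induction k with
  | zero =>
    intro F G H _ _ _ _ _ _ B f g hf hg
    rw [leafwiseContDiffOn_zero] at *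
    exact (B.continuous.comp_continuousOn hf).clm_apply hg
  | succ k ih =>
    intro F G H _ _ _ _ _ _ B f g hf hg
    have hf' := (leafwiseContDiffOn_succ hU).1 hf
    have hg' := (leafwiseContDiffOn_succ hU).1 hg
    refine (leafwiseContDiffOn_succ hU).2
      ⟨(B.continuous.comp_continuousOn hf'.1).clm_apply hg'.1, fun q hq => ?_, ?_⟩
    · exact (B.differentiableAt.comp q.1 (hf'.2.1 q hq)).clm_apply (hg'.2.1 q hq)
    · have h1 := ih (B.precompR (EuclideanSpace ℝ (Fin p))) (hf.of_le k.le_succ) hg'.2.2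
      have h2 := ih (B.precompL (EuclideanSpace ℝ (Fin p))) hf'.2.2 (hg.of_le k.le_succ)
      refine (h1.add hU h2).congr hU fun q hq => ?_
      exact B.fderiv_of_bilinear (hf'.2.1 q hq) (hg'.2.1 q hq)

/-- A smooth function of a function of class `C_L^k` is of class `C_L^k`. -/
theorem LeafwiseContDiffOn.comp_left {U : Set (EuclideanSpace ℝ (Fin p) × W)} (hU : IsOpen U)
    {k : ℕ} {F : Type} [NormedAddCommGroup F] [NormedSpace ℝ F] : ∀ {G : Type}
    [NormedAddCommGroup G] [NormedSpace ℝ G] {h : F → G}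
    {f : EuclideanSpace ℝ (Fin p) × W → F}, ContDiff ℝ k h →
    LeafwiseContDiffOn k f U → LeafwiseContDiffOn k (fun q => h (f q)) U := by
  induction k with
  | zero =>
    intro G _ _ h f hh hf
    rw [leafwiseContDiffOn_zero] at *
    exact hh.continuous.comp_continuousOn hf
  | succ k ih =>
    intro G _ _ h f hh hf
    have hf' := (leafwiseContDiffOn_succ hU).1 hf
    have hh' := (contDiff_succ_iff_fderiv (n := (k : WithTop ℕ∞))).1 (by exact_mod_cast hh)
    refine (leafwiseContDiffOn_succ hU).2
      ⟨hh.continuous.comp_continuousOn hf'.1, fun q hq => ?_, ?_⟩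
    · exact (hh'.1 _).comp q.1 (hf'.2.1 q hq)
    · have h1 := LeafwiseContDiffOn.bilinear hU
        (ContinuousLinearMap.compL ℝ (EuclideanSpace ℝ (Fin p)) F G)
        (ih hh'.2.2 (hf.of_le k.le_succ)) hf'.2.2
      refine h1.congr hU fun q hq => ?_
      exact fderiv_comp q.1 (hh'.1 _) (hf'.2.1 q hq)

end LeafwiseCalculus

/-! ### Functions and vector fields in foliated charts -/

section Charts

variable {p : ℕ} {Z M : Type*} [TopologicalSpace Z] [TopologicalSpace M]

/-- The function `h₁(y) h₂(z)` in the chart `φ`, extended by zero to `M`. -/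
def bumpFun (φ : OpenPartialHomeomorph M (EuclideanSpace ℝ (Fin p) × Z))
    (h₁ : EuclideanSpace ℝ (Fin p) → ℝ) (h₂ : Z → ℝ) : M → ℝ :=
  open Classical in fun m => if m ∈ φ.source then h₂ (φ m).2 * h₁ (φ m).1 else 0

theorem bumpFun_symm (φ : OpenPartialHomeomorph M (EuclideanSpace ℝ (Fin p) × Z))
    (h₁ : EuclideanSpace ℝ (Fin p) → ℝ) (h₂ : Z → ℝ) {q} (hq : q ∈ φ.target) :
    bumpFun φ h₁ h₂ (φ.symm q) = h₂ q.2 * h₁ q.1 := by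
  simp [bumpFun, φ.map_target hq, φ.right_inv hq]

variable [ChartedSpace (EuclideanSpace ℝ (Fin p) × Z) M]

/-- The components of a leafwise vector field in a chart, as a function of the coordinates. -/
def chartField (φ : OpenPartialHomeomorph M (EuclideanSpace ℝ (Fin p) × Z))
    (V : (m : M) → LeafTangentSpace p m) (q : EuclideanSpace ℝ (Fin p) × Z) :
    EuclideanSpace ℝ (Fin p) :=
  tangentCoord Z φ (φ.symm q) (V (φ.symm q))

theorem leafwise_transition [IsFoliatedSpace p Z M]
    {φ ψ : OpenPartialHomeomorph M (EuclideanSpace ℝ (Fin p) × Z)}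
    (hφ : φ ∈ atlas (EuclideanSpace ℝ (Fin p) × Z) M)
    (hψ : ψ ∈ atlas (EuclideanSpace ℝ (Fin p) × Z) M) (k : ℕ) {q} (hq : q ∈ φ.target)
    (hqψ : φ.symm q ∈ ψ.source) :
    ∃ O : Set (EuclideanSpace ℝ (Fin p) × Z), IsOpen O ∧ q ∈ O ∧ O ⊆ φ.target ∧
      (∀ r ∈ O, φ.symm r ∈ ψ.source) ∧
      ∃ (f₁ : EuclideanSpace ℝ (Fin p) × Z → EuclideanSpace ℝ (Fin p)) (f₂ : Z → Z),
      LeafwiseContDiffOn k f₁ O ∧ ContinuousOn f₂ (Prod.snd '' O) ∧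
      ∀ r ∈ O, ψ (φ.symm r) = (f₁ r, f₂ r.2) := by
  obtain ⟨O, hO, hqO, hOU, f₁, f₂, h1, h2, h3⟩ :=
    IsFoliatedSpace.leafwise_smooth φ hφ ψ hψ k q ⟨hq, hqψ⟩
  exact ⟨O, hO, hqO, fun r hr => (hOU hr).1, fun r hr => (hOU hr).2, f₁, f₂, h1, h2, h3⟩

/-- The derivative of a function along a leafwise vector field, computed in any chart. -/
theorem lieDeriv_chart [IsFoliatedSpace p Z M]
    {φ : OpenPartialHomeomorph M (EuclideanSpace ℝ (Fin p) × Z)}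
    (hφ : φ ∈ atlas (EuclideanSpace ℝ (Fin p) × Z) M) (V : (m : M) → LeafTangentSpace p m)
    (f : M → ℝ) {q} (hq : q ∈ φ.target)
    (hf : DifferentiableAt ℝ (fun y => f (φ.symm (y, q.2))) q.1) :
    lieDeriv Z V f (φ.symm q) = dy (f ∘ φ.symm) q (chartField φ V q) := by
  set m := φ.symm q with hm
  set c : OpenPartialHomeomorph M (EuclideanSpace ℝ (Fin p) × Z) := chartAt _ m with hc
  have hφm : φ m = q := φ.right_inv hq
  have hmc : c.symm (c m) = m := c.left_inv (mem_chart_source _ m)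
  have hmφ : m ∈ φ.source := φ.map_target hq
  obtain ⟨O, hO, hqO, -, hOs, f₁, f₂, h1, -, h3⟩ := leafwise_transition
    (chart_mem_atlas (EuclideanSpace ℝ (Fin p) × Z) m) hφ 1
    (mem_chart_target _ m) (by rw [← hc, hmc]; exact hmφ)
  change (c m) ∈ O at hqO
  rw [← hc] at hOs h3
  have hz : ∀ y, (y, (c m).2) ∈ O → φ (c.symm (y, (c m).2)) = (f₁ (y, (c m).2), q.2) := by
    intro y hy
    have := h3 _ hqO
    rw [hmc, hφm] at this
    rw [h3 _ hy, this]
  have hev := slice_mem_nhds hO hqO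
  have hT : (fun y => (φ (c.symm (y, (c m).2))).1) =ᶠ[𝓝 (c m).1] fun y => f₁ (y, (c m).2) := by
    filter_upwards [hev] with y hy
    rw [hz y hy]
  have hd : DifferentiableAt ℝ (fun y => (φ (c.symm (y, (c m).2))).1) (c m).1 :=
    (h1.differentiableAt hO le_rfl hqO).congr_of_eventuallyEq hT
  have hv : (φ (c.symm ((c m).1, (c m).2))).1 = q.1 := by
    rw [Prod.mk.eta, hmc, hφm]
  have hcomp : (fun y => f (c.symm (y, (c m).2))) =ᶠ[𝓝 (c m).1]
      (fun y => f (φ.symm (y, q.2))) ∘ (fun y => (φ (c.symm (y, (c m).2))).1) := by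
    filter_upwards [hev] with y hy
    have h4 : ((φ (c.symm (y, (c m).2))).1, q.2) = φ (c.symm (y, (c m).2)) := by
      rw [hz y hy]
    simp only [Function.comp_apply, h4]
    rw [φ.left_inv (hOs _ hy)]
  change fderiv ℝ (fun y => f (c.symm (y, (c m).2))) (c m).1 (V m) = _
  rw [hcomp.fderiv_eq, fderiv_comp _ (by rw [hv]; exact hf) hd, hv]
  rfl

theorem IsLeafwiseCkFun.lieDeriv_chart [IsFoliatedSpace p Z M] {k : ℕ}
    {φ : OpenPartialHomeomorph M (EuclideanSpace ℝ (Fin p) × Z)}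
    (hφ : φ ∈ atlas (EuclideanSpace ℝ (Fin p) × Z) M) (V : (m : M) → LeafTangentSpace p m)
    {f : M → ℝ} (hf : IsLeafwiseCkFun p Z k f) (hk : 1 ≤ k) {q} (hq : q ∈ φ.target) :
    lieDeriv Z V f (φ.symm q) = dy (f ∘ φ.symm) q (chartField φ V q) :=
  FoliatedRDE.lieDeriv_chart hφ V f hq ((hf φ hφ).differentiableAt φ.open_target hk hq)

theorem IsLeafwiseCkFun.lieDeriv [IsFoliatedSpace p Z M] {k : ℕ}
    {V : (m : M) → LeafTangentSpace p m} (hV : IsLeafwiseCkVectorField Z k V)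
    {f : M → ℝ} (hf : IsLeafwiseCkFun p Z (k + 1) f) : IsLeafwiseCkFun p Z k (lieDeriv Z V f) := by
  intro φ hφ
  refine (LeafwiseContDiffOn.bilinear φ.open_target
    (ContinuousLinearMap.id ℝ (EuclideanSpace ℝ (Fin p) →L[ℝ] ℝ))
    ((hf φ hφ).dy φ.open_target) (hV φ hφ)).congr φ.open_target fun q hq => ?_
  exact hf.lieDeriv_chart hφ V (by omega) hq

theorem IsLeafwiseCkFun.of_le {k n : ℕ} {f : M → ℝ} (hf : IsLeafwiseCkFun p Z k f) (h : n ≤ k) :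
    IsLeafwiseCkFun p Z n f := fun φ hφ => (hf φ hφ).of_le h

theorem IsLeafwiseCkVectorField.of_le {k n : ℕ} {V : (m : M) → LeafTangentSpace p m}
    (hV : IsLeafwiseCkVectorField Z k V) (h : n ≤ k) :
    IsLeafwiseCkVectorField Z n V := fun φ hφ => (hV φ hφ).of_le h

theorem IsLeafwiseCkFun.continuous {k : ℕ} {f : M → ℝ} (hf : IsLeafwiseCkFun p Z k f) :
    Continuous f := by
  refine continuous_iff_continuousAt.2 fun m => ?_
  set c : OpenPartialHomeomorph M (EuclideanSpace ℝ (Fin p) × Z) := chartAt _ m with hc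
  have h1 : ContinuousAt (f ∘ c.symm) (c m) :=
    (hf c (chart_mem_atlas _ m)).continuousOn.continuousAt
      (c.open_target.mem_nhds (mem_chart_target _ m))
  have h2 : ContinuousAt c m := c.continuousAt (mem_chart_source _ m)
  refine (ContinuousAt.comp (f := c) h1 h2).congr ?_
  filter_upwards [c.open_source.mem_nhds (mem_chart_source _ m)] with x hx
  simp [c.left_inv hx]

/-- The second derivative `V W f` in a chart: `D²f (v, w) + Df (Dw v)`, where `v` and `w` are the
components of the fields. -/
theorem lieDeriv_lieDeriv_chart [IsFoliatedSpace p Z M]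
    {φ : OpenPartialHomeomorph M (EuclideanSpace ℝ (Fin p) × Z)}
    (hφ : φ ∈ atlas (EuclideanSpace ℝ (Fin p) × Z) M) (V : (m : M) → LeafTangentSpace p m)
    {W : (m : M) → LeafTangentSpace p m} (hW : IsLeafwiseCkVectorField Z 1 W)
    {f : M → ℝ} (hf : IsLeafwiseCkFun p Z 2 f) {q} (hq : q ∈ φ.target) :
    lieDeriv Z V (lieDeriv Z W f) (φ.symm q) =
      dy (dy (f ∘ φ.symm)) q (chartField φ V q) (chartField φ W q) +
      dy (f ∘ φ.symm) q (dy (chartField φ W) q (chartField φ V q)) := by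
  rw [(hf.lieDeriv hW).lieDeriv_chart hφ V le_rfl hq]
  have h1 : dy (lieDeriv Z W f ∘ φ.symm) q =
      dy (fun q => dy (f ∘ φ.symm) q (chartField φ W q)) q :=
    dy_congr φ.open_target (fun r hr => hf.lieDeriv_chart hφ W (by omega) hr) hq
  rw [h1]
  have h2 := ((hf φ hφ).dy φ.open_target).differentiableAt φ.open_target le_rfl hq
  have h3 : DifferentiableAt ℝ (fun y => chartField φ W (y, q.2)) q.1 :=
    (hW φ hφ).differentiableAt φ.open_target le_rfl hq
  have h4 := fderiv_clm_apply h2 h3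
  change (fderiv ℝ (fun y => dy (f ∘ φ.symm) (y, q.2) (chartField φ W (y, q.2))) q.1)
    (chartField φ V q) = _
  rw [h4]
  simp only [add_apply, ContinuousLinearMap.comp_apply,
    ContinuousLinearMap.flip_apply]
  rw [add_comm]
  rfl

theorem isLeafwiseCkFun_bumpFun [IsFoliatedSpace p Z M] [T2Space M]
    {φ : OpenPartialHomeomorph M (EuclideanSpace ℝ (Fin p) × Z)}
    (hφ : φ ∈ atlas (EuclideanSpace ℝ (Fin p) × Z) M)
    {h₁ : EuclideanSpace ℝ (Fin p) → ℝ} {h₂ : Z → ℝ} (k : ℕ) (hh₁ : ContDiff ℝ k h₁)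
    (hh₂ : Continuous h₂) {K₁ : Set (EuclideanSpace ℝ (Fin p))} {K₂ : Set Z}
    (hK₁ : IsCompact K₁) (hK₂ : IsCompact K₂) (hK : K₁ ×ˢ K₂ ⊆ φ.target)
    (hz₁ : ∀ y ∉ K₁, h₁ y = 0) (hz₂ : ∀ z ∉ K₂, h₂ z = 0) :
    IsLeafwiseCkFun p Z k (bumpFun φ h₁ h₂) := by
  intro ψ hψ
  refine LeafwiseContDiffOn.of_locally fun q hq => ?_
  by_cases hm : ψ.symm q ∈ φ.source
  · obtain ⟨O, hO, hqO, hOt, hOs, f₁, f₂, h1, h2, h3⟩ := leafwise_transition hψ hφ k hq hm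
    refine ⟨O, hO, hqO, ?_⟩
    have h4 : LeafwiseContDiffOn k (fun q => h₂ (f₂ q.2)) O :=
      leafwiseContDiffOn_snd hO (c := fun z => h₂ (f₂ z))
        (hh₂.comp_continuousOn (h2.comp continuousOn_snd fun r hr => ⟨r, hr, rfl⟩))
    refine (LeafwiseContDiffOn.bilinear hO (ContinuousLinearMap.mul ℝ ℝ) h4
      (h1.comp_left hO hh₁)).congr hO fun r hr => ?_
    simp [bumpFun, hOs r hr, h3 r hr]
  · have hKc : IsClosed (φ.symm '' (K₁ ×ˢ K₂)) :=
      ((hK₁.prod hK₂).image_of_continuousOn (φ.continuousOn_symm.mono hK)).isClosed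
    refine ⟨ψ.target ∩ ψ.symm ⁻¹' (φ.symm '' (K₁ ×ˢ K₂))ᶜ,
      ψ.isOpen_inter_preimage_symm hKc.isOpen_compl, ⟨hq, ?_⟩, ?_⟩
    · rintro ⟨r, hr, hrq⟩
      exact hm (hrq ▸ φ.map_target (hK hr))
    · refine (leafwiseContDiffOn_const (ψ.isOpen_inter_preimage_symm hKc.isOpen_compl) (0 : ℝ)).congr
        (ψ.isOpen_inter_preimage_symm hKc.isOpen_compl) fun r hr => ?_
      simp only [Function.comp_apply, bumpFun]
      split_ifs with h
      · have : ¬ (φ (ψ.symm r) ∈ K₁ ×ˢ K₂) := fun h' =>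
          hr.2 ⟨_, h', φ.left_inv h⟩
        rw [mem_prod, not_and_or] at this
        rcases this with h' | h'
        · rw [hz₁ _ h', mul_zero]
        · rw [hz₂ _ h', zero_mul]
      · rfl

end Charts

/-! ### Rough paths -/

section RoughPaths

variable {α T : ℝ} {d : ℕ}

theorem enorm_le_holderNorm_mul {F : Type*} [NormedAddCommGroup F] {β : ℝ} (g : Triangle T → F)
    (q : Triangle T) (hq : q.1.1 < q.1.2) :
    ‖g q‖ₑ ≤ holderNorm β g * ENNReal.ofReal ((q.1.2 - q.1.1) ^ β) := by
  have h1 : ‖g q‖ₑ / ENNReal.ofReal ((q.1.2 - q.1.1) ^ β) ≤ holderNorm β g :=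
    le_iSup₂ (f := fun (q : Triangle T) (_ : q.1.1 < q.1.2) =>
      ‖g q‖ₑ / ENNReal.ofReal ((q.1.2 - q.1.1) ^ β)) q hq
  refine (ENNReal.div_le_iff_le_mul (Or.inl ?_) (Or.inl ENNReal.ofReal_ne_top)).1 h1
  exact (ENNReal.ofReal_pos.2 (Real.rpow_pos_of_pos (sub_pos.2 hq) _)).ne'

/-- The projection of a pair of times to the triangle `0 ≤ s ≤ t ≤ T`: a pair with `s ≤ t` is
projected coordinatewise to `[0, T]`. -/
def clampTri (hT : 0 ≤ T) (s t : ℝ) : Triangle T :=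
  ⟨(max 0 (min T s), max 0 (min T (max s t))), le_max_left _ _,
    max_le_max le_rfl (min_le_min le_rfl (le_max_left _ _)), max_le hT (min_le_left _ _)⟩

theorem clampTri_of_mem (hT : 0 ≤ T) {s t : ℝ} (h : (s, t) ∈ Triangle T) :
    clampTri hT s t = ⟨(s, t), h⟩ := by
  obtain ⟨h1, h2, h3⟩ := h
  simp only [] at h1 h2 h3
  refine Subtype.ext (Prod.ext ?_ ?_)
  · simp [clampTri, min_eq_right (h2.trans h3), h1]
  · simp [clampTri, max_eq_right h2, min_eq_right h3, h1.trans h2]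

theorem continuous_clampTri (hT : 0 ≤ T) : Continuous fun q : ℝ × ℝ => clampTri hT q.1 q.2 := by
  unfold clampTri
  fun_prop

theorem clampTri_sub_le (hT : 0 ≤ T) {s t : ℝ} (h : s ≤ t) :
    (clampTri hT s t).1.2 - (clampTri hT s t).1.1 ≤ t - s := by
  simp only [clampTri, max_eq_right h]
  rcases max_cases 0 (min T t) with h1 | h1 <;> rcases max_cases 0 (min T s) with h2 | h2 <;>
  rcases min_cases T t with h3 | h3 <;> rcases min_cases T s with h4 | h4 <;> linarith

/-- The first level of a rough path on `[0, T]`, extended to all times by stopping the path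
outside `[0, T]`. -/
def RoughPath.W1 (w : RoughPath α T d) (hT : 0 ≤ T) (s t : ℝ) : EuclideanSpace ℝ (Fin d) :=
  w.w1 (clampTri hT s t)

/-- The second level of a rough path on `[0, T]`, extended to all times by stopping the path
outside `[0, T]`. -/
def RoughPath.W2 (w : RoughPath α T d) (hT : 0 ≤ T) (s t : ℝ) :
    EuclideanSpace ℝ (Fin d × Fin d) :=
  w.w2 (clampTri hT s t)

/-- Both Hölder norms of `w` are at most `R`. -/
def RoughPath.BoundedBy (w : RoughPath α T d) (R : ℝ) : Prop :=
  holderNorm α w.w1 ≤ ENNReal.ofReal R ∧ holderNorm (2 * α) w.w2 ≤ ENNReal.ofReal R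

/-- The first-order shuffle relation `w²_{jk} + w²_{kj} = w¹_j w¹_k`. -/
def RoughPath.IsWeaklyGeometric (w : RoughPath α T d) : Prop :=
  ∀ (q : Triangle T) (j k : Fin d), w.w2 q (j, k) + w.w2 q (k, j) = w.w1 q j * w.w1 q k

theorem RoughPath.W1_add (w : RoughPath α T d) (hT : 0 ≤ T) {s u t : ℝ} (hsu : s ≤ u)
    (hut : u ≤ t) : w.W1 hT s t = w.W1 hT s u + w.W1 hT u t := by
  have h1 := (clampTri hT s t).2
  have h2 := (clampTri hT s u).2
  have h3 := (clampTri hT u t).2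
  simp only [clampTri, max_eq_right hsu, max_eq_right hut, max_eq_right (hsu.trans hut)] at h1 h2 h3
  simpa only [W1, clampTri, max_eq_right hsu, max_eq_right hut, max_eq_right (hsu.trans hut)]
    using w.chen1 _ _ _ h2 h3 h1

theorem RoughPath.W2_add (w : RoughPath α T d) (hT : 0 ≤ T) {s u t : ℝ} (hsu : s ≤ u)
    (hut : u ≤ t) (j k : Fin d) : w.W2 hT s t (j, k) =
      w.W2 hT s u (j, k) + w.W2 hT u t (j, k) + w.W1 hT s u j * w.W1 hT u t k := by
  have h1 := (clampTri hT s t).2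
  have h2 := (clampTri hT s u).2
  have h3 := (clampTri hT u t).2
  simp only [clampTri, max_eq_right hsu, max_eq_right hut, max_eq_right (hsu.trans hut)] at h1 h2 h3
  simpa only [W1, W2, clampTri, max_eq_right hsu, max_eq_right hut,
    max_eq_right (hsu.trans hut)] using w.chen2 _ _ _ h2 h3 h1 j k

theorem RoughPath.continuous_W1 (w : RoughPath α T d) (hT : 0 ≤ T) :
    Continuous fun q : ℝ × ℝ => w.W1 hT q.1 q.2 :=
  w.w1.continuous.comp (continuous_clampTri hT)

theorem RoughPath.continuous_W2 (w : RoughPath α T d) (hT : 0 ≤ T) :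
    Continuous fun q : ℝ × ℝ => w.W2 hT q.1 q.2 :=
  w.w2.continuous.comp (continuous_clampTri hT)

theorem norm_clampTri_le {F : Type*} [NormedAddCommGroup F] {β R : ℝ} (hβ : 0 ≤ β) (hR : 0 ≤ R)
    (hT : 0 ≤ T) {g : Triangle T → F} (hdiag : ∀ q : Triangle T, q.1.1 = q.1.2 → g q = 0)
    (hg : holderNorm β g ≤ ENNReal.ofReal R) {s t : ℝ} (hst : s ≤ t) :
    ‖g (clampTri hT s t)‖ ≤ R * (t - s) ^ β := by
  rcases (clampTri hT s t).2.2.1.lt_or_eq with h | h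
  · have h1 := enorm_le_holderNorm_mul (β := β) g _ h
    have h2 : ENNReal.ofReal (((clampTri hT s t).1.2 - (clampTri hT s t).1.1) ^ β) ≤
        ENNReal.ofReal ((t - s) ^ β) :=
      ENNReal.ofReal_le_ofReal (Real.rpow_le_rpow (by linarith) (clampTri_sub_le hT hst) hβ)
    have h3 := h1.trans (mul_le_mul' hg h2)
    rw [← ENNReal.ofReal_mul hR, ← ofReal_norm] at h3
    exact (ENNReal.ofReal_le_ofReal_iff
      (mul_nonneg hR (Real.rpow_nonneg (sub_nonneg.2 hst) _))).1 h3
  · rw [hdiag _ h, norm_zero]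
    exact mul_nonneg hR (Real.rpow_nonneg (sub_nonneg.2 hst) _)

theorem RoughPath.w1_eq_zero (w : RoughPath α T d) (q : Triangle T) (hq : q.1.1 = q.1.2) :
    w.w1 q = 0 := by
  obtain ⟨⟨s, t⟩, h⟩ := q
  obtain rfl : s = t := hq
  exact w.w1_diag s h

theorem RoughPath.w2_eq_zero (w : RoughPath α T d) (q : Triangle T) (hq : q.1.1 = q.1.2) :
    w.w2 q = 0 := by
  obtain ⟨⟨s, t⟩, h⟩ := q
  obtain rfl : s = t := hq
  exact w.w2_diag s h

theorem RoughPath.norm_W1_le {w : RoughPath α T d} {R : ℝ} (hw : w.BoundedBy R) (hα : 0 ≤ α)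
    (hR : 0 ≤ R) (hT : 0 ≤ T) {s t : ℝ} (hst : s ≤ t) : ‖w.W1 hT s t‖ ≤ R * (t - s) ^ α :=
  norm_clampTri_le hα hR hT w.w1_eq_zero hw.1 hst

theorem RoughPath.norm_W2_le {w : RoughPath α T d} {R : ℝ} (hw : w.BoundedBy R) (hα : 0 ≤ α)
    (hR : 0 ≤ R) (hT : 0 ≤ T) {s t : ℝ} (hst : s ≤ t) :
    ‖w.W2 hT s t‖ ≤ R * (t - s) ^ (2 * α) :=
  norm_clampTri_le (by positivity) hR hT w.w2_eq_zero hw.2 hst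

theorem continuous_eval_of_holderNorm_le {F : Type*} [NormedAddCommGroup F] {β : ℝ}
    (g : RoughPath α T d → Triangle T → F)
    (hdiag : ∀ w (q : Triangle T), q.1.1 = q.1.2 → g w q = 0)
    (hg : ∀ v w, holderNorm β (fun q => g v q - g w q) ≤ edist v w) (q : Triangle T) :
    Continuous fun w => g w q := by
  refine LipschitzWith.continuous (K := ((q.1.2 - q.1.1) ^ β).toNNReal) fun v w => ?_
  rcases q.2.2.1.lt_or_eq with h | h
  · rw [edist_eq_enorm_sub]
    refine (enorm_le_holderNorm_mul (β := β) (fun q => g v q - g w q) q h).trans ?_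
    rw [mul_comm]
    exact mul_le_mul' le_rfl (hg v w)
  · simp [hdiag _ q h]

theorem RoughPath.continuous_w1_apply (q : Triangle T) :
    Continuous fun w : RoughPath α T d => w.w1 q :=
  continuous_eval_of_holderNorm_le (β := α) (fun w q => w.w1 q) (fun w => w.w1_eq_zero)
    (fun _ _ => le_max_left _ _) q

theorem RoughPath.continuous_w2_apply (q : Triangle T) :
    Continuous fun w : RoughPath α T d => w.w2 q :=
  continuous_eval_of_holderNorm_le (β := 2 * α) (fun w q => w.w2 q) (fun w => w.w2_eq_zero)
    (fun _ _ => le_max_right _ _) q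

theorem RoughPath.exists_boundedBy (w : RoughPath α T d) : ∃ R : ℝ, 0 ≤ R ∧
    ∀ v : RoughPath α T d, edist v w < 1 → v.BoundedBy R := by
  refine ⟨(1 + holderNorm α w.w1 + holderNorm (2 * α) w.w2).toReal, ENNReal.toReal_nonneg,
    fun v hv => ?_⟩
  have hfin : 1 + holderNorm α w.w1 + holderNorm (2 * α) w.w2 ≠ ⊤ :=
    (ENNReal.add_lt_top.2 ⟨ENNReal.add_lt_top.2 ⟨ENNReal.one_lt_top, w.holder1⟩, w.holder2⟩).ne
  have e1 : holderNorm α (fun q => v.w1 q - w.w1 q) ≤ 1 := (le_max_left _ _).trans hv.le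
  have e2 : holderNorm (2 * α) (fun q => v.w2 q - w.w2 q) ≤ 1 := (le_max_right _ _).trans hv.le
  rw [BoundedBy, ENNReal.ofReal_toReal hfin]
  constructor
  · have h := holderNorm_triangle α v.w1 w.w1 (fun _ => 0)
    simp only [sub_zero] at h
    exact (h.trans (add_le_add e1 le_rfl)).trans le_self_add
  · have h := holderNorm_triangle (2 * α) v.w2 w.w2 (fun _ => 0)
    simp only [sub_zero] at h
    refine (h.trans (add_le_add e2 le_rfl)).trans ?_
    rw [add_right_comm]
    exact le_self_add

/-- Integration by parts for Riemann–Stieltjes integrals: left-tagged sums for `∫ f dg` and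
right-tagged sums for `∫ g df` add up to a telescoping sum. -/
theorem HasRiemannStieltjesIntegral.add_symm {f g : ℝ → ℝ} {s t I J : ℝ} (hst : s ≤ t)
    (hI : HasRiemannStieltjesIntegral f g s t I) (hJ : HasRiemannStieltjesIntegral g f s t J) :
    I + J = f t * g t - f s * g s := by
  refine eq_of_forall_dist_le fun ε hε => ?_
  obtain ⟨δ₁, hδ₁, h1⟩ := hI (ε / 2) (half_pos hε)
  obtain ⟨δ₂, hδ₂, h2⟩ := hJ (ε / 2) (half_pos hε)
  obtain ⟨n, hn⟩ := exists_nat_gt ((t - s) / min δ₁ δ₂)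
  have hδ : 0 < min δ₁ δ₂ := lt_min hδ₁ hδ₂
  have hn0 : (0 : ℝ) < n := (div_nonneg (sub_nonneg.2 hst) hδ.le).trans_lt hn
  have hmesh : (t - s) / n < min δ₁ δ₂ := by
    rw [div_lt_iff₀ hδ] at hn
    rw [div_lt_iff₀ hn0]
    linarith
  set τ : ℕ → ℝ := fun i => s + i * ((t - s) / n) with hτ
  have hstep : ∀ i, τ (i + 1) - τ i = (t - s) / n := by
    intro i
    simp only [hτ]
    push_cast
    ring
  have hmono : ∀ i, τ i ≤ τ (i + 1) := by
    intro i
    have := hstep i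
    have h3 : 0 ≤ (t - s) / n := div_nonneg (sub_nonneg.2 hst) hn0.le
    linarith
  have h0 : τ 0 = s := by simp [hτ]
  have hnn : τ n = t := by
    simp only [hτ]
    field_simp
    ring
  have h3 := h1 n τ τ h0 hnn fun i _ => ⟨le_rfl, hmono i, by
    rw [hstep]; exact hmesh.trans_le (min_le_left _ _)⟩
  have h4 := h2 n τ (fun i => τ (i + 1)) h0 hnn fun i _ => ⟨hmono i, le_rfl, by
    rw [hstep]; exact hmesh.trans_le (min_le_right _ _)⟩
  have h5 : ∑ i ∈ Finset.range n, f (τ i) * (g (τ (i + 1)) - g (τ i)) +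
      ∑ i ∈ Finset.range n, g (τ (i + 1)) * (f (τ (i + 1)) - f (τ i)) =
      f t * g t - f s * g s := by
    rw [← Finset.sum_add_distrib, ← hnn, ← h0, ← Finset.sum_range_sub (fun i => f (τ i) * g (τ i))]
    exact Finset.sum_congr rfl fun i _ => by ring
  rw [← h5, Real.dist_eq]
  rw [abs_lt] at h3 h4
  rw [abs_le]
  constructor <;> linarith [h3.1, h3.2, h4.1, h4.2]

theorem IsNaturalLift.isWeaklyGeometric {w : ℝ → EuclideanSpace ℝ (Fin d)}
    {W : RoughPath α T d} (h : IsNaturalLift w W) : W.IsWeaklyGeometric := by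
  intro q j k
  -- the integrator may be shifted by a constant
  have key : ∀ j k : Fin d, HasRiemannStieltjesIntegral (fun u => w u j - w q.1.1 j)
      (fun u => w u k - w q.1.1 k) q.1.1 q.1.2 (W.w2 q (j, k)) := by
    intro j k
    simpa [HasRiemannStieltjesIntegral] using (h q).2 j k
  have := (key j k).add_symm q.2.2.1 (key k j)
  rw [this, (h q).1]
  simp

theorem isWeaklyGeometric_of_mem {w : RoughPath α T d} (hw : w ∈ GeometricRoughPath α T d) :
    w.IsWeaklyGeometric := by
  have hcl : IsClosed {w : RoughPath α T d | w.IsWeaklyGeometric} := by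
    simp only [RoughPath.IsWeaklyGeometric, ofPred_forall]
    refine isClosed_iInter fun q => isClosed_iInter fun j => isClosed_iInter fun k => ?_
    have h1 := RoughPath.continuous_w1_apply (α := α) (d := d) q
    have h2 := RoughPath.continuous_w2_apply (α := α) (d := d) q
    exact isClosed_eq (by fun_prop) (by fun_prop)
  refine closure_minimal ?_ hcl hw
  rintro W ⟨w, -, -, h⟩
  exact h.isWeaklyGeometric

theorem RoughPath.IsWeaklyGeometric.W2_add_symm {w : RoughPath α T d}
    (hw : w.IsWeaklyGeometric) (hT : 0 ≤ T) (s t : ℝ) (j k : Fin d) :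
    w.W2 hT s t (j, k) + w.W2 hT s t (k, j) = w.W1 hT s t j * w.W1 hT s t k :=
  hw _ j k

end RoughPaths

/-! ### Bounded Lipschitz maps and Taylor remainders -/

section BoundedLipschitz

variable {E F G : Type*} [NormedAddCommGroup E] [NormedSpace ℝ E] [NormedAddCommGroup F]
  [NormedSpace ℝ F] [NormedAddCommGroup G] [NormedSpace ℝ G]

/-- `f` is bounded by `c` and Lipschitz with constant `c`. -/
def BL {E F : Type*} [NormedAddCommGroup E] [NormedAddCommGroup F] (c : ℝ) (f : E → F) : Prop :=
  (∀ y, ‖f y‖ ≤ c) ∧ ∀ y y', ‖f y - f y'‖ ≤ c * ‖y - y'‖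

section Norm

variable {E F : Type*} [NormedAddCommGroup E] [NormedAddCommGroup F]

theorem BL.nonneg {c : ℝ} {f : E → F} (h : BL c f) : 0 ≤ c := (norm_nonneg _).trans (h.1 0)

theorem BL.mono {c c' : ℝ} {f : E → F} (h : BL c f) (hc : c ≤ c') : BL c' f :=
  ⟨fun y => (h.1 y).trans hc, fun y y' => (h.2 y y').trans (by gcongr)⟩

theorem BL.zero : BL 0 (fun _ : E => (0 : F)) := ⟨by simp, by simp⟩

theorem BL.add {c c' : ℝ} {f g : E → F} (hf : BL c f) (hg : BL c' g) :
    BL (c + c') (fun y => f y + g y) := by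
  refine ⟨fun y => (norm_add_le _ _).trans (add_le_add (hf.1 y) (hg.1 y)), fun y y' => ?_⟩
  rw [add_sub_add_comm, add_mul]
  exact (norm_add_le _ _).trans (add_le_add (hf.2 y y') (hg.2 y y'))

theorem BL.sum {ι : Type*} (s : Finset ι) {c : ι → ℝ} {f : ι → E → F}
    (h : ∀ i ∈ s, BL (c i) (f i)) : BL (∑ i ∈ s, c i) (fun y => ∑ i ∈ s, f i y) := by
  classical
  induction s using Finset.induction_on with
  | empty => simpa using BL.zero
  | insert i s hi ih =>
    simp only [Finset.sum_insert hi]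
    exact (h i (Finset.mem_insert_self i s)).add
      (ih fun j hj => h j (Finset.mem_insert_of_mem hj))

end Norm

theorem BL.const_smul {E : Type*} [NormedAddCommGroup E] {a a' c : ℝ} {f : E → F} (h : BL c f) (ha : |a| ≤ a') :
    BL (a' * c) (fun y => a • f y) := by
  have h0 := (abs_nonneg a).trans ha
  refine ⟨fun y => ?_, fun y y' => ?_⟩
  · rw [norm_smul, Real.norm_eq_abs]
    exact mul_le_mul ha (h.1 y) (norm_nonneg _) h0
  · rw [← smul_sub, norm_smul, Real.norm_eq_abs, mul_assoc]
    exact mul_le_mul ha (h.2 y y') (norm_nonneg _) h0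

theorem BL.clm_apply {E : Type*} [NormedAddCommGroup E] {c c' : ℝ} {f : E → F →L[ℝ] G} {g : E → F} (hf : BL c f) (hg : BL c' g) :
    BL (2 * c * c') (fun y => f y (g y)) := by
  have h0 := hf.nonneg
  have h0' := hg.nonneg
  refine ⟨fun y => ?_, fun y y' => ?_⟩
  · refine ((f y).le_opNorm _).trans ((mul_le_mul (hf.1 y) (hg.1 y) (norm_nonneg _) h0).trans ?_)
    nlinarith [mul_nonneg h0 h0']
  · have e : f y (g y) - f y' (g y') = (f y - f y') (g y) + f y' (g y - g y') := by
      simp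
    rw [e]
    refine (norm_add_le _ _).trans ?_
    have h1 : ‖(f y - f y') (g y)‖ ≤ c * ‖y - y'‖ * c' :=
      ((f y - f y').le_opNorm _).trans
        (mul_le_mul (hf.2 y y') (hg.1 y) (norm_nonneg _) (by positivity))
    have h2 : ‖f y' (g y - g y')‖ ≤ c * (c' * ‖y - y'‖) :=
      ((f y').le_opNorm _).trans (mul_le_mul (hf.1 y') (hg.2 y y') (norm_nonneg _) h0)
    linarith

theorem BL.clm_comp {E H : Type*} [NormedAddCommGroup E] [NormedAddCommGroup H] [NormedSpace ℝ H] {c c' : ℝ}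
    {f : E → F →L[ℝ] G} {g : E → H →L[ℝ] F} (hf : BL c f) (hg : BL c' g) :
    BL (2 * c * c') (fun y => (f y).comp (g y)) := by
  have h0 := hf.nonneg
  have h0' := hg.nonneg
  refine ⟨fun y => ?_, fun y y' => ?_⟩
  · refine ((f y).opNorm_comp_le _).trans
      ((mul_le_mul (hf.1 y) (hg.1 y) (norm_nonneg _) h0).trans ?_)
    nlinarith [mul_nonneg h0 h0']
  · have e : (f y).comp (g y) - (f y').comp (g y') =
        (f y - f y').comp (g y) + (f y').comp (g y - g y') := by
      ext; simp
    rw [e]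
    refine (norm_add_le _ _).trans ?_
    have h1 : ‖(f y - f y').comp (g y)‖ ≤ c * ‖y - y'‖ * c' :=
      ((f y - f y').opNorm_comp_le _).trans
        (mul_le_mul (hf.2 y y') (hg.1 y) (norm_nonneg _) (by positivity))
    have h2 : ‖(f y').comp (g y - g y')‖ ≤ c * (c' * ‖y - y'‖) :=
      ((f y').opNorm_comp_le _).trans (mul_le_mul (hf.1 y') (hg.2 y y') (norm_nonneg _) h0)
    linarith

/-- `f` is differentiable, and `f` and its derivative are bounded by `c` and Lipschitz with
constant `c`. -/
structure C1BL (c : ℝ) (f : E → F) : Prop where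
  differentiable : Differentiable ℝ f
  bl : BL c f
  bl_fderiv : BL c (fderiv ℝ f)

theorem C1BL.nonneg {c : ℝ} {f : E → F} (h : C1BL c f) : 0 ≤ c := h.bl.nonneg

theorem C1BL.mono {c c' : ℝ} {f : E → F} (h : C1BL c f) (hc : c ≤ c') : C1BL c' f :=
  ⟨h.1, h.2.mono hc, h.3.mono hc⟩

theorem C1BL.zero : C1BL 0 (fun _ : E => (0 : F)) :=
  ⟨by fun_prop, BL.zero, by simpa [fderiv_fun_const, Pi.zero_def] using BL.zero⟩

theorem C1BL.add {c c' : ℝ} {f g : E → F} (hf : C1BL c f) (hg : C1BL c' g) :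
    C1BL (c + c') (fun y => f y + g y) := by
  refine ⟨hf.1.add hg.1, hf.2.add hg.2, ?_⟩
  have : fderiv ℝ (fun y => f y + g y) = fun y => fderiv ℝ f y + fderiv ℝ g y :=
    funext fun y => fderiv_fun_add (hf.1 y) (hg.1 y)
  rw [this]
  exact hf.3.add hg.3

theorem C1BL.sum {ι : Type*} (s : Finset ι) {c : ι → ℝ} {f : ι → E → F}
    (h : ∀ i ∈ s, C1BL (c i) (f i)) : C1BL (∑ i ∈ s, c i) (fun y => ∑ i ∈ s, f i y) := by
  classical
  induction s using Finset.induction_on with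
  | empty => simpa using C1BL.zero
  | insert i s hi ih =>
    simp only [Finset.sum_insert hi]
    exact (h i (Finset.mem_insert_self i s)).add
      (ih fun j hj => h j (Finset.mem_insert_of_mem hj))

theorem C1BL.const_smul {a a' c : ℝ} {f : E → F} (h : C1BL c f) (ha : |a| ≤ a') :
    C1BL (a' * c) (fun y => a • f y) := by
  refine ⟨h.1.const_smul a, h.2.const_smul ha, ?_⟩
  have : fderiv ℝ (fun y => a • f y) = fun y => a • fderiv ℝ f y :=
    funext fun y => fderiv_fun_const_smul (h.1 y) a
  rw [this]
  exact h.3.const_smul ha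

theorem C1BL.clm_apply {c : ℝ} {f : E → F →L[ℝ] F} {g : E → F} (hf : C1BL c f)
    (hg : C1BL c g) : C1BL (4 * c * c) (fun y => f y (g y)) := by
  have h0 := mul_nonneg hf.nonneg hf.nonneg
  refine ⟨hf.1.clm_apply hg.1, (hf.2.clm_apply hg.2).mono (by nlinarith), ?_⟩
  have : fderiv ℝ (fun y => f y (g y)) =
      fun y => (f y).comp (fderiv ℝ g y) + (fderiv ℝ f y).flip (g y) :=
    funext fun y => fderiv_clm_apply (hf.1 y) (hg.1 y)
  rw [this]
  have h1 : BL c (fun y => (fderiv ℝ f y).flip) := by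
    refine ⟨fun y => ?_, fun y y' => ?_⟩
    · rw [ContinuousLinearMap.opNorm_flip]
      exact hf.3.1 y
    · have : (fderiv ℝ f y).flip - (fderiv ℝ f y').flip =
        (fderiv ℝ f y - fderiv ℝ f y').flip := by ext; simp
      rw [this, ContinuousLinearMap.opNorm_flip]
      exact hf.3.2 y y'
  exact ((hf.2.clm_comp hg.3).add (h1.clm_apply hg.2)).mono (by linarith)

theorem C1BL.norm_fderiv_sub_le {c : ℝ} {g : E → F} (hg : C1BL c g) (y v : E) :
    ‖fderiv ℝ g (y + v) - fderiv ℝ g y‖ ≤ c * ‖v‖ := by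
  simpa using hg.3.2 (y + v) y

/-- Increments `g (y + v) - g y` depend in a Lipschitz way on `y` and `v`. -/
theorem C1BL.four_point {c : ℝ} {g : E → F} (hg : C1BL c g) (y y' v v' : E) :
    ‖(g (y + v) - g y) - (g (y' + v') - g y')‖ ≤ c * ‖v - v'‖ + c * ‖v‖ * ‖y - y'‖ := by
  have h1 : ‖(g (y + v) - g y) - (g (y' + v) - g y')‖ ≤ c * ‖v‖ * ‖y - y'‖ := by
    refine Convex.norm_image_sub_le_of_norm_hasFDerivWithin_le (𝕜 := ℝ) (s := univ)
      (f := fun y => g (y + v) - g y)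
      (f' := fun y => fderiv ℝ g (y + v) - fderiv ℝ g y) (fun x _ => ?_)
      (fun x _ => hg.norm_fderiv_sub_le x v) convex_univ (mem_univ _) (mem_univ _)
    have := ((hasFDerivAt_comp_add_right v).2 (hg.1 (x + v)).hasFDerivAt).sub (hg.1 x).hasFDerivAt
    exact this.hasFDerivWithinAt
  have h2 : ‖g (y' + v) - g (y' + v')‖ ≤ c * ‖v - v'‖ := by
    simpa using hg.2.2 (y' + v) (y' + v')
  have e : (g (y + v) - g y) - (g (y' + v') - g y') =
      (g (y' + v) - g (y' + v')) + ((g (y + v) - g y) - (g (y' + v) - g y')) := by abel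
  rw [e]
  exact (norm_add_le _ _).trans (add_le_add h2 h1)

theorem C1BL.bl_increment {c e L : ℝ} {g : E → F} (hg : C1BL c g) {u v : E → E}
    (hL : 0 ≤ L) (hu : ∀ y y', ‖u y - u y'‖ ≤ L * ‖y - y'‖) (hv : BL e v) :
    BL (c * e * (1 + L)) (fun y => g (u y + v y) - g (u y)) := by
  have hc := hg.nonneg
  have he := hv.nonneg
  refine ⟨fun y => ?_, fun y y' => ?_⟩
  · have h1 : ‖g (u y + v y) - g (u y)‖ ≤ c * ‖v y‖ := by simpa using hg.2.2 (u y + v y) (u y)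
    have h2 := mul_le_mul_of_nonneg_left (hv.1 y) hc
    nlinarith [mul_nonneg (mul_nonneg hc he) hL]
  · refine (hg.four_point _ _ _ _).trans ?_
    have h1 := mul_le_mul_of_nonneg_left (hv.2 y y') hc
    have h2 : c * ‖v y‖ * ‖u y - u y'‖ ≤ c * e * (L * ‖y - y'‖) :=
      mul_le_mul (mul_le_mul_of_nonneg_left (hv.1 y) hc) (hu y y') (norm_nonneg _)
        (mul_nonneg hc he)
    linarith

theorem C1BL.norm_taylor_le {c : ℝ} {g : E → F} (hg : C1BL c g) (y v : E) :
    ‖g (y + v) - g y - fderiv ℝ g y v‖ ≤ c * ‖v‖ * ‖v‖ := by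
  have := Convex.norm_image_sub_le_of_norm_hasFDerivWithin_le (𝕜 := ℝ)
    (s := Metric.closedBall (0 : E) ‖v‖) (f := fun x => g (y + x) - g y - fderiv ℝ g y x)
    (f' := fun x => fderiv ℝ g (y + x) - fderiv ℝ g y) (C := c * ‖v‖) (x := 0) (y := v)
    (fun x _ => ?_) (fun x hx => ?_) (convex_closedBall _ _) (by simp) (by simp)
  · simpa using this
  · have := (((hasFDerivAt_comp_add_left y).2 (hg.1 (y + x)).hasFDerivAt).sub_const (g y)).sub
      (fderiv ℝ g y).hasFDerivAt
    exact this.hasFDerivWithinAt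
  · have hc := hg.nonneg
    have hx' : ‖x‖ ≤ ‖v‖ := by simpa using hx
    exact (hg.norm_fderiv_sub_le y x).trans (by gcongr)

/-- The first-order Taylor remainder of a map with Lipschitz second derivative, along a bounded
Lipschitz increment of size `e`, is bounded and Lipschitz with a constant of order `e²`. -/
theorem C1BL.bl_taylor {c e : ℝ} {g : E → F} (hg : C1BL c g) (hg' : C1BL c (fderiv ℝ g))
    {v : E → E} (hv : BL e v) :
    BL (2 * c * e * e) (fun y => g (y + v y) - g y - fderiv ℝ g y (v y)) := by
  have hc := hg.nonneg
  have he := hv.nonneg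
  have hcee := mul_nonneg (mul_nonneg hc he) he
  refine ⟨fun y => (hg.norm_taylor_le y (v y)).trans ?_, fun y y' => ?_⟩
  · have : c * ‖v y‖ * ‖v y‖ ≤ c * e * e :=
      mul_le_mul (mul_le_mul_of_nonneg_left (hv.1 y) hc) (hv.1 y) (norm_nonneg _)
        (mul_nonneg hc he)
    linarith
  · have hder : ∀ z x : E, HasFDerivAt (fun x => g (z + x) - g z - fderiv ℝ g z x)
        (fderiv ℝ g (z + x) - fderiv ℝ g z) x := fun z x =>
      (((hasFDerivAt_comp_add_left z).2 (hg.1 (z + x)).hasFDerivAt).sub_const (g z)).sub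
        (fderiv ℝ g z).hasFDerivAt
    have h1 : ‖(g (y + v y) - g y - fderiv ℝ g y (v y)) -
        (g (y' + v y) - g y' - fderiv ℝ g y' (v y))‖ ≤ c * e * ‖y - y'‖ * e := by
      have := Convex.norm_image_sub_le_of_norm_hasFDerivWithin_le (𝕜 := ℝ)
        (s := Metric.closedBall (0 : E) e)
        (f := fun x => (g (y + x) - g y - fderiv ℝ g y x) -
          (g (y' + x) - g y' - fderiv ℝ g y' x))
        (f' := fun x => (fderiv ℝ g (y + x) - fderiv ℝ g y) -
          (fderiv ℝ g (y' + x) - fderiv ℝ g y')) (C := c * e * ‖y - y'‖) (x := 0) (y := v y)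
        (fun x _ => ((hder y x).sub (hder y' x)).hasFDerivWithinAt)
        (fun x hx => ?_) (convex_closedBall _ _) (by simpa using he) (by simpa using hv.1 y)
      · simp only [add_zero, sub_self, map_zero, sub_zero] at this
        exact this.trans (mul_le_mul_of_nonneg_left (hv.1 y) (by positivity))
      · have hx' : ‖x‖ ≤ e := by simpa using hx
        refine (hg'.four_point y y' x x).trans ?_
        rw [sub_self, norm_zero, mul_zero, zero_add]
        gcongr
    have h2 : ‖(g (y' + v y) - g y' - fderiv ℝ g y' (v y)) -
        (g (y' + v y') - g y' - fderiv ℝ g y' (v y'))‖ ≤ c * e * (e * ‖y - y'‖) := by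
      refine (Convex.norm_image_sub_le_of_norm_hasFDerivWithin_le (𝕜 := ℝ)
        (s := Metric.closedBall (0 : E) e)
        (f := fun x => g (y' + x) - g y' - fderiv ℝ g y' x) (C := c * e)
        (fun x _ => (hder y' x).hasFDerivWithinAt)
        (fun x hx => ?_) (convex_closedBall _ _) (by simpa using hv.1 y')
        (by simpa using hv.1 y)).trans (mul_le_mul_of_nonneg_left (hv.2 y y') (by positivity))
      have hx' : ‖x‖ ≤ e := by simpa using hx
      exact (hg.norm_fderiv_sub_le y' x).trans (by gcongr)
    exact (norm_sub_le_norm_sub_add_norm_sub _ _ _).trans ((add_le_add h1 h2).trans (by linarith))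

end BoundedLipschitz

/-! ### The local expansion of the equation -/

section Germ

variable {E : Type*} [NormedAddCommGroup E] [NormedSpace ℝ E] {d : ℕ}

/-- The second-order increment
`∑ₖ aₖ Aₖ(y) + ∑ⱼₖ bⱼₖ DAₖ(y) Aⱼ(y) + h A₀(y)` of the equation in coordinates. -/
def germ (A₀ : E → E) (A : Fin d → E → E) (a : Fin d → ℝ) (b : Fin d → Fin d → ℝ) (h : ℝ)
    (y : E) : E :=
  ∑ k, a k • A k y + ∑ j, ∑ k, b j k • fderiv ℝ (A k) y (A j y) + h • A₀ y

/-- Bounds on the coefficient fields: all fields, and the derivatives of the driven ones, are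
`C^1` with bounded and Lipschitz value and derivative. -/
structure FieldBound (K : ℝ) (A₀ : E → E) (A : Fin d → E → E) : Prop where
  drift : C1BL K A₀
  field : ∀ k, C1BL K (A k)
  field_fderiv : ∀ k, C1BL K (fderiv ℝ (A k))

variable {K R x : ℝ} {A₀ : E → E} {A : Fin d → E → E} {a a' : Fin d → ℝ}
  {b b' : Fin d → Fin d → ℝ} {h h' : ℝ}

theorem germ_c1BL (hA : FieldBound K A₀ A) (hR : 0 ≤ R) (hx : 0 ≤ x) (hx1 : x ≤ 1)
    (ha : ∀ k, |a k| ≤ R * x) (hb : ∀ j k, |b j k| ≤ R * x ^ 2) (hh : |h| ≤ x ^ 2) :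
    C1BL ((d * R * K + d * d * R * (4 * K * K) + K) * x) (germ A₀ A a b h) := by
  have hK := hA.drift.nonneg
  have h1 : C1BL (∑ _k : Fin d, R * x * K) fun y => ∑ k, a k • A k y :=
    C1BL.sum _ fun k _ => (hA.field k).const_smul (ha k)
  have h2 : C1BL (∑ _j : Fin d, ∑ _k : Fin d, R * x ^ 2 * (4 * K * K))
      fun y => ∑ j, ∑ k, b j k • fderiv ℝ (A k) y (A j y) :=
    C1BL.sum _ fun j _ => C1BL.sum _ fun k _ =>
      ((hA.field_fderiv k).clm_apply (hA.field j)).const_smul (hb j k)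
  have h3 : C1BL (x ^ 2 * K) fun y => h • A₀ y := hA.drift.const_smul hh
  refine ((h1.add h2).add h3).mono ?_
  have hx2 : x ^ 2 ≤ x := by nlinarith
  simp only [Finset.sum_const, Finset.card_univ, Fintype.card_fin, nsmul_eq_mul]
  have e1 : (d : ℝ) * (d * (R * x ^ 2 * (4 * K * K))) ≤ d * d * R * (4 * K * K) * x := by
    have : (d : ℝ) * d * R * (4 * K * K) * x ^ 2 ≤ d * d * R * (4 * K * K) * x := by gcongr
    linarith
  have e2 : x ^ 2 * K ≤ K * x := by nlinarith
  linarith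

/-- The defect of the germ: two consecutive increments compared with one increment whose
coefficients are given by Chen's relations. -/
def germDefect (A₀ : E → E) (A : Fin d → E → E) (a a' : Fin d → ℝ) (b b' : Fin d → Fin d → ℝ)
    (h h' : ℝ) (y : E) : E :=
  germ A₀ A a b h y + germ A₀ A a' b' h' (y + germ A₀ A a b h y) -
    germ A₀ A (fun k => a k + a' k) (fun j k => b j k + b' j k + a j * a' k) (h + h') y

/-- In the defect all terms of order less than three cancel. -/
theorem germDefect_eq (y : E) : germDefect A₀ A a a' b b' h h' y =
    ∑ k, a' k • (A k (y + germ A₀ A a b h y) - A k y -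
      fderiv ℝ (A k) y (germ A₀ A a b h y)) +
    ∑ k, a' k • fderiv ℝ (A k) y
      (∑ j, ∑ l, b j l • fderiv ℝ (A l) y (A j y) + h • A₀ y) +
    ∑ j, ∑ k, b' j k • (fderiv ℝ (A k) (y + germ A₀ A a b h y) (A j (y + germ A₀ A a b h y)) -
      fderiv ℝ (A k) y (A j y)) +
    h' • (A₀ (y + germ A₀ A a b h y) - A₀ y) := by
  have e1 : ∀ k, fderiv ℝ (A k) y (germ A₀ A a b h y) =
      ∑ j, a j • fderiv ℝ (A k) y (A j y) + fderiv ℝ (A k) y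
      (∑ j, ∑ l, b j l • fderiv ℝ (A l) y (A j y) + h • A₀ y) := by
    intro k
    rw [germ, add_assoc, map_add, map_sum]
    simp only [map_smul]
  have e2 : ∑ k, a' k • ∑ j, a j • fderiv ℝ (A k) y (A j y) =
      ∑ j, ∑ k, (a j * a' k) • fderiv ℝ (A k) y (A j y) := by
    rw [Finset.sum_comm]
    refine Finset.sum_congr rfl fun k _ => ?_
    rw [Finset.smul_sum]
    refine Finset.sum_congr rfl fun j _ => ?_
    rw [smul_smul, mul_comm]
  simp only [e1, smul_sub, smul_add, Finset.sum_sub_distrib, Finset.sum_add_distrib, e2]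
  rw [germDefect]
  set v := germ A₀ A a b h y with hv
  rw [germ, germ, hv, germ]
  simp only [add_smul, Finset.sum_add_distrib]
  abel

theorem germDefect_bl (hA : FieldBound K A₀ A) (hR : 0 ≤ R) (hx : 0 ≤ x) (hx1 : x ≤ 1)
    (ha : ∀ k, |a k| ≤ R * x) (hb : ∀ j k, |b j k| ≤ R * x ^ 2) (hh : |h| ≤ x ^ 2)
    (ha' : ∀ k, |a' k| ≤ R * x) (hb' : ∀ j k, |b' j k| ≤ R * x ^ 2) (hh' : |h'| ≤ x ^ 2)
    {K₁ : ℝ} (hK₁ : K₁ = d * R * K + d * d * R * (4 * K * K) + K) :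
    BL ((d * (R * (2 * K * K₁ * K₁)) + d * (R * (2 * K * (d * (d * (R * (4 * K * K))) + K))) +
      d * (d * (R * (4 * K * K * K₁ * (1 + 1)))) + K * K₁ * (1 + 1)) * x ^ 3)
      (germDefect A₀ A a a' b b' h h') := by
  have hΞ := (germ_c1BL hA hR hx hx1 ha hb hh).bl
  rw [← hK₁] at hΞ
  have hid : ∀ y y' : E, ‖(fun y => y) y - (fun y => y) y'‖ ≤ 1 * ‖y - y'‖ := by simp
  have h1 : BL (∑ _k : Fin d, R * x * (2 * K * (K₁ * x) * (K₁ * x))) fun y =>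
      ∑ k, a' k • (A k (y + germ A₀ A a b h y) - A k y -
        fderiv ℝ (A k) y (germ A₀ A a b h y)) :=
    BL.sum _ fun k _ => ((hA.field k).bl_taylor (hA.field_fderiv k) hΞ).const_smul (ha' k)
  have h2 : BL (∑ _j : Fin d, ∑ _k : Fin d, R * x ^ 2 * (4 * K * K) + x ^ 2 * K)
      fun y => ∑ j, ∑ l, b j l • fderiv ℝ (A l) y (A j y) + h • A₀ y :=
    (BL.sum _ fun j _ => BL.sum _ fun k _ =>
      ((hA.field_fderiv k).clm_apply (hA.field j)).bl.const_smul (hb j k)).add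
      (hA.drift.bl.const_smul hh)
  have h3 : BL (∑ _k : Fin d, R * x *
      (2 * K * (∑ _j : Fin d, ∑ _k : Fin d, R * x ^ 2 * (4 * K * K) + x ^ 2 * K)))
      fun y => ∑ k, a' k • fderiv ℝ (A k) y
      (∑ j, ∑ l, b j l • fderiv ℝ (A l) y (A j y) + h • A₀ y) :=
    BL.sum _ fun k _ => ((hA.field_fderiv k).bl.clm_apply h2).const_smul (ha' k)
  have h4 : BL (∑ _j : Fin d, ∑ _k : Fin d, R * x ^ 2 * (4 * K * K * (K₁ * x) * (1 + 1)))
      fun y => ∑ j, ∑ k, b' j k •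
      (fderiv ℝ (A k) (y + germ A₀ A a b h y) (A j (y + germ A₀ A a b h y)) -
      fderiv ℝ (A k) y (A j y)) :=
    BL.sum _ fun j _ => BL.sum _ fun k _ =>
      (((hA.field_fderiv k).clm_apply (hA.field j)).bl_increment zero_le_one hid hΞ).const_smul
        (hb' j k)
  have h5 : BL (x ^ 2 * (K * (K₁ * x) * (1 + 1))) fun y =>
      h' • (A₀ (y + germ A₀ A a b h y) - A₀ y) :=
    (hA.drift.bl_increment zero_le_one hid hΞ).const_smul hh'
  have e := ((h1.add h3).add h4).add h5
  rw [show germDefect A₀ A a a' b b' h h' = _ from funext germDefect_eq]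
  refine e.mono (le_of_eq ?_)
  simp only [Finset.sum_const, Finset.card_univ, Fintype.card_fin, nsmul_eq_mul]
  ring

end Germ

/-! ### Almost flows and their Euler schemes -/

section AlmostFlow

variable {E : Type*} [NormedAddCommGroup E] [NormedSpace ℝ E]

/-- The maps `y ↦ y + Ξ s t y` form an almost flow: on time intervals of length `h ≤ 1` the
increment `Ξ` has size `h^α` in `C^{1,1}`, and the failure of the flow property has size `h^θ`
as a bounded Lipschitz map. -/
structure AlmostFlow (K α θ : ℝ) (Ξ : ℝ → ℝ → E → E) : Prop where
  c1BL : ∀ s t, s ≤ t → t - s ≤ 1 → C1BL (K * (t - s) ^ α) (Ξ s t)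
  defect : ∀ s u t, s ≤ u → u ≤ t → t - s ≤ 1 →
    BL (K * (t - s) ^ θ) (fun y => Ξ s u y + Ξ u t (y + Ξ s u y) - Ξ s t y)
  continuous : Continuous fun q : ℝ × ℝ × E => Ξ q.1 q.2.1 q.2.2

/-- `n` steps of the Euler scheme along the grid `τ`, starting at time `τ i`. -/
def euler {E : Type*} [NormedAddCommGroup E] (Ξ : ℝ → ℝ → E → E) (τ : ℕ → ℝ) (i : ℕ) : ℕ → E → E
  | 0, y => y
  | n + 1, y => euler Ξ τ i n y + Ξ (τ (i + n)) (τ (i + n + 1)) (euler Ξ τ i n y)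

theorem euler_add {E : Type*} [NormedAddCommGroup E] (Ξ : ℝ → ℝ → E → E) (τ : ℕ → ℝ) (i m n : ℕ) (y : E) :
    euler Ξ τ i (m + n) y = euler Ξ τ (i + m) n (euler Ξ τ i m y) := by
  induction n with
  | zero => rfl
  | succ n ih =>
    rw [← add_assoc, euler, euler, ih]
    simp only [add_assoc]

/-- Constants for the stability of Euler schemes: `L` bounds the distance to the almost flow,
`h₀` is the length of the time intervals considered. -/
structure SchemeConst (K α θ L h₀ : ℝ) : Prop where
  K_nonneg : 0 ≤ K
  alpha_pos : 0 < α
  theta : 1 < θ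
  L_nonneg : 0 ≤ L
  h_pos : 0 < h₀
  h_le : h₀ ≤ 1
  L_eq : L * (1 - (2 / 3 : ℝ) ^ (θ - 1)) = 2 * K
  K_le : 6 * (K * h₀ ^ α) ≤ 1 - (2 / 3 : ℝ) ^ (θ - 1)
  L_le : 6 * (L * h₀ ^ θ) ≤ 1 - (2 / 3 : ℝ) ^ (θ - 1)

theorem exists_rpow_le {α c : ℝ} (hα : 0 < α) (hc : 0 < c) :
    ∃ h₀ : ℝ, 0 < h₀ ∧ h₀ ≤ 1 ∧ h₀ ^ α ≤ c := by
  refine ⟨min 1 (c ^ (1 / α)), by positivity, min_le_left _ _, ?_⟩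
  calc (min 1 (c ^ (1 / α))) ^ α ≤ (c ^ (1 / α)) ^ α :=
        Real.rpow_le_rpow (by positivity) (min_le_right _ _) hα.le
    _ = c := by rw [← Real.rpow_mul hc.le, one_div, inv_mul_cancel₀ hα.ne', Real.rpow_one]

theorem exists_schemeConst {K α θ : ℝ} (hK : 0 ≤ K) (hα : 0 < α) (hθ : 1 < θ) (hαθ : α ≤ θ) :
    ∃ L h₀, SchemeConst K α θ L h₀ := by
  have hq : (2 / 3 : ℝ) ^ (θ - 1) < 1 :=
    Real.rpow_lt_one (by norm_num) (by norm_num) (by linarith)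
  set q := (2 / 3 : ℝ) ^ (θ - 1) with hqdef
  have hq' : 0 < 1 - q := by linarith
  set L := 2 * K / (1 - q) with hL
  have hL0 : 0 ≤ L := by positivity
  obtain ⟨h₀, h1, h2, h3⟩ := exists_rpow_le hα (c := (1 - q) / (6 * (K + L + 1))) (by positivity)
  rw [le_div_iff₀ (by positivity)] at h3
  have h4 : h₀ ^ θ ≤ h₀ ^ α := Real.rpow_le_rpow_of_exponent_ge h1 h2 hαθ
  have h5 : 0 ≤ h₀ ^ α := Real.rpow_nonneg h1.le _
  refine ⟨L, h₀, hK, hα, hθ, hL0, h1, h2, ?_, ?_, ?_⟩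
  · rw [← hqdef, hL]; field_simp
  · nlinarith [mul_nonneg hL0 h5]
  · nlinarith [mul_nonneg hK h5, mul_le_mul_of_nonneg_left h4 hL0]

theorem BL.comp_lipschitz {F G H : Type*} [NormedAddCommGroup F] [NormedAddCommGroup G]
    [NormedAddCommGroup H] {c L : ℝ} {f : F → G} {u : H → F} (hf : BL c f)
    (hL : 1 ≤ L) (hu : ∀ y y', ‖u y - u y'‖ ≤ L * ‖y - y'‖) : BL (c * L) (fun y => f (u y)) := by
  have hc := hf.nonneg
  refine ⟨fun y => (hf.1 _).trans (le_mul_of_one_le_right hc hL), fun y y' => ?_⟩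
  refine (hf.2 _ _).trans ?_
  rw [mul_assoc]
  exact mul_le_mul_of_nonneg_left (hu y y') hc

theorem AlmostFlow.diag {K α θ : ℝ} {Ξ : ℝ → ℝ → E → E} (hΞ : AlmostFlow K α θ Ξ) (hα : 0 < α)
    (s : ℝ) (y : E) : Ξ s s y = 0 := by
  have := (hΞ.c1BL s s le_rfl (by simp)).bl.1 y
  simpa [Real.zero_rpow hα.ne'] using this

variable {K α θ L h₀ : ℝ} {Ξ : ℝ → ℝ → E → E}

/-- Splitting an interval into two pieces, each at most two thirds of the whole, decreases the
sum of the `θ`-th powers of the lengths. -/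
theorem rpow_add_rpow_le {θ x y h : ℝ} (hθ : 1 < θ) (hx : 0 < x) (hy : 0 < y) (hxy : x + y = h)
    (hx' : x ≤ 2 / 3 * h) (hy' : y ≤ 2 / 3 * h) :
    x ^ θ + y ^ θ ≤ (2 / 3 : ℝ) ^ (θ - 1) * h ^ θ := by
  have hh : 0 < h := by linarith
  have e : ∀ x : ℝ, 0 < x → x ^ θ = x * x ^ (θ - 1) := fun x hx => by
    conv_lhs => rw [show θ = 1 + (θ - 1) by ring, Real.rpow_add hx, Real.rpow_one]
  have e1 : x ^ (θ - 1) ≤ (2 / 3 : ℝ) ^ (θ - 1) * h ^ (θ - 1) := by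
    rw [← Real.mul_rpow (by norm_num) hh.le]
    exact Real.rpow_le_rpow hx.le hx' (by linarith)
  have e2 : y ^ (θ - 1) ≤ (2 / 3 : ℝ) ^ (θ - 1) * h ^ (θ - 1) := by
    rw [← Real.mul_rpow (by norm_num) hh.le]
    exact Real.rpow_le_rpow hy.le hy' (by linarith)
  rw [e x hx, e y hy, e h hh]
  have h1 := mul_le_mul_of_nonneg_left e1 hx.le
  have h2 := mul_le_mul_of_nonneg_left e2 hy.le
  rw [← hxy] at h1 h2 ⊢
  linarith

theorem lipschitz_step {E : Type*} [NormedAddCommGroup E] {ε a L' : ℝ} {Ψ ρ : E → E} (hΨ : BL ε Ψ) (hρ : BL a ρ)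
    (hL : 1 + ε + a ≤ L') (y y' : E) :
    ‖(y + Ψ y + ρ y) - (y' + Ψ y' + ρ y')‖ ≤ L' * ‖y - y'‖ := by
  have e : (y + Ψ y + ρ y) - (y' + Ψ y' + ρ y') =
      (y - y') + (Ψ y - Ψ y') + (ρ y - ρ y') := by abel
  rw [e]
  refine (norm_add₃_le).trans ?_
  have h1 := hΨ.2 y y'
  have h2 := hρ.2 y y'
  have h3 := mul_le_mul_of_nonneg_right hL (norm_nonneg (y - y'))
  linarith

/-- Euler schemes on uniform grids stay close to the almost flow as bounded Lipschitz maps,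
uniformly in the number of steps. The number of steps is halved: the contraction factor
`(2/3)^(θ-1)` beats the errors made when the two halves are put together. -/
theorem euler_sub_bl (hc : SchemeConst K α θ L h₀) (hΞ : AlmostFlow K α θ Ξ) {τ : ℕ → ℝ}
    {δ : ℝ} (hδ : 0 < δ) (hτ : ∀ i n : ℕ, τ (i + n) - τ i = n * δ) (n : ℕ) :
    ∀ i, n * δ ≤ h₀ → BL (L * (n * δ) ^ θ)
      (fun y => euler Ξ τ i n y - y - Ξ (τ i) (τ (i + n)) y) := by
  induction n using Nat.strong_induction_on with
  | _ n ih =>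
  intro i hn
  rcases Nat.lt_or_ge n 2 with h2 | h2
  · have hz : (fun y => euler Ξ τ i n y - y - Ξ (τ i) (τ (i + n)) y) = fun _ => 0 := by
      funext y
      interval_cases n
      · simp [euler, hΞ.diag hc.alpha_pos]
      · simp [euler]
    rw [hz]
    exact BL.zero.mono (mul_nonneg hc.L_nonneg (Real.rpow_nonneg (by positivity) _))
  · obtain ⟨m, m', hmn, hm0, hm'0, hm, hm'⟩ : ∃ m m' : ℕ, m + m' = n ∧ 0 < m ∧ 0 < m' ∧
        3 * m ≤ 2 * n ∧ 3 * m' ≤ 2 * n :=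
      ⟨n / 2, n - n / 2, by omega, by omega, by omega, by omega, by omega⟩
    have hnr : (m : ℝ) + m' = n := by exact_mod_cast hmn
    have hmr : 3 * (m : ℝ) ≤ 2 * n := by exact_mod_cast hm
    have hmr' : 3 * (m' : ℝ) ≤ 2 * n := by exact_mod_cast hm'
    have hm0r : (0 : ℝ) < m := by exact_mod_cast hm0
    have hm0r' : (0 : ℝ) < m' := by exact_mod_cast hm'0
    have hmh : m * δ ≤ h₀ := by nlinarith
    have hmh' : m' * δ ≤ h₀ := by nlinarith
    have hsplit := rpow_add_rpow_le (θ := θ) hc.theta (mul_pos hm0r hδ) (mul_pos hm0r' hδ)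
      (h := n * δ) (by rw [← hnr]; ring) (by nlinarith) (by nlinarith)
    have hρ := ih m (by omega) i hmh
    have hρ' := ih m' (by omega) (i + m) hmh'
    have hL0 := hc.L_nonneg
    set q := (2 / 3 : ℝ) ^ (θ - 1) with hq
    have hq0 : 0 < q := by positivity
    set ε := (1 - q) / 6 with hε
    have hsub : ∀ k : ℕ, k * δ ≤ h₀ → L * (k * δ) ^ θ ≤ ε := fun k hk => by
      have := mul_le_mul_of_nonneg_left (Real.rpow_le_rpow (by positivity) hk
        (by linarith [hc.theta] : 0 ≤ θ)) hL0
      have := hc.L_le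
      rw [hε]
      linarith
    have hsubK : ∀ k : ℕ, k * δ ≤ h₀ → K * (k * δ) ^ α ≤ ε := fun k hk => by
      have := mul_le_mul_of_nonneg_left (Real.rpow_le_rpow (by positivity) hk
        hc.alpha_pos.le) hc.K_nonneg
      have := hc.K_le
      rw [hε]
      linarith
    have hmono : ∀ i k : ℕ, τ i ≤ τ (i + k) := fun i k => by
      have := hτ i k
      have h3 : 0 ≤ k * δ := by positivity
      linarith
    have hε0 : 0 ≤ ε := (mul_nonneg hL0 (Real.rpow_nonneg (by positivity) _)).trans (hsub n hn)
    have hε1 : ε ≤ 1 := by rw [hε]; linarith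
    have hin : i + n = i + m + m' := by omega
    have hΞ1 : C1BL ε (Ξ (τ i) (τ (i + m))) :=
      (hΞ.c1BL _ _ (hmono i m) (by rw [hτ]; linarith [hc.h_le])).mono
        (by rw [hτ]; exact hsubK m hmh)
    have hΞ2 : C1BL ε (Ξ (τ (i + m)) (τ (i + n))) := by
      rw [hin]
      exact (hΞ.c1BL _ _ (hmono (i + m) m') (by rw [hτ]; linarith [hc.h_le])).mono
        (by rw [hτ]; exact hsubK m' hmh')
    have hD := hΞ.defect (τ i) (τ (i + m)) (τ (i + n)) (hmono i m)
      (by rw [hin]; exact hmono (i + m) m') (by rw [hτ]; linarith [hc.h_le])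
    rw [hτ] at hD
    set ρ : E → E := fun y => euler Ξ τ i m y - y - Ξ (τ i) (τ (i + m)) y with hρdef
    have hc_lip : ∀ y y', ‖euler Ξ τ i m y - euler Ξ τ i m y'‖ ≤ (1 + 2 * ε) * ‖y - y'‖ := by
      intro y y'
      have := lipschitz_step hΞ1.bl hρ (L' := 1 + 2 * ε) (by linarith [hsub m hmh]) y y'
      simpa [hρdef] using this
    have hμ_lip : ∀ y y', ‖(y + Ξ (τ i) (τ (i + m)) y) - (y' + Ξ (τ i) (τ (i + m)) y')‖ ≤
        (1 + ε) * ‖y - y'‖ := by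
      intro y y'
      have := lipschitz_step hΞ1.bl BL.zero (L' := 1 + ε) (by linarith) y y'
      simpa using this
    have t1 := hρ'.comp_lipschitz (by linarith : 1 ≤ 1 + 2 * ε) hc_lip
    have t2 := hΞ2.bl_increment (by linarith : 0 ≤ 1 + ε) hμ_lip hρ
    have key : (fun y => euler Ξ τ i n y - y - Ξ (τ i) (τ (i + n)) y) = fun y =>
        (euler Ξ τ (i + m) m' (euler Ξ τ i m y) - euler Ξ τ i m y -
          Ξ (τ (i + m)) (τ (i + m + m')) (euler Ξ τ i m y)) +
        (Ξ (τ (i + m)) (τ (i + n)) (y + Ξ (τ i) (τ (i + m)) y + ρ y) -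
          Ξ (τ (i + m)) (τ (i + n)) (y + Ξ (τ i) (τ (i + m)) y)) + ρ y +
        (Ξ (τ i) (τ (i + m)) y + Ξ (τ (i + m)) (τ (i + n)) (y + Ξ (τ i) (τ (i + m)) y) -
          Ξ (τ i) (τ (i + n)) y) := by
      funext y
      have e1 : y + Ξ (τ i) (τ (i + m)) y + ρ y = euler Ξ τ i m y := by
        rw [hρdef]; simp
      rw [e1, ← euler_add, hmn, ← hin, hρdef]
      beta_reduce
      abel
    rw [key]
    refine (((t1.add t2).add hρ).add hD).mono ?_
    have hh0 : 0 ≤ (n * δ) ^ θ := Real.rpow_nonneg (by positivity) _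
    set x := (m * δ) ^ θ
    set x' := (m' * δ) ^ θ
    have hx : 0 ≤ x := Real.rpow_nonneg (by positivity) _
    have hx' : 0 ≤ x' := Real.rpow_nonneg (by positivity) _
    set y := (n * δ) ^ θ
    have hLx := mul_nonneg hL0 hx
    have hLx' := mul_nonneg hL0 hx'
    have a1 : L * x' * (1 + 2 * ε) + ε * (L * x) * (1 + (1 + ε)) + L * x ≤
        L * (x + x') * (1 + 3 * ε) := by
      nlinarith [mul_nonneg hLx hε0, mul_nonneg hLx' hε0,
        mul_nonneg (mul_nonneg hLx hε0) (sub_nonneg.2 hε1)]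
    have a2 : L * (x + x') * (1 + 3 * ε) ≤ L * (q * y) * (1 + 3 * ε) := by
      gcongr
    have a3 : L * (q * y) * (1 + 3 * ε) + K * y ≤ L * y := by
      have hq1 : q * (1 + 3 * ε) ≤ (1 + q) / 2 := by rw [hε]; nlinarith [sq_nonneg (1 - q)]
      have hLy := mul_nonneg hL0 hh0
      have := hc.L_eq
      rw [← hq] at this
      have hK : K * y = L * y * ((1 - q) / 2) := by
        rw [show K = L * (1 - q) / 2 by linarith]; ring
      rw [hK]
      nlinarith [mul_le_mul_of_nonneg_left hq1 hLy]
    linarith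

theorem euler_lipschitz (hc : SchemeConst K α θ L h₀) (hΞ : AlmostFlow K α θ Ξ) {τ : ℕ → ℝ}
    {δ : ℝ} (hδ : 0 < δ) (hτ : ∀ i n : ℕ, τ (i + n) - τ i = n * δ) (n i : ℕ) (hn : n * δ ≤ h₀)
    (y y' : E) : ‖euler Ξ τ i n y - euler Ξ τ i n y'‖ ≤ 2 * ‖y - y'‖ := by
  have h1 := euler_sub_bl hc hΞ hδ hτ n i hn
  have h0 : 0 ≤ n * δ := by positivity
  have h2 := (hΞ.c1BL (τ i) (τ (i + n)) (by linarith [hτ i n])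
    (by rw [hτ]; linarith [hc.h_le])).bl
  rw [hτ] at h2
  have a1 := mul_le_mul_of_nonneg_left (Real.rpow_le_rpow h0 hn
        (by linarith [hc.theta] : 0 ≤ θ)) hc.L_nonneg
  have a2 := mul_le_mul_of_nonneg_left (Real.rpow_le_rpow h0 hn hc.alpha_pos.le) hc.K_nonneg
  have hq0 : (0 : ℝ) ≤ (2 / 3 : ℝ) ^ (θ - 1) := by positivity
  have := lipschitz_step h2 h1 (L' := 2) (by linarith [hc.K_le, hc.L_le]) y y'
  simpa using this

/-- A sequence which follows the Euler scheme up to an error `e` in each step stays close to the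
scheme: the errors are transported by Lipschitz maps, so they add up. -/
theorem norm_sub_euler_le (hc : SchemeConst K α θ L h₀) (hΞ : AlmostFlow K α θ Ξ) {τ : ℕ → ℝ}
    {δ : ℝ} (hδ : 0 < δ) (hτ : ∀ i n : ℕ, τ (i + n) - τ i = n * δ) {e : ℝ} (y : ℕ → E) (n : ℕ) :
    ∀ i, n * δ ≤ h₀ →
    (∀ j, i ≤ j → j < i + n → ‖y (j + 1) - (y j + Ξ (τ j) (τ (j + 1)) (y j))‖ ≤ e) →
    ‖y (i + n) - euler Ξ τ i n (y i)‖ ≤ 2 * n * e := by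
  induction n with
  | zero => intro i _ _; simp [euler]
  | succ n ih =>
    intro i hn hy
    push_cast at hn
    have hn' : n * δ ≤ h₀ := by nlinarith
    have h1 := ih (i + 1) hn' fun j hj hj' => hy j (by omega) (by omega)
    have h2 := euler_lipschitz hc hΞ hδ hτ n (i + 1) hn' (y (i + 1)) (euler Ξ τ i 1 (y i))
    have h3 : ‖y (i + 1) - euler Ξ τ i 1 (y i)‖ ≤ e := by
      simpa [euler] using hy i le_rfl (by omega)
    have h4 : i + (n + 1) = i + 1 + n := by omega
    rw [h4, Nat.add_comm n 1, euler_add]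
    refine (norm_sub_le_norm_sub_add_norm_sub _ (euler Ξ τ (i + 1) n (y (i + 1))) _).trans ?_
    push_cast
    linarith

theorem tendsto_mul_div_rpow {θ : ℝ} (hθ : 1 < θ) {h : ℝ} (hh : 0 < h) (C : ℝ) :
    Tendsto (fun n : ℕ => C * (n * (h / n) ^ θ)) atTop (𝓝 0) := by
  have h1 : Tendsto (fun n : ℕ => (h / (n : ℝ)) ^ (θ - 1)) atTop (𝓝 0) := by
    have := (tendsto_const_div_atTop_nhds_zero_nat h).rpow_const
      (p := θ - 1) (Or.inr (by linarith))
    rwa [Real.zero_rpow (by linarith)] at this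
  have h2 := h1.const_mul (C * h)
  rw [mul_zero] at h2
  refine h2.congr' ?_
  filter_upwards [eventually_gt_atTop 0] with n hn
  have hn' : (0 : ℝ) < n := by exact_mod_cast hn
  have h3 : 0 < h / n := by positivity
  have h4 : (h / n) ^ θ = (h / n) * (h / n) ^ (θ - 1) := by
    conv_lhs => rw [show θ = 1 + (θ - 1) by ring, Real.rpow_add h3, Real.rpow_one]
  rw [h4]
  field_simp

/-- Two paths which follow an almost flow up to `O(|t - s|^θ)` and start at the same point
coincide. -/
theorem AlmostFlow.unique (hc : SchemeConst K α θ L h₀) (hΞ : AlmostFlow K α θ Ξ)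
    {s₀ t₁ C C' : ℝ} (hst : s₀ ≤ t₁) (hth : t₁ ≤ s₀ + h₀) {y y' : ℝ → E} (h0 : y s₀ = y' s₀)
    (hy : ∀ s t, s₀ ≤ s → s ≤ t → t ≤ t₁ →
      ‖y t - (y s + Ξ s t (y s))‖ ≤ C * (t - s) ^ θ)
    (hy' : ∀ s t, s₀ ≤ s → s ≤ t → t ≤ t₁ →
      ‖y' t - (y' s + Ξ s t (y' s))‖ ≤ C' * (t - s) ^ θ) : y t₁ = y' t₁ := by
  rcases hst.eq_or_lt with rfl | hlt
  · exact h0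
  have hh : 0 < t₁ - s₀ := by linarith
  have key : ∀ᶠ n : ℕ in atTop, ‖y t₁ - y' t₁‖ ≤
      (2 * C + 2 * C') * (n * ((t₁ - s₀) / n) ^ θ) := by
    filter_upwards [eventually_gt_atTop 0] with n hn
    have hn' : (0 : ℝ) < n := by exact_mod_cast hn
    set δ := (t₁ - s₀) / n with hδdef
    have hδ : 0 < δ := by positivity
    have hnδ : n * δ = t₁ - s₀ := by rw [hδdef]; field_simp
    set τ : ℕ → ℝ := fun i => s₀ + i * δ with hτdef
    have hτ : ∀ i n : ℕ, τ (i + n) - τ i = n * δ := fun i n => by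
      simp only [hτdef]; push_cast; ring
    have hτ0 : τ 0 = s₀ := by simp [hτdef]
    have hτn : τ n = t₁ := by simp only [hτdef, hnδ]; ring
    have main : ∀ (C : ℝ) (y : ℝ → E), (∀ s t, s₀ ≤ s → s ≤ t → t ≤ t₁ →
        ‖y t - (y s + Ξ s t (y s))‖ ≤ C * (t - s) ^ θ) →
        ‖y t₁ - euler Ξ τ 0 n (y s₀)‖ ≤ 2 * n * (C * δ ^ θ) := by
      intro C y hy
      have := norm_sub_euler_le hc hΞ hδ hτ (e := C * δ ^ θ) (fun i => y (τ i)) n 0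
        (by linarith) fun j _ hj => ?_
      · simpa only [zero_add, hτn, hτ0] using this
      · have h1 := hτ j 1
        rw [Nat.cast_one, one_mul] at h1
        have h2 : (j : ℝ) + 1 ≤ n := by
          rw [zero_add] at hj
          exact_mod_cast hj
        have := hy (τ j) (τ (j + 1)) (by simp only [hτdef]; nlinarith [j.cast_nonneg (α := ℝ)])
          (by linarith) (by rw [← hτn]; simp only [hτdef]; push_cast; nlinarith)
        rwa [h1] at this
    have h1 := main C y hy
    have h2 := main C' y' hy'
    rw [← h0, norm_sub_rev] at h2
    refine (norm_sub_le_norm_sub_add_norm_sub _ _ _).trans ((add_le_add h1 h2).trans ?_)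
    exact le_of_eq (by ring)
  have := ge_of_tendsto (tendsto_mul_div_rpow hc.theta hh (2 * C + 2 * C')) key
  exact sub_eq_zero.1 (norm_eq_zero.1 (le_antisymm this (norm_nonneg _)))

end AlmostFlow

/-! ### The flow as a limit of Euler schemes -/

section RdeFlow

variable {E : Type*} [NormedAddCommGroup E]

/-- The dyadic grid of mesh `h₀ / 2^N` starting at `s₀`. -/
def dyadicGrid (s₀ h₀ : ℝ) (N i : ℕ) : ℝ := s₀ + i * (h₀ / 2 ^ N)

/-- The index of the last point of the dyadic grid before `t`. -/
def dyadicIndex (s₀ h₀ : ℝ) (N : ℕ) (t : ℝ) : ℕ := ⌊(t - s₀) / (h₀ / 2 ^ N)⌋₊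

/-- The Euler scheme along the dyadic grid, run up to the last grid point before `t`. -/
def dyadicEuler (Ξ : ℝ → ℝ → E → E) (s₀ h₀ : ℝ) (N : ℕ) (t : ℝ) (y : E) : E :=
  euler Ξ (dyadicGrid s₀ h₀ N) 0 (dyadicIndex s₀ h₀ N t) y

/-- The flow of an almost flow on `[s₀, s₀ + h₀]`: the limit of the dyadic Euler schemes. -/
def rdeFlow (Ξ : ℝ → ℝ → E → E) (s₀ h₀ t : ℝ) (y : E) : E :=
  limUnder atTop fun N => dyadicEuler Ξ s₀ h₀ N t y

theorem dyadicGrid_add_sub (s₀ h₀ : ℝ) (N i n : ℕ) :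
    dyadicGrid s₀ h₀ N (i + n) - dyadicGrid s₀ h₀ N i = n * (h₀ / 2 ^ N) := by
  simp only [dyadicGrid]; push_cast; ring

theorem dyadicGrid_succ (s₀ h₀ : ℝ) (N i : ℕ) :
    dyadicGrid s₀ h₀ (N + 1) (2 * i) = dyadicGrid s₀ h₀ N i := by
  simp only [dyadicGrid]; push_cast; rw [pow_succ]; field_simp

theorem dyadicIndex_succ (s₀ h₀ : ℝ) (N : ℕ) (t : ℝ) :
    dyadicIndex s₀ h₀ (N + 1) t / 2 = dyadicIndex s₀ h₀ N t := by
  have := Nat.floor_div_natCast ((t - s₀) / (h₀ / 2 ^ (N + 1))) 2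
  rw [dyadicIndex, ← this, dyadicIndex]
  congr 1
  push_cast
  rw [pow_succ]
  rcases eq_or_ne h₀ 0 with rfl | h
  · simp
  · field_simp

theorem dyadicIndex_mul_le {s₀ h₀ t : ℝ} (hh : 0 < h₀) (ht : s₀ ≤ t) (N : ℕ) :
    dyadicIndex s₀ h₀ N t * (h₀ / 2 ^ N) ≤ t - s₀ := by
  have hδ : 0 < h₀ / 2 ^ N := by positivity
  rw [← le_div_iff₀ hδ]
  exact Nat.floor_le (div_nonneg (by linarith) hδ.le)

theorem dyadicIndex_mono {s₀ h₀ s t : ℝ} (hh : 0 < h₀) (hst : s ≤ t) (N : ℕ) :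
    dyadicIndex s₀ h₀ N s ≤ dyadicIndex s₀ h₀ N t := by
  refine Nat.floor_le_floor ?_
  gcongr

theorem tendsto_dyadicGrid {s₀ h₀ t : ℝ} (hh : 0 < h₀) (ht : s₀ ≤ t) :
    Tendsto (fun N => dyadicGrid s₀ h₀ N (dyadicIndex s₀ h₀ N t)) atTop (𝓝 t) := by
  have h1 : Tendsto (fun N : ℕ => t - h₀ * (1 / 2 : ℝ) ^ N) atTop (𝓝 t) := by
    have := (tendsto_pow_atTop_nhds_zero_of_lt_one (r := (1 / 2 : ℝ)) (by norm_num)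
      (by norm_num)).const_mul h₀
    simpa using this.const_sub t
  refine tendsto_of_tendsto_of_tendsto_of_le_of_le h1 tendsto_const_nhds (fun N => ?_) fun N => ?_
  · have hδ : 0 < h₀ / 2 ^ N := by positivity
    have h2 := Nat.lt_floor_add_one ((t - s₀) / (h₀ / 2 ^ N))
    rw [div_lt_iff₀ hδ] at h2
    have h3 : h₀ * (1 / 2 : ℝ) ^ N = h₀ / 2 ^ N := by
      rw [one_div, inv_pow, div_eq_mul_inv]
    simp only [dyadicGrid, dyadicIndex, h3]
    linarith
  · have := dyadicIndex_mul_le hh ht N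
    simp only [dyadicGrid]
    linarith

theorem continuous_euler {Λ : Type*} [TopologicalSpace Λ] {Ξ : Λ → ℝ → ℝ → E → E}
    (hcont : ∀ s t, Continuous fun q : Λ × E => Ξ q.1 s t q.2)
    (τ : ℕ → ℝ) (i n : ℕ) : Continuous fun q : Λ × E => euler (Ξ q.1) τ i n q.2 := by
  induction n with
  | zero => exact continuous_snd
  | succ n ih => exact ih.add ((hcont _ _).comp (continuous_fst.prodMk ih))

variable [NormedSpace ℝ E] {K α θ L h₀ : ℝ} {Ξ : ℝ → ℝ → E → E}

theorem rpow_dyadic_le {α β h₀ : ℝ} (hβ : 0 < β) (hβα : β ≤ α) (hh : 0 < h₀) (hh1 : h₀ ≤ 1)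
    (N : ℕ) : (h₀ / 2 ^ N) ^ α ≤ ((1 / 2 : ℝ) ^ β) ^ N := by
  have h1 : h₀ / 2 ^ N ≤ (1 / 2 : ℝ) ^ N := by
    rw [one_div, inv_pow, div_eq_mul_inv]
    exact mul_le_of_le_one_left (by positivity) hh1
  have h2 : (1 / 2 : ℝ) ^ N ≤ 1 := pow_le_one₀ (by norm_num) (by norm_num)
  calc (h₀ / 2 ^ N) ^ α ≤ (h₀ / 2 ^ N) ^ β :=
        Real.rpow_le_rpow_of_exponent_ge (by positivity) (h1.trans h2) hβα
    _ ≤ ((1 / 2 : ℝ) ^ N) ^ β := Real.rpow_le_rpow (by positivity) h1 hβ.le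
    _ = ((1 / 2 : ℝ) ^ β) ^ N := by
        rw [← Real.rpow_natCast, ← Real.rpow_natCast, ← Real.rpow_mul (by norm_num),
          ← Real.rpow_mul (by norm_num), mul_comm]

theorem dyadicEuler_succ_sub_le (hc : SchemeConst K α θ L h₀) (hΞ : AlmostFlow K α θ Ξ)
    {s₀ t : ℝ} (ht : s₀ ≤ t) (hth : t ≤ s₀ + h₀) (N : ℕ) (y : E) :
    ‖dyadicEuler Ξ s₀ h₀ (N + 1) t y - dyadicEuler Ξ s₀ h₀ N t y‖ ≤
      3 * K * ((1 / 2 : ℝ) ^ min α (θ - 1)) ^ N := by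
  have hh := hc.h_pos
  have hβ : 0 < min α (θ - 1) := lt_min hc.alpha_pos (by linarith [hc.theta])
  set r := (1 / 2 : ℝ) ^ min α (θ - 1) with hr
  have hr1 : r ≤ 1 := Real.rpow_le_one (by norm_num) (by norm_num) hβ.le
  have hr0 : 0 ≤ r := by positivity
  have hδ : 0 < h₀ / 2 ^ N := by positivity
  have hδ' : 0 < h₀ / 2 ^ (N + 1) := by positivity
  have h12 : 2 * (h₀ / 2 ^ (N + 1)) = h₀ / 2 ^ N := by rw [pow_succ]; field_simp
  have hδ1 : h₀ / 2 ^ N ≤ 1 := (div_le_self hh.le (one_le_pow₀ (by norm_num))).trans hc.h_le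
  set i := dyadicIndex s₀ h₀ N t with hi
  have hiδ : i * (h₀ / 2 ^ N) ≤ h₀ := (dyadicIndex_mul_le hh ht N).trans (by linarith)
  -- even steps of the finer scheme follow the coarser one
  have h1 : ‖euler Ξ (dyadicGrid s₀ h₀ (N + 1)) 0 (2 * i) y -
      euler Ξ (dyadicGrid s₀ h₀ N) 0 i y‖ ≤ 2 * i * (K * (h₀ / 2 ^ N) ^ θ) := by
    have := norm_sub_euler_le hc hΞ hδ (dyadicGrid_add_sub s₀ h₀ N) (e := K * (h₀ / 2 ^ N) ^ θ)
      (fun j => euler Ξ (dyadicGrid s₀ h₀ (N + 1)) 0 (2 * j) y) i 0 hiδ fun j _ _ => ?_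
    · simpa [euler] using this
    · have hd := (hΞ.defect (dyadicGrid s₀ h₀ (N + 1) (2 * j))
        (dyadicGrid s₀ h₀ (N + 1) (2 * j + 1)) (dyadicGrid s₀ h₀ (N + 1) (2 * j + 2))
        (by have := dyadicGrid_add_sub s₀ h₀ (N + 1) (2 * j) 1
            push_cast at this; linarith)
        (by have := dyadicGrid_add_sub s₀ h₀ (N + 1) (2 * j + 1) 1
            push_cast at this; linarith)
        (by rw [dyadicGrid_add_sub]; push_cast; linarith)).1
        (euler Ξ (dyadicGrid s₀ h₀ (N + 1)) 0 (2 * j) y)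
      rw [dyadicGrid_add_sub, Nat.cast_ofNat, h12] at hd
      refine le_trans (le_of_eq ?_) hd
      have e1 : 2 * (j + 1) = 2 * j + 1 + 1 := by ring
      rw [← dyadicGrid_succ s₀ h₀ N j, ← dyadicGrid_succ s₀ h₀ N (j + 1), e1, euler, euler]
      simp only [zero_add]
      congr 1
      abel
  have h2 : 2 * i * (K * (h₀ / 2 ^ N) ^ θ) ≤ 2 * K * r ^ N := by
    have e1 : (h₀ / 2 ^ N) ^ θ = (h₀ / 2 ^ N) * (h₀ / 2 ^ N) ^ (θ - 1) := by
      conv_lhs => rw [show θ = 1 + (θ - 1) by ring, Real.rpow_add hδ, Real.rpow_one]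
    have e2 := rpow_dyadic_le hβ (min_le_right α (θ - 1)) hh hc.h_le N
    rw [e1]
    have e3 : i * (h₀ / 2 ^ N) ≤ 1 := hiδ.trans hc.h_le
    have e4 : (i * (h₀ / 2 ^ N)) * (h₀ / 2 ^ N) ^ (θ - 1) ≤ 1 * r ^ N :=
      mul_le_mul e3 e2 (by positivity) zero_le_one
    have := mul_le_mul_of_nonneg_left e4 hc.K_nonneg
    linarith
  have hidx := dyadicIndex_succ s₀ h₀ N t
  rw [← hi] at hidx
  have hrN : 0 ≤ K * r ^ N := mul_nonneg hc.K_nonneg (by positivity)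
  rcases Nat.mod_two_eq_zero_or_one (dyadicIndex s₀ h₀ (N + 1) t) with h | h
  · have e : dyadicIndex s₀ h₀ (N + 1) t = 2 * i := by omega
    rw [dyadicEuler, dyadicEuler, e, ← hi]
    linarith
  · have e : dyadicIndex s₀ h₀ (N + 1) t = 2 * i + 1 := by omega
    rw [dyadicEuler, dyadicEuler, e, ← hi, euler]
    have h3 := (hΞ.c1BL (dyadicGrid s₀ h₀ (N + 1) (0 + 2 * i))
      (dyadicGrid s₀ h₀ (N + 1) (0 + 2 * i + 1))
      (by have := dyadicGrid_add_sub s₀ h₀ (N + 1) (0 + 2 * i) 1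
          push_cast at this; linarith)
      (by rw [dyadicGrid_add_sub]; push_cast; linarith)).bl.1
      (euler Ξ (dyadicGrid s₀ h₀ (N + 1)) 0 (2 * i) y)
    rw [dyadicGrid_add_sub, Nat.cast_one, one_mul] at h3
    have h4 := rpow_dyadic_le hβ (min_le_left α (θ - 1)) hh hc.h_le (N + 1)
    have h5 : r ^ (N + 1) ≤ r ^ N := pow_le_pow_of_le_one hr0 hr1 N.le_succ
    have h6 := mul_le_mul_of_nonneg_left (h4.trans h5) hc.K_nonneg
    rw [add_sub_right_comm]
    refine (norm_add_le _ _).trans ?_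
    linarith

variable [CompleteSpace E]

theorem dyadic_ratio_lt_one (hc : SchemeConst K α θ L h₀) :
    (1 / 2 : ℝ) ^ min α (θ - 1) < 1 :=
  Real.rpow_lt_one (by norm_num) (by norm_num)
    (lt_min hc.alpha_pos (by linarith [hc.theta]))

theorem tendsto_dyadicEuler (hc : SchemeConst K α θ L h₀) (hΞ : AlmostFlow K α θ Ξ)
    {s₀ t : ℝ} (ht : s₀ ≤ t) (hth : t ≤ s₀ + h₀) (y : E) :
    Tendsto (fun N => dyadicEuler Ξ s₀ h₀ N t y) atTop (𝓝 (rdeFlow Ξ s₀ h₀ t y)) := by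
  refine CauchySeq.tendsto_limUnder (cauchySeq_of_le_geometric _ (3 * K) (dyadic_ratio_lt_one hc)
    fun N => ?_)
  rw [dist_comm, dist_eq_norm]
  exact dyadicEuler_succ_sub_le hc hΞ ht hth N y

theorem dist_dyadicEuler_rdeFlow_le (hc : SchemeConst K α θ L h₀) (hΞ : AlmostFlow K α θ Ξ)
    {s₀ t : ℝ} (ht : s₀ ≤ t) (hth : t ≤ s₀ + h₀) (y : E) (N : ℕ) :
    dist (dyadicEuler Ξ s₀ h₀ N t y) (rdeFlow Ξ s₀ h₀ t y) ≤
      3 * K * ((1 / 2 : ℝ) ^ min α (θ - 1)) ^ N / (1 - (1 / 2 : ℝ) ^ min α (θ - 1)) := by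
  refine dist_le_of_le_geometric_of_tendsto _ (3 * K) (dyadic_ratio_lt_one hc) (fun N => ?_)
    (tendsto_dyadicEuler hc hΞ ht hth y) N
  rw [dist_comm, dist_eq_norm]
  exact dyadicEuler_succ_sub_le hc hΞ ht hth N y

theorem rdeFlow_self (hc : SchemeConst K α θ L h₀) (hΞ : AlmostFlow K α θ Ξ) (s₀ : ℝ) (y : E) :
    rdeFlow Ξ s₀ h₀ s₀ y = y := by
  refine tendsto_nhds_unique
    (tendsto_dyadicEuler hc hΞ le_rfl (by linarith [hc.h_pos]) y) ?_
  simp [dyadicEuler, dyadicIndex, euler]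

/-- The limit of the Euler schemes follows the almost flow up to `O(|t - s|^θ)`. -/
theorem rdeFlow_sub_le (hc : SchemeConst K α θ L h₀) (hΞ : AlmostFlow K α θ Ξ)
    {s₀ s t : ℝ} (hs : s₀ ≤ s) (hst : s ≤ t) (hth : t ≤ s₀ + h₀) (y : E) :
    ‖rdeFlow Ξ s₀ h₀ t y - (rdeFlow Ξ s₀ h₀ s y + Ξ s t (rdeFlow Ξ s₀ h₀ s y))‖ ≤
      L * (t - s) ^ θ := by
  have hh := hc.h_pos
  have lt := tendsto_dyadicEuler hc hΞ (hs.trans hst) hth y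
  have ls := tendsto_dyadicEuler hc hΞ hs (hst.trans hth) y
  have gs := tendsto_dyadicGrid hh hs
  have gt := tendsto_dyadicGrid hh (hs.trans hst)
  have lΞ := (hΞ.continuous.tendsto (s, t, rdeFlow Ξ s₀ h₀ s y)).comp
    (gs.prodMk_nhds (gt.prodMk_nhds ls))
  have l1 := (lt.sub (ls.add lΞ)).norm
  have l2 : Tendsto (fun N => L * (dyadicGrid s₀ h₀ N (dyadicIndex s₀ h₀ N t) -
      dyadicGrid s₀ h₀ N (dyadicIndex s₀ h₀ N s)) ^ θ) atTop (𝓝 (L * (t - s) ^ θ)) :=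
    ((gt.sub gs).rpow_const (Or.inr (by linarith [hc.theta]))).const_mul L
  refine le_of_tendsto_of_tendsto' l1 l2 fun N => ?_
  obtain ⟨k, hk⟩ := Nat.exists_eq_add_of_le (dyadicIndex_mono (s₀ := s₀) hh hst N)
  have hkδ : k * (h₀ / 2 ^ N) ≤ h₀ := by
    have h1 := dyadicIndex_mul_le hh (hs.trans hst) N
    rw [hk] at h1
    push_cast at h1
    have h2 : (0 : ℝ) ≤ dyadicIndex s₀ h₀ N s * (h₀ / 2 ^ N) := by positivity
    linarith
  have h3 := (euler_sub_bl hc hΞ (by positivity) (dyadicGrid_add_sub s₀ h₀ N) k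
    (dyadicIndex s₀ h₀ N s) hkδ).1 (dyadicEuler Ξ s₀ h₀ N s y)
  rw [← dyadicGrid_add_sub s₀ h₀ N (dyadicIndex s₀ h₀ N s)] at h3
  have e1 : dyadicEuler Ξ s₀ h₀ N t y = euler Ξ (dyadicGrid s₀ h₀ N) (dyadicIndex s₀ h₀ N s) k
      (dyadicEuler Ξ s₀ h₀ N s y) := by
    rw [dyadicEuler, hk, euler_add, zero_add, dyadicEuler]
  simp only [Function.comp_apply]
  rw [e1, ← sub_sub, hk]
  exact h3

theorem rdeFlow_sub_le_rpow (hc : SchemeConst K α θ L h₀) (hΞ : AlmostFlow K α θ Ξ) (hαθ : α ≤ θ)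
    {s₀ s t : ℝ} (hs : s₀ ≤ s) (hst : s ≤ t) (hth : t ≤ s₀ + h₀) (y : E) :
    ‖rdeFlow Ξ s₀ h₀ t y - rdeFlow Ξ s₀ h₀ s y‖ ≤ (K + L) * (t - s) ^ α := by
  have h1 := rdeFlow_sub_le hc hΞ hs hst hth y
  have h2 := (hΞ.c1BL s t hst (by linarith [hc.h_le])).bl.1 (rdeFlow Ξ s₀ h₀ s y)
  have h3 : (t - s) ^ θ ≤ (t - s) ^ α := by
    rcases hst.eq_or_lt with rfl | hlt
    · rw [sub_self, Real.zero_rpow (by linarith [hc.theta]), Real.zero_rpow hc.alpha_pos.ne']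
    · exact Real.rpow_le_rpow_of_exponent_ge (by linarith) (by linarith [hc.h_le]) hαθ
  have h4 := mul_le_mul_of_nonneg_left h3 hc.L_nonneg
  have e : rdeFlow Ξ s₀ h₀ t y - rdeFlow Ξ s₀ h₀ s y =
      (rdeFlow Ξ s₀ h₀ t y - (rdeFlow Ξ s₀ h₀ s y + Ξ s t (rdeFlow Ξ s₀ h₀ s y))) +
        Ξ s t (rdeFlow Ξ s₀ h₀ s y) := by abel
  rw [e]
  refine (norm_add_le _ _).trans ?_
  linarith

section Parameters

variable {Λ : Type*} [TopologicalSpace Λ] {Ξ : Λ → ℝ → ℝ → E → E}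

theorem continuous_rdeFlow (hc : SchemeConst K α θ L h₀) (hΞ : ∀ l, AlmostFlow K α θ (Ξ l))
    (hcont : ∀ s t, Continuous fun q : Λ × E => Ξ q.1 s t q.2) {s₀ t : ℝ} (ht : s₀ ≤ t)
    (hth : t ≤ s₀ + h₀) : Continuous fun q : Λ × E => rdeFlow (Ξ q.1) s₀ h₀ t q.2 := by
  have hr := dyadic_ratio_lt_one hc
  have hlim : Tendsto (fun N : ℕ => 3 * K * ((1 / 2 : ℝ) ^ min α (θ - 1)) ^ N /
      (1 - (1 / 2 : ℝ) ^ min α (θ - 1))) atTop (𝓝 0) := by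
    have := ((tendsto_pow_atTop_nhds_zero_of_lt_one (by positivity) hr).const_mul
      (3 * K)).div_const (1 - (1 / 2 : ℝ) ^ min α (θ - 1))
    simpa using this
  have hunif : TendstoUniformly (fun (N : ℕ) (q : Λ × E) => dyadicEuler (Ξ q.1) s₀ h₀ N t q.2)
      (fun q => rdeFlow (Ξ q.1) s₀ h₀ t q.2) atTop := by
    refine Metric.tendstoUniformly_iff.2 fun ε hε => ?_
    filter_upwards [hlim.eventually (gt_mem_nhds hε)] with N hN q
    rw [dist_comm]
    exact (dist_dyadicEuler_rdeFlow_le hc (hΞ q.1) ht hth q.2 N).trans_lt hN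
  exact hunif.continuous (Frequently.of_forall fun N => continuous_euler hcont _ _ _)

/-- The flow is jointly continuous in the parameter, the starting point and time. -/
theorem continuousOn_rdeFlow (hc : SchemeConst K α θ L h₀) (hαθ : α ≤ θ)
    (hΞ : ∀ l, AlmostFlow K α θ (Ξ l))
    (hcont : ∀ s t, Continuous fun q : Λ × E => Ξ q.1 s t q.2) (s₀ : ℝ) :
    ContinuousOn (fun q : (Λ × E) × ℝ => rdeFlow (Ξ q.1.1) s₀ h₀ q.2 q.1.2)
      (univ ×ˢ Icc s₀ (s₀ + h₀)) := by
  rintro ⟨q₀, t₀⟩ ⟨-, ht₀⟩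
  have h1 : ContinuousAt (fun q : Λ × E => rdeFlow (Ξ q.1) s₀ h₀ t₀ q.2) q₀ :=
    (continuous_rdeFlow hc hΞ hcont ht₀.1 ht₀.2).continuousAt
  have h2 : Tendsto (fun q : (Λ × E) × ℝ => (K + L) * |q.2 - t₀| ^ α +
      ‖rdeFlow (Ξ q.1.1) s₀ h₀ t₀ q.1.2 - rdeFlow (Ξ q₀.1) s₀ h₀ t₀ q₀.2‖) (𝓝 (q₀, t₀)) (𝓝 0) := by
    have a1 : Tendsto (fun q : (Λ × E) × ℝ => |q.2 - t₀| ^ α) (𝓝 (q₀, t₀)) (𝓝 0) := by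
      have : Tendsto (fun q : (Λ × E) × ℝ => |q.2 - t₀|) (𝓝 (q₀, t₀)) (𝓝 |t₀ - t₀|) :=
        (Continuous.tendsto (by fun_prop) _)
      have := this.rpow_const (p := α) (Or.inr hc.alpha_pos.le)
      simpa [Real.zero_rpow hc.alpha_pos.ne'] using this
    have a2 : Tendsto (fun q : (Λ × E) × ℝ => ‖rdeFlow (Ξ q.1.1) s₀ h₀ t₀ q.1.2 -
        rdeFlow (Ξ q₀.1) s₀ h₀ t₀ q₀.2‖) (𝓝 (q₀, t₀)) (𝓝 0) :=
      tendsto_iff_norm_sub_tendsto_zero.1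
        (h1.tendsto.comp (continuous_fst.tendsto (q₀, t₀)))
    simpa using (a1.const_mul (K + L)).add a2
  refine tendsto_iff_norm_sub_tendsto_zero.2 (squeeze_zero' (Eventually.of_forall fun _ =>
    norm_nonneg _) ?_ (h2.mono_left nhdsWithin_le_nhds))
  filter_upwards [self_mem_nhdsWithin] with q hq
  refine (norm_sub_le_norm_sub_add_norm_sub _ (rdeFlow (Ξ q.1.1) s₀ h₀ t₀ q.1.2) _).trans ?_
  refine add_le_add ?_ le_rfl
  rcases le_total t₀ q.2 with h | h
  · rw [abs_of_nonneg (by linarith)]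
    exact rdeFlow_sub_le_rpow hc (hΞ q.1.1) hαθ ht₀.1 h hq.2.2 q.1.2
  · rw [abs_of_nonpos (by linarith), neg_sub, norm_sub_rev]
    exact rdeFlow_sub_le_rpow hc (hΞ q.1.1) hαθ hq.2.1 h ht₀.2 q.1.2

end Parameters

end RdeFlow

/-! ### Cut-off in a foliated chart -/

/-- A foliated chart with cut-off functions: `χ₁(y) χ₂(z)` has compact support in the target of
the chart and equals `1` for `y` in the ball of radius `2 r` around `y₀` and `z` in the open set
`N`. -/
structure ChartBox (p : ℕ) (Z M : Type*) [TopologicalSpace Z] [TopologicalSpace M]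
    [ChartedSpace (EuclideanSpace ℝ (Fin p) × Z) M] where
  φ : OpenPartialHomeomorph M (EuclideanSpace ℝ (Fin p) × Z)
  mem_atlas : φ ∈ atlas (EuclideanSpace ℝ (Fin p) × Z) M
  y₀ : EuclideanSpace ℝ (Fin p)
  r : ℝ
  N : Set Z
  χ₁ : EuclideanSpace ℝ (Fin p) → ℝ
  χ₂ : Z → ℝ
  K₂ : Set Z
  r_pos : 0 < r
  isOpen_N : IsOpen N
  contDiff_χ₁ : ContDiff ℝ 3 χ₁
  continuous_χ₂ : Continuous χ₂
  isCompact_K₂ : IsCompact K₂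
  subset_target : Metric.closedBall y₀ (3 * r) ×ˢ K₂ ⊆ φ.target
  χ₁_eq_one : ∀ y ∈ Metric.ball y₀ (2 * r), χ₁ y = 1
  χ₁_eq_zero : ∀ y ∉ Metric.closedBall y₀ (3 * r), χ₁ y = 0
  χ₂_eq_one : ∀ z ∈ N, χ₂ z = 1
  χ₂_eq_zero : ∀ z ∉ K₂, χ₂ z = 0

namespace ChartBox

variable {p : ℕ} {Z M : Type*} [TopologicalSpace Z] [TopologicalSpace M]
  [ChartedSpace (EuclideanSpace ℝ (Fin p) × Z) M]

theorem exists_box [LocallyCompactSpace Z] [T2Space Z] (m : M) :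
    ∃ B : ChartBox p Z M, m ∈ B.φ.source ∧ B.φ m ∈ Metric.ball B.y₀ B.r ×ˢ B.N := by
  set φ : OpenPartialHomeomorph M (EuclideanSpace ℝ (Fin p) × Z) := chartAt _ m with hφ
  have hm : φ m ∈ φ.target := mem_chart_target _ m
  obtain ⟨O₁, hO₁, O₂, hO₂, hO⟩ := mem_nhds_prod_iff.1 (φ.open_target.mem_nhds hm)
  obtain ⟨ρ, hρ, hρO⟩ := Metric.nhds_basis_closedBall.mem_iff.1 hO₁
  obtain ⟨K, hK, hKO₂, hKc⟩ := local_compact_nhds hO₂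
  obtain ⟨K', hK', hK'K, hK'c⟩ := local_compact_nhds (interior_mem_nhds.2 hK)
  obtain ⟨χ₂, h1, h2, -, -⟩ := exists_continuous_one_zero_of_isCompact hK'c
    isOpen_interior.isClosed_compl (disjoint_compl_right_iff_subset.2 hK'K)
  let b : ContDiffBump (φ m).1 := ⟨2 * (ρ / 3), 3 * (ρ / 3), by positivity, by linarith⟩
  refine ⟨⟨φ, chart_mem_atlas _ m, (φ m).1, ρ / 3, interior K', b, χ₂, K, by positivity,
    isOpen_interior, b.contDiff, χ₂.continuous, hKc, ?_, ?_, ?_, ?_, ?_⟩, mem_chart_source _ m,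
    ?_, ?_⟩
  · rintro ⟨y, z⟩ ⟨hy, hz⟩
    refine hO ⟨hρO ?_, hKO₂ hz⟩
    simpa [mul_div_cancel₀] using hy
  · intro y hy
    exact b.one_of_mem_closedBall (Metric.ball_subset_closedBall hy)
  · intro y hy
    refine b.zero_of_le_dist ?_
    rw [Metric.mem_closedBall, not_le] at hy
    exact hy.le
  · intro z hz
    exact h1 (interior_subset hz)
  · intro z hz
    exact h2 fun h => hz (interior_subset h)
  · simpa using hρ
  · exact mem_interior_iff_mem_nhds.2 hK'

variable (B : ChartBox p Z M)

/-- The open set on which the cut-off function equals `1`. -/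
def inner : Set (EuclideanSpace ℝ (Fin p) × Z) := Metric.ball B.y₀ (2 * B.r) ×ˢ B.N

/-- The compact set that contains the support of the cut-off function. -/
def supp : Set (EuclideanSpace ℝ (Fin p) × Z) := Metric.closedBall B.y₀ (3 * B.r) ×ˢ B.K₂

theorem isOpen_inner : IsOpen B.inner := Metric.isOpen_ball.prod B.isOpen_N

theorem isCompact_supp : IsCompact B.supp := (isCompact_closedBall _ _).prod B.isCompact_K₂

theorem N_subset : B.N ⊆ B.K₂ := fun z hz => by
  by_contra h
  have h1 := B.χ₂_eq_one z hz
  rw [B.χ₂_eq_zero z h] at h1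
  exact zero_ne_one h1

theorem inner_subset : B.inner ⊆ B.φ.target := fun _ hq =>
  B.subset_target ⟨Metric.ball_subset_closedBall
    (Metric.ball_subset_ball (by linarith [B.r_pos]) hq.1), B.N_subset hq.2⟩

/-- The product of `F` with the cut-off function. -/
def cut {G : Type*} [NormedAddCommGroup G] [NormedSpace ℝ G]
    (F : EuclideanSpace ℝ (Fin p) × Z → G) (q : EuclideanSpace ℝ (Fin p) × Z) : G :=
  (B.χ₂ q.2 * B.χ₁ q.1) • F q

section Cut

variable {G : Type} [NormedAddCommGroup G] [NormedSpace ℝ G]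
  {F : EuclideanSpace ℝ (Fin p) × Z → G}

theorem cut_eq_of_mem {q} (hq : q ∈ B.inner) : B.cut F q = F q := by
  rw [cut, B.χ₁_eq_one _ hq.1, B.χ₂_eq_one _ hq.2, one_mul, one_smul]

theorem cut_eq_zero {q} (hq : q ∉ B.supp) : B.cut F q = 0 := by
  rw [supp, mem_prod, not_and_or] at hq
  rcases hq with h | h
  · rw [cut, B.χ₁_eq_zero _ h, mul_zero, zero_smul]
  · rw [cut, B.χ₂_eq_zero _ h, zero_mul, zero_smul]

theorem leafwiseContDiffOn_cut [T2Space Z] (hF : LeafwiseContDiffOn 3 F B.φ.target) :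
    LeafwiseContDiffOn 3 (B.cut F) univ := by
  have hopen : IsOpen B.suppᶜ := B.isCompact_supp.isClosed.isOpen_compl
  refine LeafwiseContDiffOn.of_locally fun q _ => ?_
  by_cases hq : q ∈ B.supp
  · refine ⟨B.φ.target, B.φ.open_target, B.subset_target hq, ?_⟩
    have hU := B.φ.open_target
    have h2 : LeafwiseContDiffOn 3 (fun q : EuclideanSpace ℝ (Fin p) × Z => B.χ₂ q.2)
        B.φ.target :=
      leafwiseContDiffOn_snd hU (c := B.χ₂) (B.continuous_χ₂.comp continuous_snd).continuousOn
    have h1 := (leafwiseContDiffOn_fst (k := 3) hU).comp_left hU B.contDiff_χ₁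
    exact LeafwiseContDiffOn.bilinear hU (ContinuousLinearMap.lsmul ℝ ℝ)
      (LeafwiseContDiffOn.bilinear hU (ContinuousLinearMap.mul ℝ ℝ) h2 h1) hF
  · exact ⟨B.suppᶜ, hopen, hq, (leafwiseContDiffOn_const hopen (0 : G)).congr hopen
      fun r hr => B.cut_eq_zero hr⟩

end Cut

end ChartBox

section CompactSupport

variable {p : ℕ} {Z : Type*} [TopologicalSpace Z] {G : Type} [NormedAddCommGroup G]
  [NormedSpace ℝ G] {F : EuclideanSpace ℝ (Fin p) × Z → G}
  {S : Set (EuclideanSpace ℝ (Fin p) × Z)}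

theorem exists_norm_le_of_isCompact {G : Type} [NormedAddCommGroup G]
    {F : EuclideanSpace ℝ (Fin p) × Z → G} (hS : IsCompact S) (hF : Continuous F)
    (h0 : ∀ q ∉ S, F q = 0) : ∃ K, ∀ q, ‖F q‖ ≤ K := by
  obtain ⟨K, hK⟩ := hS.exists_bound_of_continuousOn hF.continuousOn
  refine ⟨max K 0, fun q => ?_⟩
  by_cases hq : q ∈ S
  · exact (hK q hq).trans (le_max_left _ _)
  · rw [h0 q hq, norm_zero]
    exact le_max_right _ _

theorem dy_eq_zero_of_notMem (hS : IsClosed S) (h0 : ∀ q ∉ S, F q = 0) :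
    ∀ q ∉ S, dy F q = 0 := by
  intro q hq
  rw [dy_congr (g := fun _ => (0 : G)) hS.isOpen_compl h0 hq]
  simp [dy]

theorem bl_slice {K : ℝ} (hd : LeafwiseContDiffOn 1 F univ) (h0 : ∀ q, ‖F q‖ ≤ K)
    (h1 : ∀ q, ‖dy F q‖ ≤ K) (z : Z) : BL K fun y => F (y, z) := by
  refine ⟨fun y => h0 _, fun y y' => ?_⟩
  exact Convex.norm_image_sub_le_of_norm_fderiv_le (𝕜 := ℝ) (s := univ)
    (f := fun y => F (y, z)) (fun x _ => hd.differentiableAt isOpen_univ le_rfl (mem_univ (x, z)))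
    (fun x _ => h1 (x, z)) convex_univ (mem_univ _) (mem_univ _)

theorem exists_c1BL_slice [T2Space Z] (hS : IsCompact S) (hF : LeafwiseContDiffOn 3 F univ)
    (h0 : ∀ q ∉ S, F q = 0) :
    ∃ K, ∀ z, C1BL K (fun y => F (y, z)) ∧ C1BL K (fderiv ℝ fun y => F (y, z)) := by
  have d1 := hF.dy isOpen_univ
  have d2 := d1.dy isOpen_univ
  have d3 := d2.dy isOpen_univ
  have z1 := dy_eq_zero_of_notMem hS.isClosed h0
  have z2 := dy_eq_zero_of_notMem hS.isClosed z1
  have z3 := dy_eq_zero_of_notMem hS.isClosed z2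
  obtain ⟨K₀, hK₀⟩ := exists_norm_le_of_isCompact hS (continuousOn_univ.1 hF.continuousOn) h0
  obtain ⟨K₁, hK₁⟩ := exists_norm_le_of_isCompact hS (continuousOn_univ.1 d1.continuousOn) z1
  obtain ⟨K₂, hK₂⟩ := exists_norm_le_of_isCompact hS (continuousOn_univ.1 d2.continuousOn) z2
  obtain ⟨K₃, hK₃⟩ := exists_norm_le_of_isCompact hS (continuousOn_univ.1 d3.continuousOn) z3
  refine ⟨max (max K₀ K₁) (max K₂ K₃), fun z => ?_⟩
  set K := max (max K₀ K₁) (max K₂ K₃)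
  have b0 : ∀ q, ‖F q‖ ≤ K := fun q => (hK₀ q).trans (by simp [K])
  have b1 : ∀ q, ‖dy F q‖ ≤ K := fun q => (hK₁ q).trans (by simp [K])
  have b2 : ∀ q, ‖dy (dy F) q‖ ≤ K := fun q => (hK₂ q).trans (by simp [K])
  have b3 : ∀ q, ‖dy (dy (dy F)) q‖ ≤ K := fun q => (hK₃ q).trans (by simp [K])
  exact ⟨⟨fun y => hF.differentiableAt isOpen_univ (by norm_num) (mem_univ (y, z)),
      bl_slice (hF.of_le (by norm_num)) b0 b1 z, bl_slice (d1.of_le (by norm_num)) b1 b2 z⟩,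
    ⟨fun y => d1.differentiableAt isOpen_univ (by norm_num) (mem_univ (y, z)),
      bl_slice (d1.of_le (by norm_num)) b1 b2 z, bl_slice (d2.of_le (by norm_num)) b2 b3 z⟩⟩

end CompactSupport

/-! ### The equation in a foliated chart -/

theorem abs_apply_le_norm {ι : Type*} [Fintype ι] (v : EuclideanSpace ℝ ι) (i : ι) :
    |v i| ≤ ‖v‖ := by
  simpa using PiLp.norm_apply_le v i

namespace ChartBox

variable {p d : ℕ} {Z M : Type*} [TopologicalSpace Z] [TopologicalSpace M]
  [ChartedSpace (EuclideanSpace ℝ (Fin p) × Z) M] {α T : ℝ}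

/-- The increment of the equation in a chart, with cut-off coefficient fields, on the plaque with
transverse coordinate `z`. -/
def incr (B : ChartBox p Z M) (V : Fin (d + 1) → (m : M) → LeafTangentSpace p m)
    (w : RoughPath α T d) (hT : 0 ≤ T) (z : Z) (s t : ℝ) :
    EuclideanSpace ℝ (Fin p) → EuclideanSpace ℝ (Fin p) :=
  germ (fun y => B.cut (chartField B.φ (V 0)) (y, z))
    (fun k y => B.cut (chartField B.φ (V k.succ)) (y, z))
    (fun k => w.W1 hT s t k) (fun j k => w.W2 hT s t (j, k)) (t - s)

variable (B : ChartBox p Z M) {V : Fin (d + 1) → (m : M) → LeafTangentSpace p m}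

theorem exists_fieldBound [T2Space Z] (hV : ∀ i, IsLeafwiseCkVectorField Z 3 (V i)) :
    ∃ K, ∀ z, FieldBound K (fun y => B.cut (chartField B.φ (V 0)) (y, z))
      (fun k y => B.cut (chartField B.φ (V k.succ)) (y, z)) := by
  have h : ∀ i, ∃ K, ∀ z, C1BL K (fun y => B.cut (chartField B.φ (V i)) (y, z)) ∧
      C1BL K (fderiv ℝ fun y => B.cut (chartField B.φ (V i)) (y, z)) := fun i =>
    exists_c1BL_slice B.isCompact_supp (B.leafwiseContDiffOn_cut (hV i B.φ B.mem_atlas))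
      fun q hq => B.cut_eq_zero hq
  choose K hK using h
  have hle : ∀ i, K i ≤ ∑ i, |K i| := fun i => (le_abs_self _).trans
    (Finset.single_le_sum (f := fun i => |K i|) (fun _ _ => abs_nonneg _) (Finset.mem_univ i))
  exact ⟨∑ i, |K i|, fun z => ⟨(hK 0 z).1.mono (hle 0), fun k => (hK k.succ z).1.mono (hle _),
    fun k => (hK k.succ z).2.mono (hle _)⟩⟩

theorem continuous_incr_of_continuous [T2Space Z] (hV : ∀ i, IsLeafwiseCkVectorField Z 3 (V i))
    {X : Type*} [TopologicalSpace X] {a : X → Fin d → ℝ} {b : X → Fin d → Fin d → ℝ} {h : X → ℝ}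
    {y : X → EuclideanSpace ℝ (Fin p)} {z : X → Z} (ha : ∀ k, Continuous fun x => a x k)
    (hb : ∀ j k, Continuous fun x => b x j k) (hh : Continuous h) (hy : Continuous y)
    (hz : Continuous z) :
    Continuous fun x => germ (fun y => B.cut (chartField B.φ (V 0)) (y, z x))
      (fun k y => B.cut (chartField B.φ (V k.succ)) (y, z x)) (a x) (b x) (h x) (y x) := by
  have hc : ∀ i, LeafwiseContDiffOn 3 (B.cut (chartField B.φ (V i))) univ := fun i =>
    B.leafwiseContDiffOn_cut (hV i B.φ B.mem_atlas)
  have hyz : Continuous fun x => (y x, z x) := hy.prodMk hz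
  have c0 : ∀ i, Continuous fun x => B.cut (chartField B.φ (V i)) (y x, z x) := fun i =>
    (continuousOn_univ.1 (hc i).continuousOn).comp hyz
  have c1 : ∀ i, Continuous fun x => dy (B.cut (chartField B.φ (V i))) (y x, z x) := fun i =>
    (continuousOn_univ.1 ((hc i).dy isOpen_univ).continuousOn).comp hyz
  refine ((continuous_finsetSum _ fun k _ => (ha k).smul (c0 _)).add
    (continuous_finsetSum _ fun j _ => continuous_finsetSum _ fun k _ =>
      (hb j k).smul ((c1 k.succ).clm_apply (c0 j.succ)))).add (hh.smul (c0 0))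

theorem coeff_bounds {w : RoughPath α T d} {R : ℝ} (hw : w.BoundedBy R)
    (hα : 0 ≤ α) (hα₂ : α < 1 / 2) (hR : 0 ≤ R) (hT : 0 ≤ T) {s t x : ℝ} (hst : s ≤ t)
    (hx1 : t - s ≤ 1) (hx : (t - s) ^ α ≤ x) :
    (∀ k, |w.W1 hT s t k| ≤ R * x) ∧ (∀ j k, |w.W2 hT s t (j, k)| ≤ R * x ^ 2) ∧
      |t - s| ≤ x ^ 2 := by
  have hts : 0 ≤ t - s := by linarith
  have h0 : 0 ≤ (t - s) ^ α := Real.rpow_nonneg hts _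
  have h1 : (t - s) ^ (2 * α) ≤ x ^ 2 := by
    rw [mul_comm, Real.rpow_mul hts, Real.rpow_two]
    exact pow_le_pow_left₀ h0 hx 2
  refine ⟨fun k => (abs_apply_le_norm _ _).trans
      ((RoughPath.norm_W1_le hw hα hR hT hst).trans (by gcongr)), fun j k =>
    (abs_apply_le_norm _ _).trans
      ((RoughPath.norm_W2_le hw hα hR hT hst).trans (by gcongr)), ?_⟩
  rw [abs_of_nonneg hts]
  refine le_trans ?_ h1
  rcases hts.eq_or_lt with h | h
  · rw [← h]; positivity
  · calc t - s = (t - s) ^ (1 : ℝ) := (Real.rpow_one _).symm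
      _ ≤ _ := Real.rpow_le_rpow_of_exponent_ge h hx1 (by linarith)

/-- The increments of the equation in a chart form an almost flow, with a constant that depends
on the rough path only through a bound on its Hölder norms. -/
theorem exists_almostFlow [T2Space Z] (hV : ∀ i, IsLeafwiseCkVectorField Z 3 (V i))
    (hα : 0 < α) (hα₂ : α < 1 / 2) (hT : 0 ≤ T) {R : ℝ} (hR : 0 ≤ R) :
    ∃ K, 0 ≤ K ∧ ∀ (w : RoughPath α T d) (z : Z), w.BoundedBy R →
      AlmostFlow K α (3 * α) (B.incr V w hT z) := by
  obtain ⟨K, hK⟩ := B.exists_fieldBound hV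
  set K₁ := d * R * K + d * d * R * (4 * K * K) + K with hK₁
  set K₂ := (d * (R * (2 * K * K₁ * K₁)) +
    d * (R * (2 * K * (d * (d * (R * (4 * K * K))) + K))) +
      d * (d * (R * (4 * K * K * K₁ * (1 + 1)))) + K * K₁ * (1 + 1)) with hK₂
  refine ⟨max 0 (max K₁ K₂), le_max_left _ _, fun w z hw => ⟨fun s t hst h1 => ?_,
    fun s u t hsu hut h1 => ?_, ?_⟩⟩
  · have hts : 0 ≤ t - s := by linarith
    have hx0 : 0 ≤ (t - s) ^ α := Real.rpow_nonneg hts _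
    obtain ⟨ha, hb, hh⟩ := coeff_bounds hw hα.le hα₂ hR hT hst h1 le_rfl
    refine (germ_c1BL (hK z) hR hx0 (Real.rpow_le_one hts h1 hα.le) ha hb hh).mono ?_
    gcongr
    exact (le_max_left _ _).trans (le_max_right _ _)
  · have hts : 0 ≤ t - s := by linarith
    have hx0 : 0 ≤ (t - s) ^ α := Real.rpow_nonneg hts _
    obtain ⟨ha, hb, hh⟩ := coeff_bounds hw hα.le hα₂ hR hT hsu (by linarith)
      (x := (t - s) ^ α) (Real.rpow_le_rpow (by linarith) (by linarith) hα.le)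
    obtain ⟨ha', hb', hh'⟩ := coeff_bounds hw hα.le hα₂ hR hT hut (by linarith)
      (x := (t - s) ^ α) (Real.rpow_le_rpow (by linarith) (by linarith) hα.le)
    have h2 := germDefect_bl (hK z) hR hx0 (Real.rpow_le_one hts h1 hα.le) ha hb hh ha' hb' hh'
      hK₁
    have e1 : ((t - s) ^ α) ^ 3 = (t - s) ^ (3 * α) := by
      rw [mul_comm, Real.rpow_mul hts, ← Real.rpow_natCast]
      norm_num
    rw [e1] at h2
    have e2 : (fun y => B.incr V w hT z s u y + B.incr V w hT z u t (y + B.incr V w hT z s u y) -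
        B.incr V w hT z s t y) = germDefect (fun y => B.cut (chartField B.φ (V 0)) (y, z))
        (fun k y => B.cut (chartField B.φ (V k.succ)) (y, z)) (fun k => w.W1 hT s u k)
        (fun k => w.W1 hT u t k) (fun j k => w.W2 hT s u (j, k)) (fun j k => w.W2 hT u t (j, k))
        (u - s) (t - u) := by
      funext y
      rw [germDefect]
      unfold incr
      congr 2
      · funext k
        rw [w.W1_add hT hsu hut]
        rfl
      · funext j k
        rw [w.W2_add hT hsu hut]
      · ring
    rw [e2]
    refine h2.mono ?_
    gcongr
    exact (le_max_right _ _).trans (le_max_right _ _)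
  · refine B.continuous_incr_of_continuous hV (fun k => ?_) (fun j k => ?_) (by fun_prop) (by fun_prop)
      continuous_const
    · have := (w.continuous_W1 hT).comp
        (continuous_fst.prodMk (continuous_snd.fst) :
        Continuous fun q : ℝ × ℝ × EuclideanSpace ℝ (Fin p) => (q.1, q.2.1))
      fun_prop
    · have := (w.continuous_W2 hT).comp
        (continuous_fst.prodMk (continuous_snd.fst) :
        Continuous fun q : ℝ × ℝ × EuclideanSpace ℝ (Fin p) => (q.1, q.2.1))
      fun_prop

theorem continuous_incr [T2Space Z] (hV : ∀ i, IsLeafwiseCkVectorField Z 3 (V i)) (hT : 0 ≤ T)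
    (P : RoughPath α T d → Prop) (s t : ℝ) :
    Continuous fun q : (Z × {w : RoughPath α T d // P w}) × EuclideanSpace ℝ (Fin p) =>
      B.incr V q.1.2.1 hT q.1.1 s t q.2 := by
  have hw : Continuous fun q : (Z × {w : RoughPath α T d // P w}) × EuclideanSpace ℝ (Fin p) =>
      q.1.2.1 := by fun_prop
  refine B.continuous_incr_of_continuous hV (fun k => ?_) (fun j k => ?_) continuous_const (by fun_prop)
    (by fun_prop)
  · have := (RoughPath.continuous_w1_apply (α := α) (d := d) (clampTri hT s t)).comp hw
    simp only [RoughPath.W1]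
    fun_prop
  · have := (RoughPath.continuous_w2_apply (α := α) (d := d) (clampTri hT s t)).comp hw
    simp only [RoughPath.W2]
    fun_prop

end ChartBox

/-! ### Test functions along solutions in a chart -/

section GermTaylor

variable {E : Type*} [NormedAddCommGroup E] [NormedSpace ℝ E] {d : ℕ}

/-- Second-order Taylor formula for a function with Lipschitz second derivative. -/
theorem norm_taylor_two_le {K : ℝ} {g : E → ℝ} (hg : C1BL K g) (hg' : C1BL K (fderiv ℝ g))
    (y v : E) :
    ‖g (y + v) - g y - fderiv ℝ g y v - (1 / 2 : ℝ) * fderiv ℝ (fderiv ℝ g) y v v‖ ≤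
      K * ‖v‖ * ‖v‖ * ‖v‖ := by
  set S := fderiv ℝ (fderiv ℝ g) y with hS
  have hsymm : ∀ v w, S v w = S w v := fun v w =>
    second_derivative_symmetric (fun x => (hg.1 x).hasFDerivAt) (hg'.1 y).hasFDerivAt v w
  have := Convex.norm_image_sub_le_of_norm_hasFDerivWithin_le (𝕜 := ℝ)
    (s := Metric.closedBall (0 : E) ‖v‖)
    (f := fun x => g (y + x) - g y - fderiv ℝ g y x - (1 / 2 : ℝ) * S x x)
    (f' := fun x => fderiv ℝ g (y + x) - fderiv ℝ g y - S x) (C := K * ‖v‖ * ‖v‖) (x := 0) (y := v)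
    (fun x _ => ?_) (fun x hx => ?_) (convex_closedBall _ _) (by simp) (by simp)
  · simpa using this
  · have h1 := (((hasFDerivAt_comp_add_left y).2 (hg.1 (y + x)).hasFDerivAt).sub_const (g y)).sub
      (fderiv ℝ g y).hasFDerivAt
    have h2 : HasFDerivAt (fun x => S x x) (S x + S.flip x) x := by
      have := S.hasFDerivAt.clm_apply (hasFDerivAt_id x)
      simpa using this
    have h3 := h1.sub (h2.const_mul (1 / 2 : ℝ))
    refine (h3.congr_fderiv ?_).hasFDerivWithinAt
    ext w
    simp only [sub_apply, smul_apply, add_apply, ContinuousLinearMap.flip_apply, smul_eq_mul]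
    rw [hsymm w x]
    ring
  · have hc := hg.nonneg
    have hx' : ‖x‖ ≤ ‖v‖ := by simpa using hx
    refine (hg'.norm_taylor_le y x).trans ?_
    gcongr

/-- Itô's formula in a chart: if the second level of the driving path has symmetric part
`a ⊗ a / 2`, then a function of an increment close to the germ has the expansion prescribed by
the equation. -/
theorem exists_germ_taylor {K R C : ℝ} (hR : 0 ≤ R) (hC : 0 ≤ C) : ∃ C' : ℝ, 0 ≤ C' ∧
    ∀ {A₀ : E → E} {A : Fin d → E → E} {g : E → ℝ} {a : Fin d → ℝ} {b : Fin d → Fin d → ℝ}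
    {h x : ℝ} {y v : E}, FieldBound K A₀ A → C1BL K g → C1BL K (fderiv ℝ g) → 0 ≤ x → x ≤ 1 →
    (∀ k, |a k| ≤ R * x) → (∀ j k, |b j k| ≤ R * x ^ 2) → |h| ≤ x ^ 2 →
    (∀ j k, b j k + b k j = a j * a k) → ‖v - germ A₀ A a b h y‖ ≤ C * x ^ 3 →
    |g (y + v) - g y - (∑ k, fderiv ℝ g y (A k y) * a k +
      ∑ j, ∑ k, (fderiv ℝ (fderiv ℝ g) y (A j y) (A k y) +
        fderiv ℝ g y (fderiv ℝ (A k) y (A j y))) * b j k + fderiv ℝ g y (A₀ y) * h)| ≤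
      C' * x ^ 3 := by
  by_cases hK : 0 ≤ K
  swap
  · exact ⟨0, le_rfl, fun hA => absurd hA.drift.nonneg hK⟩
  set c₁ := d * R * K with hc₁
  set c₂ := d * (d * (R * (4 * K * K))) + K with hc₂
  have hc₁0 : 0 ≤ c₁ := by positivity
  have hc₂0 : 0 ≤ c₂ := by positivity
  set M := C + c₁ + c₂ with hM
  have hM0 : 0 ≤ M := by positivity
  refine ⟨K * M * M * M + K * C + K * (C + c₂) * (M + c₁), by positivity, ?_⟩
  intro A₀ A g a b h x y v hA hg hg' hx hx1 ha hb hh hsym hv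
  set S := fderiv ℝ (fderiv ℝ g) y with hS
  set D := fderiv ℝ g y with hD
  have hSsymm : ∀ v w, S v w = S w v := fun v w =>
    second_derivative_symmetric (fun x => (hg.1 x).hasFDerivAt) (hg'.1 y).hasFDerivAt v w
  set u : E := ∑ k, a k • A k y with hu
  set ρ : E := ∑ j, ∑ k, b j k • fderiv ℝ (A k) y (A j y) + h • A₀ y with hρ
  have hgerm : germ A₀ A a b h y = u + ρ := by rw [germ, hu, hρ, add_assoc]
  rw [hgerm] at hv
  have hun : ‖u‖ ≤ c₁ * x := by
    have := (BL.sum Finset.univ fun k _ => (hA.field k).bl.const_smul (ha k)).1 y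
    simp only [Finset.sum_const, Finset.card_univ, Fintype.card_fin, nsmul_eq_mul] at this
    rw [hc₁]
    linarith
  have hρn : ‖ρ‖ ≤ c₂ * x ^ 2 := by
    have := ((BL.sum Finset.univ fun j _ => BL.sum Finset.univ fun k _ =>
      ((hA.field_fderiv k).clm_apply (hA.field j)).bl.const_smul (hb j k)).add
      (hA.drift.bl.const_smul hh)).1 y
    simp only [Finset.sum_const, Finset.card_univ, Fintype.card_fin, nsmul_eq_mul] at this
    rw [hc₂]
    linarith
  have hx2 : x ^ 2 ≤ x := by nlinarith
  have hx3 : x ^ 3 ≤ x ^ 2 := by nlinarith [sq_nonneg x]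
  have hvu : ‖v - u‖ ≤ (C + c₂) * x ^ 2 := by
    have e : v - u = (v - (u + ρ)) + ρ := by abel
    rw [e]
    refine (norm_add_le _ _).trans ?_
    nlinarith [mul_le_mul_of_nonneg_left hx3 hC]
  have hvn : ‖v‖ ≤ M * x := by
    have e : v = (v - u) + u := by abel
    rw [e]
    refine (norm_add_le _ _).trans ?_
    nlinarith [mul_le_mul_of_nonneg_left hx2 (add_nonneg hC hc₂0)]
  have hSn : ‖S‖ ≤ K := hg'.bl_fderiv.1 y
  have hDn : ‖D‖ ≤ K := hg.bl_fderiv.1 y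
  -- the expansion of the equation is `D (u + ρ) + S u u / 2`
  have hD1 : D (u + ρ) = ∑ k, D (A k y) * a k +
      ∑ j, ∑ k, D (fderiv ℝ (A k) y (A j y)) * b j k + D (A₀ y) * h := by
    rw [hu, hρ, map_add, map_add, map_sum, map_sum, ← add_assoc]
    simp only [map_sum, map_smul, smul_eq_mul, mul_comm]
  have hS1 : (1 / 2 : ℝ) * S u u = ∑ j, ∑ k, S (A j y) (A k y) * b j k := by
    have e1 : S u u = ∑ j, ∑ k, S (A j y) (A k y) * (a j * a k) := by
      rw [hu]
      simp only [map_sum, map_smul, sum_apply, smul_apply, smul_eq_mul,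
        Finset.mul_sum]
      rw [Finset.sum_comm]
      refine Finset.sum_congr rfl fun j _ => Finset.sum_congr rfl fun k _ => ?_
      ring
    have e2 : ∑ j, ∑ k, S (A j y) (A k y) * b k j = ∑ j, ∑ k, S (A j y) (A k y) * b j k := by
      rw [Finset.sum_comm]
      refine Finset.sum_congr rfl fun j _ => Finset.sum_congr rfl fun k _ => ?_
      rw [hSsymm]
    simp only [e1, ← hsym, mul_add, Finset.sum_add_distrib, e2]
    ring
  have hmain : g (y + v) - g y - (∑ k, D (A k y) * a k +
      ∑ j, ∑ k, (S (A j y) (A k y) + D (fderiv ℝ (A k) y (A j y))) * b j k + D (A₀ y) * h) =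
      (g (y + v) - g y - D v - (1 / 2 : ℝ) * S v v) + D (v - (u + ρ)) +
      (1 / 2 : ℝ) * (S (v - u) v + S u (v - u)) := by
    have e3 : S (v - u) v + S u (v - u) = S v v - S u u := by
      simp only [map_sub, sub_apply]; ring
    rw [e3, map_sub, hD1]
    simp only [add_mul, Finset.sum_add_distrib]
    rw [← hS1]
    ring
  rw [hmain]
  have b1 : ‖g (y + v) - g y - D v - (1 / 2 : ℝ) * S v v‖ ≤ K * M * M * M * x ^ 3 := by
    refine (norm_taylor_two_le hg hg' y v).trans ?_
    calc K * ‖v‖ * ‖v‖ * ‖v‖ ≤ K * (M * x) * (M * x) * (M * x) := by gcongr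
      _ = _ := by ring
  have b2 : ‖D (v - (u + ρ))‖ ≤ K * C * x ^ 3 := by
    refine (D.le_opNorm _).trans ?_
    rw [mul_assoc]
    exact mul_le_mul hDn hv (norm_nonneg _) hK
  have b3 : ‖S (v - u) v‖ ≤ K * (C + c₂) * M * x ^ 3 := by
    refine (S.le_opNorm₂ _ _).trans ?_
    calc ‖S‖ * ‖v - u‖ * ‖v‖ ≤ K * ((C + c₂) * x ^ 2) * (M * x) := by gcongr
      _ = _ := by ring
  have b4 : ‖S u (v - u)‖ ≤ K * (C + c₂) * c₁ * x ^ 3 := by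
    refine (S.le_opNorm₂ _ _).trans ?_
    calc ‖S‖ * ‖u‖ * ‖v - u‖ ≤ K * (c₁ * x) * ((C + c₂) * x ^ 2) := by gcongr
      _ = _ := by ring
  have b5 : ‖(1 / 2 : ℝ) * (S (v - u) v + S u (v - u))‖ ≤ K * (C + c₂) * (M + c₁) * x ^ 3 := by
    rw [norm_mul]
    have h1 : ‖(1 / 2 : ℝ)‖ ≤ 1 := by norm_num
    have h2 := norm_add_le (S (v - u) v) (S u (v - u))
    have h3 := mul_le_mul h1 h2 (norm_nonneg _) zero_le_one
    linarith
  rw [← Real.norm_eq_abs]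
  refine (norm_add₃_le).trans ?_
  linarith

end GermTaylor

/-! ### Solutions on the foliated space -/

section Solutions

variable {p d : ℕ} {Z M : Type*} [TopologicalSpace Z] [TopologicalSpace M]
  [ChartedSpace (EuclideanSpace ℝ (Fin p) × Z) M] {α T : ℝ}

/-- The second-order expansion of `f (x_t) - f (x_s)` prescribed by the equation, for `x_s = m`. -/
def expansion (Z : Type*) {M : Type*} [TopologicalSpace Z] [TopologicalSpace M]
    [ChartedSpace (EuclideanSpace ℝ (Fin p) × Z) M]
    (V : Fin (d + 1) → (m : M) → LeafTangentSpace p m) (w : RoughPath α T d)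
    (hT : 0 ≤ T) (f : M → ℝ) (m : M) (s t : ℝ) : ℝ :=
  ∑ i : Fin d, lieDeriv Z (V i.succ) f m * w.W1 hT s t i
    + ∑ j : Fin d, ∑ k : Fin d,
      lieDeriv Z (V j.succ) (lieDeriv Z (V k.succ) f) m * w.W2 hT s t (j, k)
    + lieDeriv Z (V 0) f m * (t - s)

/-- `x` solves the equation on `[s₀, t₀]`, with an arbitrary starting point. Outside `[0, T]` the
driving path is stopped. -/
def SolOn (Z : Type*) {M : Type*} [TopologicalSpace Z] [TopologicalSpace M]
    [ChartedSpace (EuclideanSpace ℝ (Fin p) × Z) M]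
    (V : Fin (d + 1) → (m : M) → LeafTangentSpace p m) (w : RoughPath α T d)
    (hT : 0 ≤ T) (s₀ t₀ : ℝ) (x : ℝ → M) : Prop :=
  ContinuousOn x (Icc s₀ t₀) ∧ ∀ f : M → ℝ, IsLeafwiseCkFun p Z 3 f → ∃ C : ℝ,
    ∀ s t, s₀ ≤ s → s ≤ t → t ≤ t₀ →
      |f (x t) - f (x s) - expansion Z V w hT f (x s) s t| ≤ C * (t - s) ^ (3 * α)

variable {V : Fin (d + 1) → (m : M) → LeafTangentSpace p m} {w : RoughPath α T d} {hT : 0 ≤ T}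

theorem SolOn.mono {s₀ t₀ s₁ t₁ : ℝ} {x : ℝ → M} (h : SolOn Z V w hT s₀ t₀ x) (hs : s₀ ≤ s₁)
    (ht : t₁ ≤ t₀) : SolOn Z V w hT s₁ t₁ x := by
  refine ⟨h.1.mono (Icc_subset_Icc hs ht), fun f hf => ?_⟩
  obtain ⟨C, hC⟩ := h.2 f hf
  exact ⟨C, fun s t h1 h2 h3 => hC s t (hs.trans h1) h2 (h3.trans ht)⟩

theorem SolOn.congr {s₀ t₀ : ℝ} {x x' : ℝ → M} (h : SolOn Z V w hT s₀ t₀ x)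
    (hx : ∀ t ∈ Icc s₀ t₀, x' t = x t) : SolOn Z V w hT s₀ t₀ x' := by
  refine ⟨h.1.congr hx, fun f hf => ?_⟩
  obtain ⟨C, hC⟩ := h.2 f hf
  refine ⟨C, fun s t h1 h2 h3 => ?_⟩
  rw [hx t ⟨h1.trans h2, h3⟩, hx s ⟨h1, h2.trans h3⟩]
  exact hC s t h1 h2 h3

theorem expansion_chart [IsFoliatedSpace p Z M] (hV : ∀ i, IsLeafwiseCkVectorField Z 3 (V i))
    {φ : OpenPartialHomeomorph M (EuclideanSpace ℝ (Fin p) × Z)}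
    (hφ : φ ∈ atlas (EuclideanSpace ℝ (Fin p) × Z) M) {f : M → ℝ}
    (hf : IsLeafwiseCkFun p Z 3 f) {q} (hq : q ∈ φ.target) (s t : ℝ) :
    expansion Z V w hT f (φ.symm q) s t =
      ∑ k : Fin d, dy (f ∘ φ.symm) q (chartField φ (V k.succ) q) * w.W1 hT s t k +
      ∑ j : Fin d, ∑ k : Fin d,
        (dy (dy (f ∘ φ.symm)) q (chartField φ (V j.succ) q) (chartField φ (V k.succ) q) +
        dy (f ∘ φ.symm) q (dy (chartField φ (V k.succ)) q (chartField φ (V j.succ) q))) *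
          w.W2 hT s t (j, k) +
      dy (f ∘ φ.symm) q (chartField φ (V 0) q) * (t - s) := by
  have h1 : ∀ i, lieDeriv Z (V i) f (φ.symm q) = _ := fun i =>
    hf.lieDeriv_chart hφ (V i) (by norm_num) hq
  have h2 : ∀ j k, lieDeriv Z (V j) (lieDeriv Z (V k) f) (φ.symm q) = _ := fun j k =>
    lieDeriv_lieDeriv_chart hφ (V j) ((hV k).of_le (by norm_num)) (hf.of_le (by norm_num)) hq
  simp only [expansion, h1, h2]

/-- A real function with increments `O(|t - s|^θ)`, `θ > 1`, is constant. -/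
theorem eq_of_abs_sub_le_rpow {θ C s₀ t₀ : ℝ} (hθ : 1 < θ) (hst : s₀ ≤ t₀) {g : ℝ → ℝ}
    (hg : ∀ s t, s₀ ≤ s → s ≤ t → t ≤ t₀ → |g t - g s| ≤ C * (t - s) ^ θ) : g t₀ = g s₀ := by
  rcases hst.eq_or_lt with rfl | hlt
  · rfl
  have hh : 0 < t₀ - s₀ := by linarith
  have key : ∀ᶠ n : ℕ in atTop, |g t₀ - g s₀| ≤ C * (n * ((t₀ - s₀) / n) ^ θ) := by
    filter_upwards [eventually_gt_atTop 0] with n hn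
    have hn' : (0 : ℝ) < n := by exact_mod_cast hn
    set δ := (t₀ - s₀) / n with hδdef
    have hδ : 0 < δ := by positivity
    have hnδ : n * δ = t₀ - s₀ := by rw [hδdef]; field_simp
    have main : ∀ m : ℕ, m ≤ n → |g (s₀ + m * δ) - g s₀| ≤ C * (m * δ ^ θ) := by
      intro m
      induction m with
      | zero => simp
      | succ m ih =>
        intro hm
        have h1 : ((m : ℝ) + 1) * δ ≤ n * δ := by
          have : (m : ℝ) + 1 ≤ n := by exact_mod_cast hm
          gcongr
        have h0 : 0 ≤ m * δ := by positivity
        have h2 := hg (s₀ + m * δ) (s₀ + (m + 1 : ℕ) * δ) (by linarith)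
          (by push_cast; linarith) (by push_cast; linarith)
        have h3 : s₀ + (m + 1 : ℕ) * δ - (s₀ + m * δ) = δ := by push_cast; ring
        rw [h3] at h2
        have h4 := ih (by omega)
        refine (abs_sub_le _ (g (s₀ + m * δ)) _).trans ((add_le_add h2 h4).trans ?_)
        push_cast
        exact le_of_eq (by ring)
    have := main n le_rfl
    rwa [hnδ, add_sub_cancel] at this
  have := ge_of_tendsto (tendsto_mul_div_rpow hθ hh C) key
  exact sub_eq_zero.1 (abs_eq_zero.1 (le_antisymm this (abs_nonneg _)))

theorem FieldBound.mono {E : Type*} [NormedAddCommGroup E] [NormedSpace ℝ E] {K K' : ℝ}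
    {A₀ : E → E} {A : Fin d → E → E} (h : FieldBound K A₀ A) (hK : K ≤ K') :
    FieldBound K' A₀ A :=
  ⟨h.1.mono hK, fun k => (h.2 k).mono hK, fun k => (h.3 k).mono hK⟩

theorem norm_le_sum_abs (v : EuclideanSpace ℝ (Fin p)) : ‖v‖ ≤ ∑ l, |v l| := by
  rw [EuclideanSpace.norm_eq]
  refine Real.sqrt_le_iff.2 ⟨Finset.sum_nonneg fun _ _ => abs_nonneg _, ?_⟩
  exact Finset.sum_sq_le_sq_sum_of_nonneg fun _ _ => abs_nonneg _

namespace ChartBox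

variable [IsFoliatedSpace p Z M] (B : ChartBox p Z M)

/-- A path which follows the increments of the equation in a chart is the coordinate expression
of a solution. -/
theorem solOn_of_incr [T2Space Z] (hV : ∀ i, IsLeafwiseCkVectorField Z 3 (V i)) (hα : 0 < α)
    (hα₂ : α < 1 / 2) {R C : ℝ} (hR : 0 ≤ R) (hC : 0 ≤ C) (hw : w.BoundedBy R)
    (hg : w.IsWeaklyGeometric) {s₀ t₀ : ℝ} (hst : t₀ ≤ s₀ + 1)
    {y : ℝ → EuclideanSpace ℝ (Fin p)} {z : Z} (hz : z ∈ B.N)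
    (hyc : ContinuousOn y (Icc s₀ t₀)) (hy : ∀ t ∈ Icc s₀ t₀, y t ∈ Metric.ball B.y₀ (2 * B.r))
    (hdav : ∀ s t, s₀ ≤ s → s ≤ t → t ≤ t₀ →
      ‖y t - (y s + B.incr V w hT z s t (y s))‖ ≤ C * (t - s) ^ (3 * α)) :
    SolOn Z V w hT s₀ t₀ (fun t => B.φ.symm (y t, z)) := by
  have hmem : ∀ t ∈ Icc s₀ t₀, (y t, z) ∈ B.inner := fun t ht => ⟨hy t ht, hz⟩
  refine ⟨B.φ.continuousOn_symm.comp (hyc.prodMk continuousOn_const) fun t ht =>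
    B.inner_subset (hmem t ht), fun f hf => ?_⟩
  have hF := hf B.φ B.mem_atlas
  obtain ⟨K₁, hK₁⟩ := B.exists_fieldBound hV
  obtain ⟨K₂, hK₂⟩ := exists_c1BL_slice B.isCompact_supp (B.leafwiseContDiffOn_cut hF)
    fun q hq => B.cut_eq_zero hq
  obtain ⟨C', -, hC'⟩ := exists_germ_taylor (E := EuclideanSpace ℝ (Fin p)) (d := d)
    (K := max K₁ K₂) hR hC
  refine ⟨C', fun s t hs hst' ht => ?_⟩
  have hts : 0 ≤ t - s := by linarith
  have hx1 : (t - s) ^ α ≤ 1 := Real.rpow_le_one hts (by linarith) hα.le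
  have e1 : ((t - s) ^ α) ^ 3 = (t - s) ^ (3 * α) := by
    rw [mul_comm, Real.rpow_mul hts, ← Real.rpow_natCast]
    norm_num
  obtain ⟨ha, hb, hh⟩ := coeff_bounds hw hα.le hα₂ hR hT hst' (by linarith) (x := (t - s) ^ α) le_rfl
  have hq : (y s, z) ∈ B.inner := hmem s ⟨hs, by linarith⟩
  have hq' : (y t, z) ∈ B.inner := hmem t ⟨by linarith, ht⟩
  have key := hC' (y := y s) (v := y t - y s) ((hK₁ z).mono (le_max_left _ _))
    ((hK₂ z).1.mono (le_max_right _ _)) ((hK₂ z).2.mono (le_max_right _ _))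
    (Real.rpow_nonneg hts _) hx1 ha hb hh (hg.W2_add_symm hT s t)
    (by rw [e1, sub_sub]; exact hdav s t hs hst' ht)
  rw [e1, add_sub_cancel] at key
  rw [expansion_chart hV B.mem_atlas hf (B.inner_subset hq)]
  have cF : ∀ q ∈ B.inner, B.cut (f ∘ B.φ.symm) q = (f ∘ B.φ.symm) q := fun q hq =>
    B.cut_eq_of_mem hq
  have cA : ∀ i, ∀ q ∈ B.inner, B.cut (chartField B.φ (V i)) q = chartField B.φ (V i) q :=
    fun i q hq => B.cut_eq_of_mem hq
  have dF : ∀ q ∈ B.inner, dy (B.cut (f ∘ B.φ.symm)) q = dy (f ∘ B.φ.symm) q := fun q hq =>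
    dy_congr B.isOpen_inner cF hq
  have ddF := dy_congr B.isOpen_inner dF hq
  have dA : ∀ i, dy (B.cut (chartField B.φ (V i))) (y s, z) =
      dy (chartField B.φ (V i)) (y s, z) := fun i => dy_congr B.isOpen_inner (cA i) hq
  rw [← ddF, ← dF _ hq]
  simp only [← dA, ← cA _ _ hq]
  change |(f ∘ B.φ.symm) (y t, z) - (f ∘ B.φ.symm) (y s, z) - _| ≤ _
  rw [← cF _ hq, ← cF _ hq']
  exact key

section

variable [T2Space M]

/-- A solution does not leave its plaque. -/
theorem snd_eq_of_solOn [TopologicalSpace.MetrizableSpace Z]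
    (hV : ∀ i, IsLeafwiseCkVectorField Z 3 (V i)) (hα : 1 / 3 < α)
    {s₀ t₀ : ℝ} (hst : s₀ ≤ t₀) {x : ℝ → M} (hx : SolOn Z V w hT s₀ t₀ x)
    (hmem : ∀ t ∈ Icc s₀ t₀, x t ∈ B.φ.source ∧ B.φ (x t) ∈ B.inner) :
    (B.φ (x t₀)).2 = (B.φ (x s₀)).2 := by
  let _ := TopologicalSpace.metrizableSpaceMetric Z
  set z₀ := (B.φ (x s₀)).2 with hz₀
  have hf : IsLeafwiseCkFun p Z 3 (bumpFun B.φ B.χ₁ fun z => B.χ₂ z * dist z z₀) :=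
    isLeafwiseCkFun_bumpFun B.mem_atlas 3 B.contDiff_χ₁
      (B.continuous_χ₂.mul (by fun_prop)) (isCompact_closedBall _ _) B.isCompact_K₂
      B.subset_target B.χ₁_eq_zero fun z hz => by rw [B.χ₂_eq_zero z hz, zero_mul]
  have hF : ∀ q ∈ B.inner, (bumpFun B.φ B.χ₁ (fun z => B.χ₂ z * dist z z₀) ∘ B.φ.symm) q =
      dist q.2 z₀ := fun q hq => by
    rw [Function.comp_apply, bumpFun_symm _ _ _ (B.inner_subset hq), B.χ₁_eq_one _ hq.1,
      B.χ₂_eq_one _ hq.2]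
    ring
  have dF : ∀ q ∈ B.inner, dy (bumpFun B.φ B.χ₁ (fun z => B.χ₂ z * dist z z₀) ∘ B.φ.symm) q =
      0 := fun q hq => by
    rw [dy_congr B.isOpen_inner hF hq, dy_const (fun z => dist z z₀)]
  have ddF : ∀ q ∈ B.inner,
      dy (dy (bumpFun B.φ B.χ₁ (fun z => B.χ₂ z * dist z z₀) ∘ B.φ.symm)) q = 0 := fun q hq => by
    rw [dy_congr B.isOpen_inner (g := fun _ => 0) dF hq]
    simp [dy]
  have hfx : ∀ t ∈ Icc s₀ t₀, bumpFun B.φ B.χ₁ (fun z => B.χ₂ z * dist z z₀) (x t) =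
      dist (B.φ (x t)).2 z₀ := fun t ht => by
    rw [← hF _ (hmem t ht).2, Function.comp_apply, B.φ.left_inv (hmem t ht).1]
  obtain ⟨C, hC⟩ := hx.2 _ hf
  have h1 := eq_of_abs_sub_le_rpow (θ := 3 * α) (C := C) (by linarith) hst
    (g := fun t => dist (B.φ (x t)).2 z₀) fun s t hs hst' ht => ?_
  · rw [← hz₀, dist_self] at h1
    exact dist_eq_zero.1 h1
  · have hms := hmem s ⟨hs, hst'.trans ht⟩
    have h2 := hC s t hs hst' ht
    have h3 := expansion_chart (w := w) (hT := hT) hV B.mem_atlas hf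
      (B.inner_subset hms.2) s t
    rw [B.φ.left_inv hms.1, ddF _ hms.2, dF _ hms.2] at h3
    rw [h3, hfx t ⟨hs.trans hst', ht⟩, hfx s ⟨hs, hst'.trans ht⟩] at h2
    simpa using h2

/-- The coordinates of a solution follow the increments of the equation in the chart. -/
theorem incr_of_solOn (hV : ∀ i, IsLeafwiseCkVectorField Z 3 (V i)) {s₀ t₀ : ℝ} {x : ℝ → M}
    (hx : SolOn Z V w hT s₀ t₀ x)
    (hmem : ∀ t ∈ Icc s₀ t₀, x t ∈ B.φ.source ∧ B.φ (x t) ∈ B.inner) :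
    ∃ C, ∀ s t, s₀ ≤ s → s ≤ t → t ≤ t₀ →
      ‖(B.φ (x t)).1 - ((B.φ (x s)).1 +
        B.incr V w hT (B.φ (x s)).2 s t (B.φ (x s)).1)‖ ≤ C * (t - s) ^ (3 * α) := by
  have hl : ∀ l : Fin p, ∃ C, ∀ s t, s₀ ≤ s → s ≤ t → t ≤ t₀ →
      |((B.φ (x t)).1 - ((B.φ (x s)).1 +
        B.incr V w hT (B.φ (x s)).2 s t (B.φ (x s)).1)) l| ≤ C * (t - s) ^ (3 * α) := by
    intro l
    set π : EuclideanSpace ℝ (Fin p) →L[ℝ] ℝ := EuclideanSpace.proj l with hπ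
    set h₁ : EuclideanSpace ℝ (Fin p) → ℝ := fun y => B.χ₁ y * π y with hh₁
    have hf : IsLeafwiseCkFun p Z 3 (bumpFun B.φ h₁ B.χ₂) :=
      isLeafwiseCkFun_bumpFun B.mem_atlas 3 (B.contDiff_χ₁.mul π.contDiff)
        B.continuous_χ₂ (isCompact_closedBall _ _) B.isCompact_K₂
        B.subset_target (fun y hy => by rw [hh₁]; simp [B.χ₁_eq_zero y hy]) B.χ₂_eq_zero
    have hF : ∀ q ∈ B.inner, (bumpFun B.φ h₁ B.χ₂ ∘ B.φ.symm) q = π q.1 := fun q hq => by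
      rw [Function.comp_apply, bumpFun_symm _ _ _ (B.inner_subset hq), hh₁]
      simp only [B.χ₁_eq_one _ hq.1, B.χ₂_eq_one _ hq.2, one_mul]
    have dF : ∀ q ∈ B.inner, dy (bumpFun B.φ h₁ B.χ₂ ∘ B.φ.symm) q = π := fun q hq => by
      rw [dy_congr B.isOpen_inner hF hq]
      exact π.fderiv
    have ddF : ∀ q ∈ B.inner, dy (dy (bumpFun B.φ h₁ B.χ₂ ∘ B.φ.symm)) q = 0 := fun q hq => by
      rw [dy_congr B.isOpen_inner (g := fun _ => π) dF hq]
      simp [dy]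
    have hfx : ∀ t ∈ Icc s₀ t₀, bumpFun B.φ h₁ B.χ₂ (x t) = π (B.φ (x t)).1 := fun t ht => by
      rw [← hF _ (hmem t ht).2, Function.comp_apply, B.φ.left_inv (hmem t ht).1]
    obtain ⟨C, hC⟩ := hx.2 _ hf
    refine ⟨C, fun s t hs hst' ht => ?_⟩
    have hms := hmem s ⟨hs, hst'.trans ht⟩
    have h2 := hC s t hs hst' ht
    have h3 := expansion_chart (w := w) (hT := hT) hV B.mem_atlas hf
      (B.inner_subset hms.2) s t
    rw [B.φ.left_inv hms.1, ddF _ hms.2, dF _ hms.2] at h3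
    rw [h3, hfx t ⟨hs.trans hst', ht⟩, hfx s ⟨hs, hst'.trans ht⟩] at h2
    refine le_trans (le_of_eq ?_) h2
    rw [show ∀ v : EuclideanSpace ℝ (Fin p), v l = π v from fun _ => rfl]
    have cA : ∀ i, B.cut (chartField B.φ (V i)) (B.φ (x s)) = chartField B.φ (V i) (B.φ (x s)) :=
      fun i => B.cut_eq_of_mem hms.2
    have dA : ∀ i, dy (B.cut (chartField B.φ (V i))) (B.φ (x s)) =
        dy (chartField B.φ (V i)) (B.φ (x s)) := fun i =>
      dy_congr B.isOpen_inner (fun q hq => B.cut_eq_of_mem hq) hms.2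
    have e : π (B.incr V w hT (B.φ (x s)).2 s t (B.φ (x s)).1) =
        ∑ k : Fin d, w.W1 hT s t k * π (B.cut (chartField B.φ (V k.succ)) (B.φ (x s))) +
        ∑ j : Fin d, ∑ k : Fin d, w.W2 hT s t (j, k) *
          π (dy (B.cut (chartField B.φ (V k.succ))) (B.φ (x s))
            (B.cut (chartField B.φ (V j.succ)) (B.φ (x s)))) +
        (t - s) * π (B.cut (chartField B.φ (V 0)) (B.φ (x s))) := by
      rw [incr, germ, map_add, map_add, map_sum, map_sum]
      simp only [map_sum, map_smul, smul_eq_mul]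
      rfl
    rw [map_sub, map_add, e, ← sub_sub]
    simp only [cA, dA, zero_apply, zero_add, mul_comm]
  choose C hC using hl
  refine ⟨∑ l, C l, fun s t hs hst' ht => (norm_le_sum_abs _).trans ?_⟩
  rw [Finset.sum_mul]
  exact Finset.sum_le_sum fun l _ => hC l s t hs hst' ht

end

end ChartBox

end Solutions

section LocalTheory

variable {p d : ℕ} {Z M : Type*} [TopologicalSpace Z] [TopologicalSpace M]
  [ChartedSpace (EuclideanSpace ℝ (Fin p) × Z) M] [IsFoliatedSpace p Z M]
  [LocallyCompactSpace Z] [TopologicalSpace.MetrizableSpace Z]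
  {α T : ℝ} {V : Fin (d + 1) → (m : M) → LeafTangentSpace p m} {hT : 0 ≤ T}

/-! ### Uniqueness and local existence -/

theorem SolOn.eqOn [T2Space M] {w : RoughPath α T d} (hV : ∀ i, IsLeafwiseCkVectorField Z 3 (V i))
    (hα₁ : 1 / 3 < α) (hα₂ : α < 1 / 2) {R : ℝ} (hR : 0 ≤ R) (hw : w.BoundedBy R) {s₀ t₁ : ℝ}
    {x x' : ℝ → M} (hx : SolOn Z V w hT s₀ t₁ x) (hx' : SolOn Z V w hT s₀ t₁ x')
    (h0 : x s₀ = x' s₀) : EqOn x x' (Icc s₀ t₁) := by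
  have hα : 0 < α := by linarith
  change Icc s₀ t₁ ⊆ {t | x t = x' t}
  refine IsClosed.Icc_subset_of_forall_mem_nhdsWithin ?_ h0 ?_
  · have := (hx.1.prodMk hx'.1).preimage_isClosed_of_isClosed isClosed_Icc isClosed_diagonal
    rw [inter_comm]
    exact this
  rintro t₀ ⟨ht₀, ht₀s, ht₀t⟩
  obtain ⟨B, hBs, hBm⟩ := ChartBox.exists_box (p := p) (Z := Z) (x t₀)
  obtain ⟨K, hK0, hK⟩ := B.exists_almostFlow (d := d) (α := α) (T := T) hV hα hα₂ hT hR
  obtain ⟨L, h₀, hc⟩ := exists_schemeConst hK0 hα (by linarith : 1 < 3 * α) (by linarith)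
  set G : Set M := B.φ.source ∩ B.φ ⁻¹' B.inner with hG
  have hGo : IsOpen G := B.φ.isOpen_inter_preimage B.isOpen_inner
  have hxG : x t₀ ∈ G := ⟨hBs, Metric.ball_subset_ball (by linarith [B.r_pos]) hBm.1, hBm.2⟩
  have ht₀I : t₀ ∈ Icc s₀ t₁ := ⟨ht₀s, ht₀t.le⟩
  have e1 : ∀ᶠ t in 𝓝[Icc s₀ t₁] t₀, x t ∈ G ∧ x' t ∈ G :=
    ((hx.1 t₀ ht₀I).eventually (hGo.mem_nhds hxG)).and
      ((hx'.1 t₀ ht₀I).eventually (hGo.mem_nhds (by rw [← (ht₀ : x t₀ = x' t₀)]; exact hxG)))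
  obtain ⟨ε, hε, hεs⟩ := Metric.mem_nhdsWithin_iff.1 e1
  set η := min (ε / 2) (min (t₁ - t₀) h₀) with hη
  have hη0 : 0 < η := lt_min (by positivity) (lt_min (by linarith) hc.h_pos)
  have hη1 : η ≤ ε / 2 := min_le_left _ _
  have hη2 : η ≤ t₁ - t₀ := (min_le_right _ _).trans (min_le_left _ _)
  have hη3 : η ≤ h₀ := (min_le_right _ _).trans (min_le_right _ _)
  have hGt : ∀ t ∈ Icc t₀ (t₀ + η), x t ∈ G ∧ x' t ∈ G := fun t ht => by
    refine hεs ⟨?_, by linarith [ht.1], by linarith [ht.2]⟩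
    rw [Metric.mem_ball, Real.dist_eq, abs_of_nonneg (by linarith [ht.1])]
    linarith [ht.2]
  refine mem_of_superset (Ioc_mem_nhdsGT (by linarith : t₀ < t₀ + η)) fun t ht => ?_
  have sub : ∀ t' ∈ Icc t₀ t, t' ∈ Icc t₀ (t₀ + η) := fun t' ht' => ⟨ht'.1, ht'.2.trans ht.2⟩
  have hxt := hx.mono ht₀s (by linarith [ht.2] : t ≤ t₁)
  have hxt' := hx'.mono ht₀s (by linarith [ht.2] : t ≤ t₁)
  -- both solutions stay in the plaque of the common starting point
  have hz : ∀ s ∈ Icc t₀ t, (B.φ (x s)).2 = (B.φ (x t₀)).2 := fun s hs =>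
    B.snd_eq_of_solOn hV hα₁ hs.1 (hxt.mono le_rfl hs.2) fun t' ht' =>
      (hGt t' (sub t' ⟨ht'.1, ht'.2.trans hs.2⟩)).1
  have hz' : ∀ s ∈ Icc t₀ t, (B.φ (x' s)).2 = (B.φ (x t₀)).2 := fun s hs => by
    rw [(ht₀ : x t₀ = x' t₀)]
    exact B.snd_eq_of_solOn hV hα₁ hs.1 (hxt'.mono le_rfl hs.2) fun t' ht' =>
      (hGt t' (sub t' ⟨ht'.1, ht'.2.trans hs.2⟩)).2
  obtain ⟨C, hC⟩ := B.incr_of_solOn hV hxt fun t' ht' => (hGt t' (sub t' ht')).1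
  obtain ⟨C', hC'⟩ := B.incr_of_solOn hV hxt' fun t' ht' => (hGt t' (sub t' ht')).2
  have hy : (B.φ (x t)).1 = (B.φ (x' t)).1 := by
    refine (hK w (B.φ (x t₀)).2 hw).unique hc (s₀ := t₀) (C := C) (C' := C') ht.1.le
      (by linarith [ht.2]) (y := fun t => (B.φ (x t)).1) (y' := fun t => (B.φ (x' t)).1) ?_
      (fun s t' h1 h2 h3 => ?_) (fun s t' h1 h2 h3 => ?_)
    · rw [(ht₀ : x t₀ = x' t₀)]
    · have := hC s t' h1 h2 h3
      rwa [hz s ⟨h1, h2.trans h3⟩] at this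
    · have := hC' s t' h1 h2 h3
      rwa [hz' s ⟨h1, h2.trans h3⟩] at this
  have htI : t ∈ Icc t₀ t := ⟨ht.1.le, le_rfl⟩
  have hφ : B.φ (x t) = B.φ (x' t) := Prod.ext hy (by rw [hz t htI, hz' t htI])
  exact B.φ.injOn (hGt t (sub t htI)).1.1 (hGt t (sub t htI)).2.1 hφ

/-- The weakly geometric rough paths with Hölder norms bounded by `R`. -/
abbrev BoundedRoughPath (α T : ℝ) (d : ℕ) (R : ℝ) : Type :=
  {w : RoughPath α T d // w.BoundedBy R ∧ w.IsWeaklyGeometric}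

/-- Around every point of `M` there are, for a time `τ` which depends on the rough path only
through a bound on its norms, solutions which depend continuously on all data. -/
theorem exists_local_solution (hV : ∀ i, IsLeafwiseCkVectorField Z 3 (V i)) (hα₁ : 1 / 3 < α)
    (hα₂ : α < 1 / 2) {R : ℝ} (hR : 0 ≤ R) (hT : 0 ≤ T) (m₀ : M) :
    ∃ U : Set M, IsOpen U ∧ m₀ ∈ U ∧ ∃ τ > 0, ∀ s₀ : ℝ,
      ∃ S : M × BoundedRoughPath α T d R → ℝ → M,
        (∀ m ∈ U, ∀ w, SolOn Z V w.1 hT s₀ (s₀ + τ) (S (m, w)) ∧ S (m, w) s₀ = m) ∧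
        ContinuousOn (fun q : (M × BoundedRoughPath α T d R) × ℝ => S q.1 q.2)
          ((U ×ˢ univ) ×ˢ Icc s₀ (s₀ + τ)) := by
  have hα : 0 < α := by linarith
  obtain ⟨B, hBs, hBm⟩ := ChartBox.exists_box (p := p) (Z := Z) m₀
  obtain ⟨K, hK0, hK⟩ := B.exists_almostFlow (d := d) (α := α) (T := T) hV hα hα₂ hT hR
  obtain ⟨L, h₀, hc⟩ := exists_schemeConst hK0 hα (by linarith : 1 < 3 * α) (by linarith)
  have hL0 := hc.L_nonneg
  have hr := B.r_pos
  obtain ⟨τ₁, hτ₁, -, hτ₁r⟩ := exists_rpow_le hα (c := B.r / (K + L + 1)) (by positivity)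
  rw [le_div_iff₀ (by positivity)] at hτ₁r
  refine ⟨B.φ.source ∩ B.φ ⁻¹' (Metric.ball B.y₀ B.r ×ˢ B.N),
    B.φ.isOpen_inter_preimage (Metric.isOpen_ball.prod B.isOpen_N), ⟨hBs, hBm⟩,
    min h₀ τ₁, lt_min hc.h_pos hτ₁, fun s₀ => ?_⟩
  set U : Set M := B.φ.source ∩ B.φ ⁻¹' (Metric.ball B.y₀ B.r ×ˢ B.N) with hU
  set τ := min h₀ τ₁ with hτ
  have hτh : τ ≤ h₀ := min_le_left _ _
  set Ξ : Z × BoundedRoughPath α T d R → ℝ → ℝ → EuclideanSpace ℝ (Fin p) →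
    EuclideanSpace ℝ (Fin p) := fun l => B.incr V l.2.1 hT l.1 with hΞ
  have hAF : ∀ l, AlmostFlow K α (3 * α) (Ξ l) := fun l => hK l.2.1 l.1 l.2.2.1
  set Y : M × BoundedRoughPath α T d R → ℝ → EuclideanSpace ℝ (Fin p) := fun q t =>
    rdeFlow (Ξ ((B.φ q.1).2, q.2)) s₀ h₀ t (B.φ q.1).1 with hY
  have hYmem : ∀ m ∈ U, ∀ w, ∀ t ∈ Icc s₀ (s₀ + τ),
      Y (m, w) t ∈ Metric.ball B.y₀ (2 * B.r) := by
    intro m hm w t ht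
    have h1 := rdeFlow_sub_le_rpow hc (hAF ((B.φ m).2, w)) (by linarith) (le_refl s₀) ht.1
      (by linarith [ht.2]) (B.φ m).1
    rw [rdeFlow_self hc (hAF _)] at h1
    have h2 : (t - s₀) ^ α ≤ τ₁ ^ α := Real.rpow_le_rpow (by linarith [ht.1])
      (by linarith [ht.2, min_le_right h₀ τ₁]) hα.le
    have h3 : (K + L) * (t - s₀) ^ α ≤ B.r := by
      have := mul_le_mul_of_nonneg_left h2 (add_nonneg hK0 hL0)
      have h4 : 0 ≤ τ₁ ^ α := Real.rpow_nonneg hτ₁.le _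
      linarith
    have h5 := hm.2.1
    rw [Metric.mem_ball] at h5 ⊢
    refine (dist_triangle _ (B.φ m).1 _).trans_lt ?_
    rw [dist_eq_norm]
    have := h1.trans h3
    linarith
  have hYc : ContinuousOn (fun q : (M × BoundedRoughPath α T d R) × ℝ => Y q.1 q.2)
      ((U ×ˢ univ) ×ˢ Icc s₀ (s₀ + τ)) := by
    have h1 := continuousOn_rdeFlow hc (by linarith) hAF
      (fun s t => B.continuous_incr (α := α) hV hT _ s t) s₀
    have hφ : ContinuousOn (fun q : (M × BoundedRoughPath α T d R) × ℝ => B.φ q.1.1)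
        ((U ×ˢ univ) ×ˢ Icc s₀ (s₀ + τ)) :=
      B.φ.continuousOn.comp (by fun_prop) fun q hq => hq.1.1.1
    exact h1.comp (f := fun q : (M × BoundedRoughPath α T d R) × ℝ =>
      ((((B.φ q.1.1).2, q.1.2), (B.φ q.1.1).1), q.2)) (by fun_prop)
      fun q hq => ⟨mem_univ _, hq.2.1, by linarith [hq.2.2]⟩
  refine ⟨fun q t => B.φ.symm (Y q t, (B.φ q.1).2), fun m hm w => ⟨?_, ?_⟩, ?_⟩
  · refine B.solOn_of_incr (R := R) (C := L) hV hα hα₂ hR hL0 w.2.1 w.2.2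
      (by linarith [hc.h_le]) hm.2.2 ?_ (hYmem m hm w) fun s t h1 h2 h3 => ?_
    · exact hYc.comp (f := fun t => ((m, w), t)) (by fun_prop)
        fun t ht => ⟨⟨hm, mem_univ _⟩, ht⟩
    · exact rdeFlow_sub_le hc (hAF _) h1 h2 (by linarith) _
  · simp only [hY]
    rw [rdeFlow_self hc (hAF _), Prod.mk.eta, B.φ.left_inv hm.1]
  · have hφ : ContinuousOn (fun q : (M × BoundedRoughPath α T d R) × ℝ => B.φ q.1.1)
        ((U ×ˢ univ) ×ˢ Icc s₀ (s₀ + τ)) :=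
      B.φ.continuousOn.comp (by fun_prop) fun q hq => hq.1.1.1
    exact B.φ.continuousOn_symm.comp (hYc.prodMk (by fun_prop)) fun q hq =>
      B.inner_subset ⟨hYmem _ hq.1.1 _ _ hq.2, hq.1.1.2.2⟩

end LocalTheory

section GlobalTheory

variable {p d : ℕ} {Z M : Type*} [TopologicalSpace Z] [TopologicalSpace M]
  [ChartedSpace (EuclideanSpace ℝ (Fin p) × Z) M] [IsFoliatedSpace p Z M]
  {α T : ℝ} {V : Fin (d + 1) → (m : M) → LeafTangentSpace p m} {hT : 0 ≤ T}

/-! ### Global solutions -/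

theorem continuousOn_expansion {w : RoughPath α T d}
    (hV : ∀ i, IsLeafwiseCkVectorField Z 3 (V i)) {f : M → ℝ}
    (hf : IsLeafwiseCkFun p Z 3 f) {a b : ℝ} {x : ℝ → M} (hx : ContinuousOn x (Icc a b)) :
    ContinuousOn (fun q : ℝ × ℝ => f (x q.2) - f (x q.1) - expansion Z V w hT f (x q.1) q.1 q.2)
      (Icc a b ×ˢ Icc a b) := by
  have h1 : ContinuousOn (fun q : ℝ × ℝ => x q.1) (Icc a b ×ˢ Icc a b) :=
    hx.comp continuousOn_fst fun q hq => hq.1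
  have h2 : ContinuousOn (fun q : ℝ × ℝ => x q.2) (Icc a b ×ˢ Icc a b) :=
    hx.comp continuousOn_snd fun q hq => hq.2
  have hL : ∀ i, IsLeafwiseCkFun p Z 2 (lieDeriv Z (V i) f) := fun i =>
    hf.lieDeriv ((hV i).of_le (by norm_num))
  have hLL : ∀ j k, Continuous (lieDeriv Z (V j) (lieDeriv Z (V k) f)) := fun j k =>
    ((hL k).lieDeriv (k := 1) ((hV j).of_le (by norm_num))).continuous
  have hw1 := w.continuous_W1 hT
  have hw2 := w.continuous_W2 hT
  refine ((hf.continuous.comp_continuousOn h2).sub (hf.continuous.comp_continuousOn h1)).sub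
    (((continuousOn_finsetSum _ fun i _ => ?_).add (continuousOn_finsetSum _ fun j _ =>
      continuousOn_finsetSum _ fun k _ => ?_)).add ?_)
  · exact ((hL _).continuous.comp_continuousOn h1).mul (by fun_prop)
  · exact ((hLL _ _).comp_continuousOn h1).mul (by fun_prop)
  · exact ((hL _).continuous.comp_continuousOn h1).mul (by fun_prop)

/-- Two solutions which agree on an overlap of positive length can be glued: increments across
the overlap are not short, and for those the estimate is trivial. -/
theorem SolOn.glue {w : RoughPath α T d} (hV : ∀ i, IsLeafwiseCkVectorField Z 3 (V i))
    {a b c e : ℝ} (hbc : b < c) (hα : 0 < α)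
    {x x' : ℝ → M} (hx : SolOn Z V w hT a c x) (hx' : SolOn Z V w hT b e x')
    (h : EqOn x x' (Icc b c)) : SolOn Z V w hT a e (fun t => if t ≤ c then x t else x' t) := by
  set y : ℝ → M := fun t => if t ≤ c then x t else x' t with hy
  have e1 : ∀ t ∈ Icc a c, y t = x t := fun t ht => by simp [hy, ht.2]
  have e2 : ∀ t ∈ Icc b e, y t = x' t := fun t ht => by
    by_cases htc : t ≤ c
    · simp only [hy, htc, if_true]
      exact h ⟨ht.1, htc⟩
    · simp [hy, htc]
  have s1 := hx.congr e1
  have s2 := hx'.congr e2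
  have hc : ContinuousOn y (Icc a e) :=
    (s1.1.union_of_isClosed s2.1 isClosed_Icc isClosed_Icc).mono fun t ht => by
      rcases le_total t c with h | h
      · exact Or.inl ⟨ht.1, h⟩
      · exact Or.inr ⟨hbc.le.trans h, ht.2⟩
  refine ⟨hc, fun f hf => ?_⟩
  obtain ⟨C₁, h1⟩ := s1.2 f hf
  obtain ⟨C₂, h2⟩ := s2.2 f hf
  obtain ⟨D, hD⟩ := (isCompact_Icc.prod isCompact_Icc).exists_bound_of_continuousOn
    (continuousOn_expansion (w := w) (hT := hT) hV hf hc)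
  have hη : 0 < (c - b) ^ (3 * α) := Real.rpow_pos_of_pos (by linarith) _
  refine ⟨max (max C₁ C₂) (D / (c - b) ^ (3 * α)), fun s t hs hst ht => ?_⟩
  have hts : 0 ≤ (t - s) ^ (3 * α) := Real.rpow_nonneg (by linarith) _
  by_cases htc : t ≤ c
  · exact (h1 s t hs hst htc).trans
      (mul_le_mul_of_nonneg_right ((le_max_left _ _).trans (le_max_left _ _)) hts)
  by_cases hsb : b ≤ s
  · exact (h2 s t hsb hst ht).trans
      (mul_le_mul_of_nonneg_right ((le_max_right _ _).trans (le_max_left _ _)) hts)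
  have hb := hD (s, t) ⟨⟨hs, hst.trans ht⟩, ⟨hs.trans hst, ht⟩⟩
  have hgap : (c - b) ^ (3 * α) ≤ (t - s) ^ (3 * α) :=
    Real.rpow_le_rpow (by linarith) (by linarith) (by linarith)
  have hD0 : 0 ≤ D := (norm_nonneg _).trans hb
  calc _ ≤ D := hb
    _ = D / (c - b) ^ (3 * α) * (c - b) ^ (3 * α) := by field_simp
    _ ≤ D / (c - b) ^ (3 * α) * (t - s) ^ (3 * α) := by gcongr
    _ ≤ _ := mul_le_mul_of_nonneg_right (le_max_right _ _) hts

variable [LocallyCompactSpace Z] [TopologicalSpace.MetrizableSpace Z] [T2Space M] [CompactSpace M]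

/-- The time of existence is uniform in the starting point. -/
theorem exists_uniform_solution (hV : ∀ i, IsLeafwiseCkVectorField Z 3 (V i)) (hα₁ : 1 / 3 < α)
    (hα₂ : α < 1 / 2) {R : ℝ} (hR : 0 ≤ R) (hT : 0 ≤ T) :
    ∃ τ > 0, ∀ s₀ : ℝ, ∃ S : M × BoundedRoughPath α T d R → ℝ → M,
        (∀ q, SolOn Z V q.2.1 hT s₀ (s₀ + τ) (S q) ∧ S q s₀ = q.1) ∧
        ContinuousOn (fun q : (M × BoundedRoughPath α T d R) × ℝ => S q.1 q.2)
          (univ ×ˢ Icc s₀ (s₀ + τ)) := by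
  choose U hUo hmU τ hτ hS using
    exists_local_solution (p := p) (Z := Z) (M := M) (d := d) hV hα₁ hα₂ hR hT
  obtain ⟨A, -, hA⟩ := (isCompact_univ (X := M)).elim_nhds_subcover U
    fun m _ => (hUo m).mem_nhds (hmU m)
  obtain ⟨τ', hτ', hle⟩ : ∃ τ' > 0, ∀ m ∈ A, τ' ≤ τ m := by
    rcases A.eq_empty_or_nonempty with rfl | hne
    · exact ⟨1, one_pos, by simp⟩
    · obtain ⟨m, -, hm⟩ := A.exists_min_image τ hne
      exact ⟨τ m, hτ m, hm⟩
  have hcov : ∀ m : M, ∃ i ∈ A, m ∈ U i := fun m => by simpa using hA (mem_univ m)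
  choose i hiA hiU using hcov
  refine ⟨τ', hτ', fun s₀ => ?_⟩
  choose S hsol hcont using fun m => hS m s₀
  have hsol' : ∀ j ∈ A, ∀ q : M × BoundedRoughPath α T d R, q.1 ∈ U j →
      SolOn Z V q.2.1 hT s₀ (s₀ + τ') (S j q) ∧ S j q s₀ = q.1 := fun j hj q hq =>
    ⟨(hsol j q.1 hq q.2).1.mono le_rfl (by linarith [hle j hj]), (hsol j q.1 hq q.2).2⟩
  refine ⟨fun q => S (i q.1) q, fun q => hsol' _ (hiA _) q (hiU _), ?_⟩
  rintro ⟨q₀, t₀⟩ ⟨-, ht₀⟩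
  set j := i q₀.1 with hj
  have hjA : j ∈ A := hiA _
  have h1 : ∀ q : (M × BoundedRoughPath α T d R) × ℝ, q.1.1 ∈ U j → q.2 ∈ Icc s₀ (s₀ + τ') →
      S (i q.1.1) q.1 q.2 = S j q.1 q.2 := fun q hq hqt => by
    have a1 := hsol' _ (hiA q.1.1) q.1 (hiU _)
    have a2 := hsol' j hjA q.1 hq
    exact a1.1.eqOn hV hα₁ hα₂ hR q.1.2.2.1 a2.1 (a1.2.trans a2.2.symm) hqt
  have hsub : Icc s₀ (s₀ + τ') ⊆ Icc s₀ (s₀ + τ j) :=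
    Icc_subset_Icc le_rfl (by linarith [hle j hjA])
  have h2 : ContinuousWithinAt (fun q : (M × BoundedRoughPath α T d R) × ℝ => S j q.1 q.2)
      ((U j ×ˢ univ) ×ˢ Icc s₀ (s₀ + τ')) (q₀, t₀) :=
    ((hcont j).mono (prod_mono le_rfl hsub)) _ ⟨⟨hiU _, mem_univ _⟩, ht₀⟩
  have h3 := h2.congr (fun q hq => h1 q hq.1.1 hq.2) (h1 (q₀, t₀) (hiU _) ht₀)
  refine h3.mono_of_mem_nhdsWithin ?_
  have h4 : ((U j ×ˢ univ) ×ˢ univ : Set ((M × BoundedRoughPath α T d R) × ℝ)) ∈ 𝓝 (q₀, t₀) :=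
    (((hUo j).prod isOpen_univ).prod isOpen_univ).mem_nhds ⟨⟨hiU _, mem_univ _⟩, mem_univ _⟩
  filter_upwards [mem_nhdsWithin_of_mem_nhds h4, self_mem_nhdsWithin] with q hq hq'
  exact ⟨hq.1, hq'.2⟩

/-- Solutions exist on arbitrarily long time intervals and depend continuously on all data. -/
theorem exists_global_solution (hV : ∀ i, IsLeafwiseCkVectorField Z 3 (V i)) (hα₁ : 1 / 3 < α)
    (hα₂ : α < 1 / 2) {R : ℝ} (hR : 0 ≤ R) (hT : 0 ≤ T) (a b : ℝ) :
    ∃ X : M × BoundedRoughPath α T d R → ℝ → M,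
        (∀ q, SolOn Z V q.2.1 hT a b (X q) ∧ X q a = q.1) ∧
        ContinuousOn (fun q : (M × BoundedRoughPath α T d R) × ℝ => X q.1 q.2)
          (univ ×ˢ Icc a b) := by
  obtain ⟨τ₂, hτ₂, hS⟩ := exists_uniform_solution (p := p) (Z := Z) (M := M) (d := d)
    (α := α) (T := T) hV hα₁ hα₂ hR hT
  obtain ⟨τ, hτ, rfl⟩ : ∃ τ > 0, τ₂ = 2 * τ := ⟨τ₂ / 2, by positivity, by ring⟩
  have main : ∀ n : ℕ, ∃ X : M × BoundedRoughPath α T d R → ℝ → M,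
        (∀ q, SolOn Z V q.2.1 hT a (a + (n + 1) * τ) (X q) ∧ X q a = q.1) ∧
        ContinuousOn (fun q : (M × BoundedRoughPath α T d R) × ℝ => X q.1 q.2)
          (univ ×ˢ Icc a (a + (n + 1) * τ)) := by
    intro n
    induction n with
    | zero =>
      obtain ⟨S, h1, h2⟩ := hS a
      have hle : a + ((0 : ℕ) + 1) * τ ≤ a + 2 * τ := by push_cast; linarith
      exact ⟨S, fun q => ⟨(h1 q).1.mono le_rfl hle, (h1 q).2⟩,
        h2.mono (prod_mono le_rfl (Icc_subset_Icc le_rfl hle))⟩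
    | succ n ih =>
      obtain ⟨X, hX, hXc⟩ := ih
      set s := a + n * τ with hs
      obtain ⟨S, h1, h2⟩ := hS s
      have hnτ : 0 ≤ n * τ := by positivity
      have has : a ≤ s := by linarith
      set c := a + (n + 1) * τ with hc
      have hsc : s < c := by rw [hs, hc]; linarith
      have hse : s + 2 * τ = a + ((n + 1 : ℕ) + 1) * τ := by rw [hs]; push_cast; ring
      rw [← hse]
      have hce : c ≤ s + 2 * τ := by rw [hs, hc]; linarith
      -- restart at time `s`, so that the two solutions overlap on `[s, c]`
      set Y : M × BoundedRoughPath α T d R → ℝ → M := fun q => S (X q s, q.2) with hY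
      have hYs : ∀ q, SolOn Z V q.2.1 hT s (s + 2 * τ) (Y q) := fun q => (h1 (X q s, q.2)).1
      have heq : ∀ q, EqOn (X q) (Y q) (Icc s c) := fun q =>
        ((hX q).1.mono has le_rfl).eqOn hV hα₁ hα₂ hR q.2.2.1 ((hYs q).mono le_rfl hce)
          (h1 (X q s, q.2)).2.symm
      refine ⟨fun q t => if t ≤ c then X q t else Y q t, fun q =>
        ⟨(hX q).1.glue hV hsc (by linarith) (hYs q) (heq q), ?_⟩, ?_⟩
      · simp only [has.trans hsc.le, if_true]
        exact (hX q).2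
      · have hXs : Continuous fun q : M × BoundedRoughPath α T d R => X q s :=
          hXc.comp_continuous (f := fun q => (q, s)) (by fun_prop)
            fun q => ⟨mem_univ _, has, hsc.le⟩
        have hYc : ContinuousOn (fun q : (M × BoundedRoughPath α T d R) × ℝ => Y q.1 q.2)
            (univ ×ˢ Icc s (s + 2 * τ)) :=
          h2.comp (f := fun q : (M × BoundedRoughPath α T d R) × ℝ =>
            ((X q.1 s, q.1.2), q.2)) (Continuous.continuousOn (by fun_prop))
            fun q hq => ⟨mem_univ _, hq.2⟩
        have g1 : ContinuousOn (fun q : (M × BoundedRoughPath α T d R) × ℝ =>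
            if q.2 ≤ c then X q.1 q.2 else Y q.1 q.2) (univ ×ˢ Icc a c) :=
          hXc.congr fun q hq => if_pos hq.2.2
        have g2 : ContinuousOn (fun q : (M × BoundedRoughPath α T d R) × ℝ =>
            if q.2 ≤ c then X q.1 q.2 else Y q.1 q.2) (univ ×ˢ Icc s (s + 2 * τ)) :=
          hYc.congr fun q hq => by
            by_cases hqc : q.2 ≤ c
            · simp only [hqc, if_true]
              exact heq q.1 ⟨hq.2.1, hqc⟩
            · simp [hqc]
        refine (g1.union_of_isClosed g2 (isClosed_univ.prod isClosed_Icc)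
          (isClosed_univ.prod isClosed_Icc)).mono fun q hq => ?_
        rcases le_total q.2 c with h | h
        · exact Or.inl ⟨mem_univ _, hq.2.1, h⟩
        · exact Or.inr ⟨mem_univ _, hsc.le.trans h, hq.2.2⟩
  obtain ⟨n, hn⟩ := exists_nat_gt ((b - a) / τ)
  rw [div_lt_iff₀ hτ] at hn
  obtain ⟨X, hX, hXc⟩ := main n
  have hle : b ≤ a + (n + 1) * τ := by linarith
  exact ⟨X, fun q => ⟨(hX q).1.mono le_rfl hle, (hX q).2⟩,
    hXc.mono (prod_mono le_rfl (Icc_subset_Icc le_rfl hle))⟩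

end GlobalTheory

section Bridge

variable {p d : ℕ} {Z M : Type*} [TopologicalSpace Z] [TopologicalSpace M]
  [ChartedSpace (EuclideanSpace ℝ (Fin p) × Z) M]
  {α T : ℝ} {V : Fin (d + 1) → (m : M) → LeafTangentSpace p m}

theorem isRDESolution_iff_solOn (hT : 0 ≤ T) {a b : ℝ} (ha : 0 ≤ a) (hab : a ≤ b) (hb : b ≤ T)
    (w : RoughPath α T d) (m : M) (x : C(Icc a b, M)) :
    IsRDESolution Z V w hab m x ↔
      x ⟨a, left_mem_Icc.2 hab⟩ = m ∧ SolOn Z V w hT a b (fun t => x (projIcc a b hab t)) := by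
  have hcl : ∀ s t (hst : (s, t) ∈ Triangle T), w.W1 hT s t = w.w1 ⟨(s, t), hst⟩ ∧
      w.W2 hT s t = w.w2 ⟨(s, t), hst⟩ := fun s t hst => by
    simp only [RoughPath.W1, RoughPath.W2, clampTri_of_mem hT hst, and_self]
  refine and_congr Iff.rfl ⟨fun h => ⟨?_, fun f hf => ?_⟩, fun h f hf => ?_⟩
  · exact (x.continuous.comp continuous_projIcc).continuousOn
  · obtain ⟨C, hC⟩ := h f hf
    refine ⟨C, fun s t hs hst ht => ?_⟩
    have hsI : s ∈ Icc a b := ⟨hs, hst.trans ht⟩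
    have htI : t ∈ Icc a b := ⟨hs.trans hst, ht⟩
    have hTri : (s, t) ∈ Triangle T := ⟨ha.trans hs, hst, ht.trans hb⟩
    have := hC s t hsI htI hTri
    simpa only [expansion, projIcc_of_mem hab hsI, projIcc_of_mem hab htI, hcl s t hTri] using this
  · obtain ⟨C, hC⟩ := h.2 f hf
    refine ⟨C, fun s t hsI htI hTri => ?_⟩
    have := hC s t hsI.1 hTri.2.1 htI.2
    simpa only [expansion, projIcc_of_mem hab hsI, projIcc_of_mem hab htI, hcl s t hTri] using this

end Bridge

end FoliatedRDE

end

open FoliatedRDE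

theorem mainTheorem4 {p d : ℕ} {Z M : Type*}
    [TopologicalSpace Z] [LocallyCompactSpace Z] [TopologicalSpace.SeparableSpace Z]
    [TopologicalSpace.MetrizableSpace Z]
    [TopologicalSpace M] [CompactSpace M] [TopologicalSpace.MetrizableSpace M]
    [ChartedSpace (EuclideanSpace ℝ (Fin p) × Z) M] [IsFoliatedSpace p Z M]
    (α T : ℝ) (hα₁ : 1 / 3 < α) (hα₂ : α < 1 / 2) (hT : 0 < T)
    (a b : ℝ) (ha : 0 ≤ a) (hab : a ≤ b) (hb : b ≤ T)
    (V : Fin (d + 1) → (m : M) → LeafTangentSpace p m)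
    (hV : ∀ i, IsLeafwiseCkVectorField Z 3 (V i)) :
    ∃ Φ : M × GeometricRoughPath α T d → C(Icc a b, M),
      (∀ (m : M) (w : GeometricRoughPath α T d) (x : C(Icc a b, M)),
        IsRDESolution Z V (w : RoughPath α T d) hab m x ↔ x = Φ (m, w)) ∧
      Continuous Φ := by
  have hbd := fun w : GeometricRoughPath α T d => (w : RoughPath α T d).exists_boundedBy
  choose R hR hRw using hbd
  have hG := fun w₀ : GeometricRoughPath α T d => exists_global_solution (p := p) (Z := Z)
    (M := M) (d := d) (α := α) hV hα₁ hα₂ (hR w₀) hT.le a b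
  choose X hX hXc using hG
  -- continuity of the solutions driven by rough paths near `w₀`
  have hcont : ∀ w₀ : GeometricRoughPath α T d, Continuous fun q :
      {q : M × GeometricRoughPath α T d // edist (q.2 : RoughPath α T d) w₀ < 1} × Icc a b =>
      X w₀ (q.1.1.1, ⟨q.1.1.2, hRw w₀ _ q.1.2, isWeaklyGeometric_of_mem q.1.1.2.2⟩) q.2 := by
    intro w₀
    refine (hXc w₀).comp_continuous (f := fun q :
      {q : M × GeometricRoughPath α T d // edist (q.2 : RoughPath α T d) w₀ < 1} × Icc a b =>
      (((q.1.1.1, ⟨q.1.1.2, hRw w₀ _ q.1.2, isWeaklyGeometric_of_mem q.1.1.2.2⟩) :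
        M × BoundedRoughPath α T d (R w₀)), (q.2 : ℝ))) ?_ fun q => ⟨mem_univ _, q.2.2⟩
    refine (Continuous.prodMk ?_ ?_).prodMk ?_
    · fun_prop
    · exact Continuous.subtype_mk (by fun_prop) _
    · fun_prop
  have hself : ∀ (m : M) (w : GeometricRoughPath α T d), edist (w : RoughPath α T d) w < 1 :=
    fun m w => by simp
  let F : ∀ w₀ : GeometricRoughPath α T d,
      {q : M × GeometricRoughPath α T d // edist (q.2 : RoughPath α T d) w₀ < 1} →
        C(Icc a b, M) := fun w₀ => (ContinuousMap.curry ⟨_, hcont w₀⟩)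
  have hF : ∀ w₀ q (x : C(Icc a b, M)), IsRDESolution Z V (q.1.2 : RoughPath α T d) hab q.1.1 x ↔
      x = F w₀ q := by
    intro w₀ q x
    have h1 := hX w₀
      (q.1.1, ⟨q.1.2, hRw w₀ _ q.2, isWeaklyGeometric_of_mem q.1.2.2⟩)
    have h2 : ∀ t ∈ Icc a b, F w₀ q (projIcc a b hab t) = X w₀
        (q.1.1, ⟨q.1.2, hRw w₀ _ q.2, isWeaklyGeometric_of_mem q.1.2.2⟩) t := fun t ht => by
      rw [projIcc_of_mem hab ht]
      rfl
    rw [isRDESolution_iff_solOn hT.le ha hab hb]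
    have hFa : F w₀ q ⟨a, left_mem_Icc.2 hab⟩ = q.1.1 := h1.2
    constructor
    · rintro ⟨hxa, hx⟩
      have := hx.eqOn hV hα₁ hα₂ (hR w₀) (hRw w₀ _ q.2) (h1.1.congr h2) (by
        simp only [projIcc_left]
        rw [hxa, hFa])
      ext ⟨t, ht⟩
      simpa [projIcc_of_mem hab ht] using this ht
    · rintro rfl
      exact ⟨hFa, h1.1.congr h2⟩
  refine ⟨fun q => F q.2 ⟨q, hself q.1 q.2⟩, fun m w x => hF w ⟨(m, w), hself m w⟩ x, ?_⟩
  refine continuous_iff_continuousAt.2 fun q₀ => ?_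
  have hopen : IsOpen {q : M × GeometricRoughPath α T d |
      edist (q.2 : RoughPath α T d) q₀.2 < 1} :=
    isOpen_lt (by fun_prop) continuous_const
  have hon : ContinuousOn (fun q : M × GeometricRoughPath α T d => F q.2 ⟨q, hself q.1 q.2⟩)
      {q | edist (q.2 : RoughPath α T d) q₀.2 < 1} := by
    rw [continuousOn_iff_continuous_domRestrict]
    refine (ContinuousMap.continuous (ContinuousMap.curry ⟨_, hcont q₀.2⟩)).congr fun q => ?_
    exact (hF q.1.2 ⟨q.1, hself q.1.1 q.1.2⟩ _).1 ((hF q₀.2 q _).2 rfl)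
  exact hon.continuousAt (hopen.mem_nhds (hself q₀.1 q₀.2))
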